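/- **Conventions.** Let $B\subset SU(2)$ be a finite group corresponding, under the McKay correspondence, to an affine diagram $T$ of type $\tilde A_n$ ($n\ge1$), $\tilde D_n$ ($n\ge4$), $\tilde E_6,\tilde E_7$ or $\tilde E_8$ (with $n=6,7,8$ in the last three cases). This means: the vertices $0,\dots,n$ of $T$ are in bijection with the irreducible representations $r_0,\dots,r_n$ of $B$, the affine vertex $0$ corresponds to the trivial representation, and the weight $a_{ij}$ of the edge $ij$ is the multiplicity of $r_j$ in $\mathbb C^2\otimes r_i$. ($\tilde A_1$ has one edge, of weight $2$. The cycle $\tilde A_n$ is numbered along the cycle.) Let $$P_i(q)=\sum_{k\ge0}m_{k,i}q^k,$$ where $m_{k,i}$ is the multiplicity of $r_i$ in the restriction of $\mathrm{Sym}^k\mathbb C^2$ to $B$. Put $z=q+q^{-1}$. *Polynomials of weighted graphs.* For a graph with numbered vertices, without loops, and with edge weights $a_{ij}$, let $S$ be the upper triangular matrix with $1$ on the diagonal and $-a_{ij}$ above it, and let $C=S+S^t$. The Coxeter polynomial of the graph $G$ is $G(q)=\det(qS+q^{-1}S^t)$, and its characteristic polynomial is $G^\#(z)=\det((z-2)E+C)$.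 For $T$ let $H_{ij}(z)$ be the cofactors of $(z-2)E+C$. *The additional vertex.* Add a vertex $-1$ joined to the vertex $0$ by an edge of weight $1$, and put $P_{-1}=q^{-1}$, $H_{-1,0}=T^\#(z)$, $Z_{-1}=q^{-1}(1-q^a)(1-q^b)$. *The numbers $a,b$ and the polynomials $Z_i$* ($i\ge0$), where $(m,n,\dots)$ stands for $q^m+q^n+\cdots$: - $\tilde A_n$: $a=2$, $b=n+1$; $Z_i=(i,\,n+1-i)$. - $\tilde D_n$ (chain $1-2-\dots-(n-1)$, with $0$ joined to $2$ and $n$ joined to $n-2$): $a=4$, $b=2n-4$; $Z_0=(0,2n-2)$; $Z_1=(2,2n-4)$; $Z_i=(i-1,i+1,2n-i-3,2n-i-1)$ for $2\le i\le n-2$; $Z_{n-1}=Z_n=(n-2,n)$. - $\tilde E_6$ (chains $0-1-2-3-4$ and $2-5-6$): $a=6$, $b=8$; $Z_0,\dots,Z_6$ are $(0,12)$; $(1,5,7,11)$; $(2,4,6,6,8,10)$; $(3,5,7,9)$; $(4,8)$; $(3,5,7,9)$; $(4,8)$. - $\tilde E_7$ (chain $0-1-\dots-6$, and $7$ joined to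 $3$): $a=8$, $b=12$; $Z_0,\dots,Z_7$ are $(0,18)$; $(1,7,11,17)$; $(2,6,8,10,12,16)$; $(3,5,7,9,9,11,13,15)$; $(4,6,8,10,12,14)$; $(5,7,11,13)$; $(6,12)$; $(4,8,10,14)$. - $\tilde E_8$ (chain $0-1-\dots-7$, and $8$ joined to $5$): $a=12$, $b=20$; $Z_0,\dots,Z_8$ are $(0,30)$; $(1,11,19,29)$; $(2,10,12,18,20,28)$; $(3,9,11,13,17,19,21,27)$; $(4,8,10,12,14,16,18,20,22,26)$; $(5,7,9,11,13,15,15,17,19,21,23,25)$; $(6,8,12,14,16,18,22,24)$; $(7,13,17,23)$; $(6,10,14,16,20,24)$. *Bezoutian and Wronskian.* For functions $f,g$ of $q$, $$\mathrm{Bez}(f,g)=\frac{f(x)g(y)-f(y)g(x)}{x-y},\qquad \mathrm{Wr}(f,g)=f'g-fg'=\lim_{y\to x}\mathrm{Bez}(f,g).$$ **Statement.** **1)** All $P_i,Z_i,H_{i0}(z)$ ($-1\le i\le n$) are non-zero, and for $-1\le i,j\le n$ $$\frac{P_i(q)}{P_j(q)}=\frac{Z_i(q)}{Z_j(q)}=\frac{H_{i0}(z)}{H_{j0}(z)};\qquad\text{in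 particular}\quad P_i(q)=\frac{H_{i0}(z)}{q\,H_{-1,0}(z)}\quad(i\ge0).$$ *Coxeter polynomials.* In terms of the Coxeter polynomials $A_k,D_k,E_k$ of the Euclidean diagrams ($A_0=1$, $D_2=A_1^2$, $D_3=A_3$): - $\tilde A_n$: $H_{00}=A_n$, and $H_{j0}=A_{j-1}+A_{n-j}$ for $1\le j\le n$. - $\tilde D_n$: $H_{00}=D_n$; $H_{10}=D_{n-2}$; $H_{i0}=A_1D_{n-i}$ for $2\le i\le n-2$; $H_{n-1,0}=H_{n,0}=A_1^2$. - $\tilde E_6$: $H_{00},\dots,H_{60}$ are $E_6,\ A_5,\ A_2^2,\ A_1A_2,\ A_2,\ A_1A_2,\ A_2$. - $\tilde E_7$: $H_{00},\dots,H_{70}$ are $E_7,\ D_6,\ A_5,\ A_1A_3,\ A_1A_2,\ A_1^2,\ A_1,\ A_3$. - $\tilde E_8$: $H_{00},\dots,H_{80}$ are $E_8,\ E_7,\ E_6,\ D_5,\ A_4,\ A_1A_2,\ A_1^2,\ A_1,\ A_2$. Moreover $H_{-1,0}(z)=T(q)$, for any numbering of the vertices if $T$ is not a cycle, and for $\tilde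 A_{2m-1}$ if the vertices of one part of the bipartition are numbered before those of the other part. For the odd cycles, for $m\ge1$, $$q\tilde A_{2m}^\#(z)=q\Bigl(z^{2m+1}-\sum_{i=1}^{m-1}\tbinom{2m+1}{i}\bigl(\tilde A_{2m-2i}^\#(z)+2\bigr)-\tbinom{2m+1}{m}z-2\Bigr)=q^{-2m}(q^{2m+1}-1)^2 .$$ *Branches.* Let $T$ be $\tilde D_n,\tilde E_6,\tilde E_7$ or $\tilde E_8$, and let $v_0,\dots,v_k$ be a path (without repeated vertices) in $T\cup\{-1\}$ whose interior vertices are joined only to their two neighbours in the path. Put $C_t=H_{v_t,0}(z)$. For $1\le i\le k-1$: $$C_{i-1}-zC_i+C_{i+1}=0,\qquad \begin{pmatrix}C_{i-1}&C_i\\C_i&C_{i+1}\end{pmatrix}=\begin{pmatrix}0&1\\-1&z\end{pmatrix}^{i-1}\begin{pmatrix}C_0&C_1\\C_1&C_2\end{pmatrix},$$ $$\frac{C_{i-1}}{C_i}=\begin{vmatrix}C_0&C_1\\C_1&C_2\end{vmatrix}\sum_{j=i+1}^k\frac1{C_{j-1}C_j}+\frac{C_{k-1}}{C_k},\qquad \frac{C_i}{C_{i-1}}=\cfrac1{z-\cfrac1{z-\dots-\cfrac1{z-\frac{C_k}{C_{k-1}}}}}\quad(z\text{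 occurs }k-i\text{ times}),$$ $$\mathrm{Bez}(C_{i-1},C_i)=(1-(xy)^{-1})\sum_{j=i}^{k-1}C_j(x)C_j(y)+\mathrm{Bez}(C_{k-1},C_k),$$ $$\mathrm{Wr}(C_{i-1},C_i)=(1-x^{-2})\sum_{j=i}^{k-1}C_j(x)^2+\mathrm{Wr}(C_{k-1},C_k),$$ where in the last two formulas $C_t$ is regarded as a function of $q\neq 0$. **2)** For $1\le i\le n$ $$P_i^2(q)=\frac1{qH_{-1,0}(z)}\begin{vmatrix}P_0(q)&T_i(q)\\q^{-1}&\tilde T_i(q)\end{vmatrix},$$ where $T_i$ (resp. $\tilde T_i$) is the Coxeter polynomial of the diagram obtained by removing the vertices $0$ and $i$ (resp. the vertex $i$) from $T$. **3)** The series $P_i(q)$ converge for $|q|<1$. For $x,y$ with $0<|x|,|y|<1$ (and $x\ne y$ in the formulas with Bezoutians): - for all $T$, $$\mathrm{Bez}(q^{-1},P_0)=(1-(xy)^{-1})\sum_{k\ge0}P_k(x)P_k(y),\qquad \mathrm{Wr}(q^{-1},P_0)=(1-x^{-2})\sum_{k\ge0}P_k^2(x);$$ - for $\tilde D_n,\tilde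 E_6,\tilde E_7,\tilde E_8$ and $0\le i\le n$, $$\mathrm{Bez}(P_{i\to},P_i)=(1-(xy)^{-1})\sum_{k\in Q_i}P_k(x)P_k(y),\qquad \mathrm{Wr}(P_{i\to},P_i)=(1-x^{-2})\sum_{k\in Q_i}P_k^2(x),$$ where $i\to$ is the unique vertex joined to $i$ and closer to $-1$ than $i$, and $Q_i$ is the set of vertices whose shortest paths to $-1$ contain $i$; - for $\tilde A_n$ and $1\le i\le j\le n$, with $P_{n+1}=P_0$, $$\mathrm{Bez}(P_{i-1},P_i)+\mathrm{Bez}(P_{j+1},P_j)=(1-(xy)^{-1})\sum_{k=i}^jP_k(x)P_k(y),$$ $$\mathrm{Wr}(P_{i-1},P_i)+\mathrm{Wr}(P_{j+1},P_j)=(1-x^{-2})\sum_{k=i}^jP_k^2(x).$$ The same formulas hold, for all non-zero $x,y$, if all $P_i$ are replaced by $Z_i$ and $q^{-1}$ by $q^{-1}(1-q^a)(1-q^b)$. *Matrix versions.* Write any of the above Bezoutian identities as $\mathcal B(x,y)=(1-(xy)^{-1})\sum_{k\in S}f_k(x)f_k(y)$. For points $x_1,\dots,x_m$, $y_1,\dots,y_l$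 with $x_s\ne y_t$ and $x_sy_t\ne1$ for all $s,t$, $$\left(\frac{\mathcal B(x_s,y_t)}{1-(x_sy_t)^{-1}}\right)_{s,t}=\bigl(f_k(x_s)\bigr)_{s,k}\,\bigl(f_k(y_t)\bigr)_{t,k}^{\,t},$$ and for $m=l$ $$\det\left(\frac{\mathcal B(x_s,y_t)}{1-(x_sy_t)^{-1}}\right)=\sum_{\{k_1<\dots<k_m\}\subset S}\det\bigl(f_{k_r}(x_s)\bigr)\det\bigl(f_{k_r}(y_s)\bigr).$$ **4)** For $0\le i\le n$ $$qP_i(q)=\sum_{k\ge0}d^k_{i0}\,z^{-k-1}$$ as power series in $q$, with $z^{-1}=q/(1+q^2)$, where $d^k_{i0}$ is the sum of the weights of all paths of length $k$ from $i$ to $0$ in $T$ (the weight of a path is the product of the weights of its edges). -/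

import Mathlib

open CategoryTheory MonoidalCategory Polynomial

open scoped PowerSeries.WithPiTopology LaurentSeries

namespace Kleinian

/-! ### Weighted graphs, Coxeter polynomials, characteristic polynomials -/

section Graphs

variable {V : Type} [Fintype V] [LinearOrder V]

/-- The upper triangular matrix with `1` on the diagonal and `-a i j` above the diagonal. -/
def seifert {R : Type} [CommRing R] (a : Matrix V V ℕ) : Matrix V V R :=
  Matrix.of fun i j => if i = j then 1 else if i < j then -(a i j : R) else 0

/-- The (symmetrized) Coxeter polynomial `det (q S + q⁻¹ Sᵗ)`, evaluated at an element `q` of a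
field; the vertices are numbered according to the order of `V`. -/
def coxeter {K : Type} [Field K] (q : K) (a : Matrix V V ℕ) : K :=
  Matrix.det (q • seifert a + q⁻¹ • (seifert a).transpose : Matrix V V K)

/-- The matrix `C = S + Sᵗ`. -/
def cartan (a : Matrix V V ℕ) : Matrix V V ℤ := seifert a + (seifert a).transpose

/-- The matrix `(z - 2) E + C` over `ℤ[z]`. -/
noncomputable def charMat (a : Matrix V V ℕ) : Matrix V V ℤ[X] :=
  (X - 2 : ℤ[X]) • (1 : Matrix V V ℤ[X]) + (cartan a).map Polynomial.C

/-- The characteristic polynomial `det ((z - 2) E + C)` of the weighted graph. -/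
noncomputable def charPoly (a : Matrix V V ℕ) : ℤ[X] := (charMat a).det

/-- The cofactor `H i j` of the entry `(i, j)` of `(z - 2) E + C`
(the adjugate is the transpose of the cofactor matrix). -/
noncomputable def cofactor (a : Matrix V V ℕ) (i j : V) : ℤ[X] := (charMat a).adjugate j i

/-- Remove the vertices in `s` from a weighted graph. -/
def removeVertices (a : Matrix V V ℕ) (s : Finset V) :
    Matrix {v : V // v ∉ s} {v : V // v ∉ s} ℕ :=
  a.submatrix Subtype.val Subtype.val

/-- The sum of the weights of all paths of length `k` from `i` to `j` (vertices may repeat), the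
weight of a path being the product of the weights of its edges. A sequence of vertices which is
not a path contributes `0`. -/
def weightedPaths (a : Matrix V V ℕ) (k : ℕ) (i j : V) : ℕ :=
  ∑ v : Fin (k + 1) → V with v 0 = i ∧ v (Fin.last k) = j,
    ∏ t : Fin k, a (v t.castSucc) (v t.succ)

end Graphs

/-- The symmetric weight matrix on the vertices `0, …, N - 1` with one edge for every pair `(i, j)`
with `E i j` (pairs containing numbers `≥ N` are ignored). If both `E i j` and `E j i` hold, the
weight of the edge is `2`. -/
def diagram (N : ℕ) (E : ℕ → ℕ → Bool) : Matrix (Fin N) (Fin N) ℕ :=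
  Matrix.of fun i j => (E i j).toNat + (E j i).toNat

/-! ### Euclidean diagrams -/

/-- The chain `A_k`. -/
def dynkinA (k : ℕ) : Matrix (Fin k) (Fin k) ℕ :=
  diagram k fun i j => decide (j = i + 1)

/-- The diagram `D_k`: the chain `1 - 2 - ⋯ - (k - 1)`, and the vertex `0` joined to `2`.
So `D_2 = A_1 ⊔ A_1` and `D_3 = A_3`. -/
def dynkinD (k : ℕ) : Matrix (Fin k) (Fin k) ℕ :=
  diagram k fun i j => decide ((i = 0 ∧ j = 2) ∨ (1 ≤ i ∧ j = i + 1))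

/-- The diagram `E_k` (`k = 6, 7, 8`): the chain `0 - 1 - ⋯ - (k - 2)`, and the vertex `k - 1`
joined to `2`. -/
def dynkinE (k : ℕ) : Matrix (Fin k) (Fin k) ℕ :=
  diagram k fun i j => decide ((j = i + 1 ∧ j + 1 < k) ∨ (i = 2 ∧ j + 1 = k))

/-! ### Affine diagrams -/

/-- The cycle `Ã_n` with `n + 1` vertices, numbered along the cycle
(for `n = 1`: two vertices joined by an edge of weight `2`). -/
def cycle (n : ℕ) : Matrix (Fin (n + 1)) (Fin (n + 1)) ℕ :=
  diagram (n + 1) fun i j => decide (j = i + 1 ∨ (i = n ∧ j = 0))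

/-- The affine diagrams `Ã_n` (`n ≥ 1`), `D̃_n` (`n ≥ 4`), `Ẽ_6`, `Ẽ_7`, `Ẽ_8`. -/
inductive AffineDiagram : Type
  | A (n : ℕ) (hn : 1 ≤ n)
  | D (n : ℕ) (hn : 4 ≤ n)
  | E6
  | E7
  | E8

namespace AffineDiagram

/-- The number `n` in the name of the diagram; the vertices are numbered `0, …, n`. -/
def rank : AffineDiagram → ℕ
  | A n _ => n
  | D n _ => n
  | E6 => 6
  | E7 => 7
  | E8 => 8

/-- The vertices. The affine vertex is `0`. -/
abbrev Vertex (T : AffineDiagram) : Type := Fin (T.rank + 1)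

/-- The weights of the edges.
* `D̃_n`: the chain `1 - 2 - ⋯ - (n - 1)`, with `0` joined to `2` and `n` joined to `n - 2`;
* `Ẽ_6`: the chain `0 - 1 - 2 - 3 - 4` and the chain `2 - 5 - 6`;
* `Ẽ_7`: the chain `0 - 1 - ⋯ - 6`, and `7` joined to `3`;
* `Ẽ_8`: the chain `0 - 1 - ⋯ - 7`, and `8` joined to `5`. -/
def adj : (T : AffineDiagram) → Matrix T.Vertex T.Vertex ℕ
  | A n _ => cycle n
  | D n _ => diagram (n + 1) fun i j =>
      decide ((i = 0 ∧ j = 2) ∨ (1 ≤ i ∧ j = i + 1 ∧ j < n) ∨ (i + 2 = n ∧ j = n))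
  | E6 => diagram 7 fun i j =>
      decide ((i, j) ∈ [(0, 1), (1, 2), (2, 3), (3, 4), (2, 5), (5, 6)])
  | E7 => diagram 8 fun i j =>
      decide ((i, j) ∈ [(0, 1), (1, 2), (2, 3), (3, 4), (4, 5), (5, 6), (3, 7)])
  | E8 => diagram 9 fun i j =>
      decide ((i, j) ∈ [(0, 1), (1, 2), (2, 3), (3, 4), (4, 5), (5, 6), (6, 7), (5, 8)])

/-- The diagram is a cycle `Ã_n`. -/
def IsCycle : AffineDiagram → Prop
  | A _ _ => True
  | _ => False

/-- The number `a` in the denominator `(1 - q ^ a) (1 - q ^ b)`. -/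
def expA : AffineDiagram → ℕ
  | A _ _ => 2
  | D _ _ => 4
  | E6 => 6
  | E7 => 8
  | E8 => 12

/-- The number `b` in the denominator `(1 - q ^ a) (1 - q ^ b)`. -/
def expB : AffineDiagram → ℕ
  | A n _ => n + 1
  | D n _ => 2 * n - 4
  | E6 => 8
  | E7 => 12
  | E8 => 20

/-- The exponents of the monomials of `Z_i`, with multiplicity. -/
def zExps : (T : AffineDiagram) → T.Vertex → List ℕ
  | A n _, i => [i.val, n + 1 - i.val]
  | D n _, i =>
      if i.val = 0 then [0, 2 * n - 2]
      else if i.val = 1 then [2, 2 * n - 4]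
      else if i.val + 2 ≤ n then
        [i.val - 1, i.val + 1, 2 * n - i.val - 3, 2 * n - i.val - 1]
      else [n - 2, n]
  | E6, i =>
      [[0, 12], [1, 5, 7, 11], [2, 4, 6, 6, 8, 10], [3, 5, 7, 9], [4, 8],
        [3, 5, 7, 9], [4, 8]].getD i.val []
  | E7, i =>
      [[0, 18], [1, 7, 11, 17], [2, 6, 8, 10, 12, 16], [3, 5, 7, 9, 9, 11, 13, 15],
        [4, 6, 8, 10, 12, 14], [5, 7, 11, 13], [6, 12], [4, 8, 10, 14]].getD i.val []
  | E8, i =>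
      [[0, 30], [1, 11, 19, 29], [2, 10, 12, 18, 20, 28], [3, 9, 11, 13, 17, 19, 21, 27],
        [4, 8, 10, 12, 14, 16, 18, 20, 22, 26], [5, 7, 9, 11, 13, 15, 15, 17, 19, 21, 23, 25],
        [6, 8, 12, 14, 16, 18, 22, 24], [7, 13, 17, 23], [6, 10, 14, 16, 20, 24]].getD i.val []

/-- The polynomials `Z_i`. -/
noncomputable def zPoly (T : AffineDiagram) (i : T.Vertex) : ℤ[X] :=
  ((T.zExps i).map fun k => (X : ℤ[X]) ^ k).sum

/-- Expressions in Coxeter polynomials of Euclidean diagrams (the polynomials `H_{i0}`). -/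
def coxeterExpr {K : Type} [Field K] (q : K) : (T : AffineDiagram) → T.Vertex → K
  | A n _, i =>
      if i.val = 0 then coxeter q (dynkinA n)
      else coxeter q (dynkinA (i.val - 1)) + coxeter q (dynkinA (n - i.val))
  | D n _, i =>
      if i.val = 0 then coxeter q (dynkinD n)
      else if i.val = 1 then coxeter q (dynkinD (n - 2))
      else if i.val + 2 ≤ n then coxeter q (dynkinA 1) * coxeter q (dynkinD (n - i.val))
      else coxeter q (dynkinA 1) ^ 2
  | E6, i =>
      [coxeter q (dynkinE 6), coxeter q (dynkinA 5), coxeter q (dynkinA 2) ^ 2,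
        coxeter q (dynkinA 1) * coxeter q (dynkinA 2), coxeter q (dynkinA 2),
        coxeter q (dynkinA 1) * coxeter q (dynkinA 2), coxeter q (dynkinA 2)].getD i.val 0
  | E7, i =>
      [coxeter q (dynkinE 7), coxeter q (dynkinD 6), coxeter q (dynkinA 5),
        coxeter q (dynkinA 1) * coxeter q (dynkinA 3),
        coxeter q (dynkinA 1) * coxeter q (dynkinA 2), coxeter q (dynkinA 1) ^ 2,
        coxeter q (dynkinA 1), coxeter q (dynkinA 3)].getD i.val 0
  | E8, i =>
      [coxeter q (dynkinE 8), coxeter q (dynkinE 7), coxeter q (dynkinE 6),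
        coxeter q (dynkinD 5), coxeter q (dynkinA 4),
        coxeter q (dynkinA 1) * coxeter q (dynkinA 2), coxeter q (dynkinA 1) ^ 2,
        coxeter q (dynkinA 1), coxeter q (dynkinA 2)].getD i.val 0

/-! The additional vertex `-1`, joined to `0`, is `none : Option T.Vertex`. -/

/-- The polynomials `H_{i0}` in `z`; `H_{-1,0}` is the characteristic polynomial. -/
noncomputable def hPoly (T : AffineDiagram) : Option T.Vertex → ℤ[X]
  | none => charPoly T.adj
  | some i => cofactor T.adj i 0

/-- The diagram with the additional vertex `-1`, as a graph. -/
def extGraph (T : AffineDiagram) : SimpleGraph (Option T.Vertex) :=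
  SimpleGraph.fromRel fun u v =>
    match u, v with
    | none, some i => i = 0
    | some i, some j => T.adj i j ≠ 0
    | _, _ => False

/-- `p` is a vertex `i→`: it is joined to `i` and is closer to `-1` than `i`. -/
def IsNext (T : AffineDiagram) (i : T.Vertex) (p : Option T.Vertex) : Prop :=
  T.extGraph.Adj (some i) p ∧ T.extGraph.dist p none < T.extGraph.dist (some i) none

open Classical in
/-- `Q_i`: the vertices whose shortest paths to `-1` contain `i`. -/
noncomputable def beyond (T : AffineDiagram) (i : T.Vertex) : Finset T.Vertex :=
  Finset.univ.filter fun k => ∀ w : T.extGraph.Walk (some k) none,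
    w.length = T.extGraph.dist (some k) none → some i ∈ w.support

/-- `v 0, …, v k` is a path in the extended diagram whose interior vertices are joined to their
two neighbours in the path and to no other vertex. -/
structure IsBranch (T : AffineDiagram) (k : ℕ) (v : ℕ → Option T.Vertex) : Prop where
  injOn : Set.InjOn v (Set.Iic k)
  adj : ∀ t < k, T.extGraph.Adj (v t) (v (t + 1))
  interior : ∀ t, 1 ≤ t → t < k → T.extGraph.neighborSet (v t) = {v (t - 1), v (t + 1)}

end AffineDiagram

/-! ### Representations of finite subgroups of `SU(2)` -/

/-- `SU(2)`. -/
abbrev SU2 : Type := Matrix.specialUnitaryGroup (Fin 2) ℂ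

section Representations

/-- The endomorphism of `ℂ[X₀, X₁] = Sym (ℂ²)` induced by a matrix: `X_j ↦ ∑ i, M i j X_i`. -/
noncomputable def symHom (M : Matrix (Fin 2) (Fin 2) ℂ) :
    MvPolynomial (Fin 2) ℂ →ₐ[ℂ] MvPolynomial (Fin 2) ℂ :=
  MvPolynomial.aeval fun j => ∑ i, MvPolynomial.C (M i j) * MvPolynomial.X i

theorem symHom_one : symHom 1 = AlgHom.id ℂ _ := by
  refine MvPolynomial.algHom_ext fun j => ?_
  fin_cases j <;> simp [symHom, Fin.sum_univ_two]

theorem symHom_mul (M N : Matrix (Fin 2) (Fin 2) ℂ) :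
    symHom (M * N) = (symHom M).comp (symHom N) := by
  refine MvPolynomial.algHom_ext fun j => ?_
  simp only [symHom, AlgHom.comp_apply, MvPolynomial.aeval_X, Fin.sum_univ_two, map_add, map_mul,
    Matrix.mul_apply, MvPolynomial.aeval_C, MvPolynomial.algebraMap_eq]
  ring

theorem symHom_mem (M : Matrix (Fin 2) (Fin 2) ℂ) (n : ℕ) :
    ∀ p ∈ MvPolynomial.homogeneousSubmodule (Fin 2) ℂ n,
      (symHom M).toLinearMap p ∈ MvPolynomial.homogeneousSubmodule (Fin 2) ℂ n := by
  intro p hp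
  have h : ∀ j, (∑ i, MvPolynomial.C (M i j) * MvPolynomial.X i :
      MvPolynomial (Fin 2) ℂ).IsHomogeneous 1 := fun j =>
    MvPolynomial.IsHomogeneous.sum _ _ _ fun i _ => MvPolynomial.isHomogeneous_C_mul_X _ _
  have h2 := MvPolynomial.IsHomogeneous.aeval hp _ h
  simpa [symHom] using h2

instance (n : ℕ) : Module.Finite ℂ (MvPolynomial.homogeneousSubmodule (Fin 2) ℂ n) :=
  Module.Finite.iff_fg.2 (MvPolynomial.homogeneousSubmodule_fg _ _ n)

variable (B : Subgroup SU2)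

/-- The inclusion of `B` into the `2 × 2` matrices. -/
def toMatrixHom : B →* Matrix (Fin 2) (Fin 2) ℂ :=
  (Submonoid.subtype _).comp B.subtype

/-- The standard two-dimensional representation, restricted to `B`. -/
noncomputable def stdRep : FDRep ℂ B :=
  FDRep.of (V := Fin 2 → ℂ)
    ((Matrix.toLinAlgEquiv' : Matrix (Fin 2) (Fin 2) ℂ ≃ₐ[ℂ] _).toAlgHom.toMonoidHom.comp
      (toMatrixHom B))

/-- The action on the `n`-th symmetric power of `ℂ²` (the homogeneous polynomials of degree `n`
in the basis vectors), restricted to `B`. -/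
noncomputable def symRepresentation (n : ℕ) :
    Representation ℂ B (MvPolynomial.homogeneousSubmodule (Fin 2) ℂ n) where
  toFun g := (symHom (toMatrixHom B g)).toLinearMap.restrict (symHom_mem _ n)
  map_one' := by
    ext1 p
    apply Subtype.ext
    simp [symHom_one, LinearMap.restrict_apply]
  map_mul' g h := by
    ext1 p
    apply Subtype.ext
    simp [symHom_mul, LinearMap.restrict_apply]

/-- The `n`-th symmetric power of the standard representation, restricted to `B`. -/
noncomputable def symRep (n : ℕ) : FDRep ℂ B := FDRep.of (symRepresentation B n)

/-- The multiplicity of an irreducible representation `r` in `W`. -/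
noncomputable def multiplicity {B : Subgroup SU2} (r W : FDRep ℂ B) : ℕ :=
  Module.finrank ℂ (r ⟶ W)

/-- The subgroup `B` of `SU(2)` corresponds to the diagram `T`: the vertices of `T` are in
bijection with the isomorphism classes of irreducible representations of `B`, the affine vertex
with the trivial representation, and the weight of the edge `ij` is the multiplicity of `r j` in
the tensor product of the standard representation with `r i`. -/
structure McKay (T : AffineDiagram) where
  /-- The irreducible representations. -/
  r : T.Vertex → FDRep ℂ B
  simple : ∀ i, Simple (r i)
  trivial : Nonempty (r 0 ≅ 𝟙_ (FDRep ℂ B))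
  injective : ∀ i j, Nonempty (r i ≅ r j) → i = j
  complete : ∀ W : FDRep ℂ B, Simple W → ∃ i, Nonempty (W ≅ r i)
  tensor : ∀ i j, multiplicity (r j) (stdRep B ⊗ r i) = T.adj i j

end Representations

/-! ### Formal series in `q` -/

/-- The variable `q` in the field of Laurent series. -/
noncomputable def qL : ℚ⸨X⸩ := HahnSeries.single 1 1

/-- `z = q + q⁻¹`. -/
noncomputable def zL : ℚ⸨X⸩ := qL + qL⁻¹

/-- `z⁻¹` as a power series in `q`. -/
noncomputable def zInv : PowerSeries ℚ := PowerSeries.X * (1 + PowerSeries.X ^ 2)⁻¹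

theorem coe_zInv : ((zInv : PowerSeries ℚ) : ℚ⸨X⸩) = zL⁻¹ := by
  have hq : ((PowerSeries.X : PowerSeries ℚ) : ℚ⸨X⸩) = qL := by
    simp [qL, HahnSeries.ofPowerSeries_X]
  have hq0 : qL ≠ 0 := by simp [qL]
  have h1 : zInv * (1 + PowerSeries.X ^ 2) = PowerSeries.X := by
    rw [zInv, mul_assoc, PowerSeries.inv_mul_cancel _ (by simp), mul_one]
  have h2 := congrArg (fun p : PowerSeries ℚ => (p : ℚ⸨X⸩)) h1
  simp only [PowerSeries.coe_mul, PowerSeries.coe_add, PowerSeries.coe_one, PowerSeries.coe_pow,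
    hq] at h2
  apply eq_inv_of_mul_eq_one_left
  rw [zL]
  have h3 : qL + qL⁻¹ = (1 + qL ^ 2) * qL⁻¹ := by field_simp; ring
  rw [h3, ← mul_assoc, h2, mul_inv_cancel₀ hq0]

variable {B : Subgroup SU2} {T : AffineDiagram}

/-- The coefficient of `q ^ n` in the Poincaré series `P_i`. -/
noncomputable def McKay.mult (M : McKay B T) (n : ℕ) (i : T.Vertex) : ℕ :=
  multiplicity (M.r i) (symRep B n)

/-- The Poincaré series `P_i`. -/
noncomputable def McKay.poincare (M : McKay B T) (i : T.Vertex) : PowerSeries ℚ :=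
  PowerSeries.mk fun n => (M.mult n i : ℚ)

/-- The Poincaré series as Laurent series, with `P_{-1} = q⁻¹`. -/
noncomputable def McKay.pL (M : McKay B T) : Option T.Vertex → ℚ⸨X⸩
  | none => qL⁻¹
  | some i => (M.poincare i : ℚ⸨X⸩)

/-- The polynomials `Z_i` as Laurent series, with `Z_{-1} = q⁻¹ (1 - q ^ a) (1 - q ^ b)`. -/
noncomputable def AffineDiagram.zSeries (T : AffineDiagram) : Option T.Vertex → ℚ⸨X⸩
  | none => qL⁻¹ * (1 - qL ^ T.expA) * (1 - qL ^ T.expB)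
  | some i => aeval qL (T.zPoly i)

/-- `H_{i0}(z)` as a Laurent series in `q`. -/
noncomputable def AffineDiagram.hSeries (T : AffineDiagram) (i : Option T.Vertex) : ℚ⸨X⸩ :=
  aeval zL (T.hPoly i)

/-! ### Functions of `q`, Bezoutians and Wronskians -/

/-- `0 < |q| < 1`. -/
def puncturedDisc : Set ℂ := {q | 0 < ‖q‖ ∧ ‖q‖ < 1}

/-- The sum of the Poincaré series at a complex number, with `P_{-1}(q) = q⁻¹`. -/
noncomputable def McKay.pFun (M : McKay B T) : Option T.Vertex → ℂ → ℂ
  | none, q => q⁻¹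
  | some i, q => ∑' n, (M.mult n i : ℂ) * q ^ n

/-- `Z_i(q)`, with `Z_{-1}(q) = q⁻¹ (1 - q ^ a) (1 - q ^ b)`. -/
noncomputable def AffineDiagram.zFun (T : AffineDiagram) : Option T.Vertex → ℂ → ℂ
  | none, q => q⁻¹ * (1 - q ^ T.expA) * (1 - q ^ T.expB)
  | some i, q => aeval q (T.zPoly i)

/-- `H_{i0}(q + q⁻¹)`. -/
noncomputable def AffineDiagram.hFun (T : AffineDiagram) (i : Option T.Vertex) (q : ℂ) : ℂ :=
  aeval (q + q⁻¹) (T.hPoly i)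

/-- The Bezoutian. -/
noncomputable def bez (f g : ℂ → ℂ) (x y : ℂ) : ℂ := (f x * g y - f y * g x) / (x - y)

/-- The Wronskian `f' g - f g'`. -/
noncomputable def wr (f g : ℂ → ℂ) (x : ℂ) : ℂ := deriv f x * g x - f x * deriv g x

/-- The Christoffel–Darboux identities on `Ω`, for a (sum of) Bezoutian(s) `Bz`, the corresponding
Wronskian(s) `W`, and functions `f k`, `k ∈ S`:
* `Bz (x, y) = (1 - (x y)⁻¹) ∑ f_k(x) f_k(y)` and `W (x) = (1 - x⁻²) ∑ f_k(x)²`;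
* the matrix version, for several variables `x_s`, `y_t`;
* its determinant, for equally many variables `x_s` and `y_t`. The sum is over the `m`-element
  subsets `k_1 < ⋯ < k_m` of `S`. -/
structure ChristoffelDarboux {ι : Type} [LinearOrder ι] (Ω : Set ℂ) (Bz : ℂ → ℂ → ℂ) (W : ℂ → ℂ)
    (S : Finset ι) (f : ι → ℂ → ℂ) : Prop where
  bezoutian : ∀ x ∈ Ω, ∀ y ∈ Ω, x ≠ y →
    Bz x y = (1 - (x * y)⁻¹) * ∑ k ∈ S, f k x * f k y
  wronskian : ∀ x ∈ Ω, W x = (1 - (x ^ 2)⁻¹) * ∑ k ∈ S, f k x ^ 2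
  matrix : ∀ (m l : ℕ) (x : Fin m → ℂ) (y : Fin l → ℂ), (∀ s, x s ∈ Ω) → (∀ t, y t ∈ Ω) →
    (∀ s t, x s ≠ y t ∧ x s * y t ≠ 1) →
    Matrix.of (fun s t => Bz (x s) (y t) / (1 - (x s * y t)⁻¹)) =
      Matrix.of (fun s (k : S) => f k (x s)) *
        (Matrix.of (fun t (k : S) => f k (y t))).transpose
  det : ∀ (m : ℕ) (x y : Fin m → ℂ), (∀ s, x s ∈ Ω) → (∀ t, y t ∈ Ω) →
    (∀ s t, x s ≠ y t ∧ x s * y t ≠ 1) →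
    (Matrix.of (fun s t => Bz (x s) (y t) / (1 - (x s * y t)⁻¹))).det =
      ∑ K ∈ (S.powersetCard m).attach,
        (Matrix.of fun s r =>
          f (K.1.orderEmbOfFin (Finset.mem_powersetCard.1 K.2).2 r) (x s)).det *
        (Matrix.of fun t r =>
          f (K.1.orderEmbOfFin (Finset.mem_powersetCard.1 K.2).2 r) (y t)).det

/-- The identities for the family `F` (`F none` belongs to the vertex `-1`):
* for all diagrams, with the sum over all vertices of the diagram;
* for `D̃_n`, `Ẽ_6`, `Ẽ_7`, `Ẽ_8`: for every vertex `i`, the vertex `i→` and the set `Q_i`;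
* for `Ã_n`: for `1 ≤ i ≤ j ≤ n`, where the index `n + 1` means `0`. -/
structure BezoutIdentities (T : AffineDiagram) (Ω : Set ℂ) (F : Option T.Vertex → ℂ → ℂ) :
    Prop where
  all : ChristoffelDarboux Ω (bez (F none) (F (some 0))) (wr (F none) (F (some 0)))
    Finset.univ (fun k => F (some k))
  tree : ¬ T.IsCycle → ∀ i : T.Vertex, ∀ p, T.IsNext i p →
    ChristoffelDarboux Ω (bez (F p) (F (some i))) (wr (F p) (F (some i)))
      (T.beyond i) (fun k => F (some k))
  cycle : T.IsCycle → ∀ i j : ℕ, 1 ≤ i → i ≤ j → j ≤ T.rank →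
    let f : ℕ → ℂ → ℂ := fun k => F (some (Fin.ofNat (T.rank + 1) k))
    ChristoffelDarboux Ω
      (fun x y => bez (f (i - 1)) (f i) x y + bez (f (j + 1)) (f j) x y)
      (fun x => wr (f (i - 1)) (f i) x + wr (f (j + 1)) (f j) x)
      (Finset.Icc i j) f

/-- The continued fraction `1 / (z - 1 / (z - ⋯ - 1 / (z - r)))` with `m` occurrences of `z`. -/
def contFrac {K : Type} [Field K] (z r : K) : ℕ → K
  | 0 => r
  | m + 1 => 1 / (z - contFrac z r m)

/-- The formulas for the polynomials `C_t = H_{v_t,0}` along a branch `v 0, …, v k`. -/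
structure BranchFormulas (T : AffineDiagram) (k : ℕ) (v : ℕ → Option T.Vertex) : Prop where
  recurrence : ∀ i, 1 ≤ i → i < k →
    T.hSeries (v (i - 1)) - zL * T.hSeries (v i) + T.hSeries (v (i + 1)) = 0
  transfer : ∀ i, 1 ≤ i → i < k →
    !![T.hSeries (v (i - 1)), T.hSeries (v i); T.hSeries (v i), T.hSeries (v (i + 1))] =
      !![0, 1; -1, zL] ^ (i - 1) *
        !![T.hSeries (v 0), T.hSeries (v 1); T.hSeries (v 1), T.hSeries (v 2)]
  quotient : ∀ i, 1 ≤ i → i < k →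
    T.hSeries (v (i - 1)) / T.hSeries (v i) =
      (!![T.hSeries (v 0), T.hSeries (v 1); T.hSeries (v 1), T.hSeries (v 2)]).det *
        ∑ j ∈ Finset.Icc (i + 1) k, 1 / (T.hSeries (v (j - 1)) * T.hSeries (v j)) +
      T.hSeries (v (k - 1)) / T.hSeries (v k)
  continuedFraction : ∀ i, 1 ≤ i → i < k →
    T.hSeries (v i) / T.hSeries (v (i - 1)) =
      contFrac zL (T.hSeries (v k) / T.hSeries (v (k - 1))) (k - i)
  bezoutian : ∀ i, 1 ≤ i → i < k → ∀ x y : ℂ, x ≠ 0 → y ≠ 0 → x ≠ y →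
    bez (T.hFun (v (i - 1))) (T.hFun (v i)) x y =
      (1 - (x * y)⁻¹) * ∑ j ∈ Finset.Ico i k, T.hFun (v j) x * T.hFun (v j) y +
      bez (T.hFun (v (k - 1))) (T.hFun (v k)) x y
  wronskian : ∀ i, 1 ≤ i → i < k → ∀ x : ℂ, x ≠ 0 →
    wr (T.hFun (v (i - 1))) (T.hFun (v i)) x =
      (1 - (x ^ 2)⁻¹) * ∑ j ∈ Finset.Ico i k, T.hFun (v j) x ^ 2 +
      wr (T.hFun (v (k - 1))) (T.hFun (v k)) x

end Kleinian

/-!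
Put `z = q + q⁻¹` and let `A` be the matrix of the edge weights of the affine diagram `T`.
Everything follows from one linear system: the Poincaré series solve `(z E - A) P = q⁻¹ e₀`.

For the Poincaré series this is the Clebsch–Gordan rule `ℂ² ⊗ Symⁿ = Symⁿ⁺¹ ⊕ Symⁿ⁻¹`, combined with
the definition of the McKay correspondence (`McKay.mult_add_two`). The rule is proved on the level of
characters; its only input is a recurrence for the traces of a matrix on homogeneous polynomials
in two variables. The polynomials `Z_i` solve the same system with the right-hand side
`q⁻¹ (1 - q ^ a) (1 - q ^ b) e₀` (`AffineDiagram.zPoly_eq`), and the cofactors `H_{i0}` solve it with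
the right-hand side `H_{-1,0} e₀` (`AffineDiagram.hPoly_eq`). Since `det (z E - A)` is not zero as a
Laurent series, the three families are proportional by Cramer's rule. Therefore one `H_{i0}` and the
explicit `Z_i` determine all the others.

A Coxeter polynomial `det (q S + q⁻¹ Sᵗ)` equals `det (z E - A)` whenever the two matrices are
conjugate by a diagonal matrix. On a forest every multiplicative cocycle is a coboundary, so this
holds for every numbering (`coxeter_eq_det_of_isParent`). The formula for `P_i ^ 2` is Jacobi's
identity for the two-by-two minors of the adjugate of the symmetric matrix `z E - A`.

The formulas for the Bezoutians and Wronskians are Green's formula for the operator `A`, on a set of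
vertices which is joined to its complement by one edge (for a cycle: by two edges), applied to the
pairs `F(x), F(y)` and `F'(x), F(x)` (`AffineDiagram.IsHarmonic.christoffelDarboux`). The set `Q_i`
is the set of descendants of `i` in the tree with the root `-1`, hence only the edge from `i` to
`i→` leaves it. The matrix versions follow by the Cauchy–Binet formula. The series converge because
`∑ i, Z_i(1) m_{n,i}` is an arithmetic progression in `n`.

Finally, the system can be written `q P = z⁻¹ (A q P + e₀)`, and its iteration is the expansion in
powers of `z⁻¹`.
-/

namespace Kleinian

/-! ### Dimensions of spaces of morphisms in a semisimple category -/

section Hom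
open Limits
variable {k : Type*} [Field k] {C : Type*} [Category C] [Preadditive C] [Linear k C]
  [HasBinaryBiproducts C] [∀ X Y : C, FiniteDimensional k (X ⟶ Y)]

theorem finrank_hom_biprod_right (X Y Z : C) :
    Module.finrank k (X ⟶ Y ⊞ Z) = Module.finrank k (X ⟶ Y) + Module.finrank k (X ⟶ Z) := by
  rw [← Module.finrank_prod]
  exact LinearEquiv.finrank_eq
    { toFun := fun f => (f ≫ biprod.fst, f ≫ biprod.snd)
      invFun := fun f => biprod.lift f.1 f.2
      map_add' := fun f g => by simp
      map_smul' := fun c f => by simp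
      left_inv := fun f => by ext <;> simp
      right_inv := fun f => by simp }

theorem finrank_hom_biprod_left (X Y Z : C) :
    Module.finrank k (Y ⊞ Z ⟶ X) = Module.finrank k (Y ⟶ X) + Module.finrank k (Z ⟶ X) := by
  rw [← Module.finrank_prod]
  exact LinearEquiv.finrank_eq
    { toFun := fun f => (biprod.inl ≫ f, biprod.inr ≫ f)
      invFun := fun f => biprod.desc f.1 f.2
      map_add' := fun f g => by simp
      map_smul' := fun c f => by simp
      left_inv := fun f => by ext <;> simp
      right_inv := fun f => by simp }

omit [HasBinaryBiproducts C] [∀ X Y : C, FiniteDimensional k (X ⟶ Y)] in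
theorem finrank_hom_congr_left {X Y : C} (e : X ≅ Y) (Z : C) :
    Module.finrank k (X ⟶ Z) = Module.finrank k (Y ⟶ Z) :=
  (Linear.homCongr k e (Iso.refl Z)).finrank_eq

omit [HasBinaryBiproducts C] [∀ X Y : C, FiniteDimensional k (X ⟶ Y)] in
theorem finrank_hom_congr_right {X Y : C} (e : X ≅ Y) (Z : C) :
    Module.finrank k (Z ⟶ X) = Module.finrank k (Z ⟶ Y) :=
  (Linear.homCongr k (Iso.refl Z) e).finrank_eq

omit [HasBinaryBiproducts C] in
theorem finrank_end_pos {X : C} (h : ¬ IsZero X) : 0 < Module.finrank k (X ⟶ X) :=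
  Module.finrank_pos_iff_exists_ne_zero.2 ⟨𝟙 X, fun h0 => h ((IsZero.iff_id_eq_zero X).2 h0)⟩

end Hom

/-- In a semisimple category whose simple objects are, up to isomorphism, the pairwise
non-isomorphic `r j`, the dimension of a space of morphisms is the scalar product of the vectors
of multiplicities. -/
theorem finrank_hom_eq_sum {k : Type*} [Field k] {C : Type*} [Category C]
    [Abelian C] [Linear k C] [∀ X Y : C, FiniteDimensional k (X ⟶ Y)]
    (inj : ∀ X : C, Injective X) {ι : Type*} [Fintype ι] [DecidableEq ι] (r : ι → C)
    (hr : ∀ i j, Module.finrank k (r i ⟶ r j) = if i = j then 1 else 0)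
    (complete : ∀ W : C, Simple W → ∃ i, Nonempty (W ≅ r i)) (W X : C) :
    Module.finrank k (W ⟶ X) =
      ∑ j, Module.finrank k (r j ⟶ W) * Module.finrank k (r j ⟶ X) := by
  -- Induction on the dimension of `End W`: if `W` is neither zero nor simple, then it is a direct
  -- sum of two non-zero objects.
  induction hn : Module.finrank k (W ⟶ W) using Nat.strong_induction_on generalizing W with
  | _ n ih =>
  subst hn
  by_cases hW : Limits.IsZero W
  · have h1 : Module.finrank k (W ⟶ X) = 0 := by
      have : Subsingleton (W ⟶ X) := ⟨fun f g => hW.eq_of_src f g⟩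
      exact Module.finrank_zero_of_subsingleton
    have h2 : ∀ j, Module.finrank k (r j ⟶ W) = 0 := fun j => by
      have : Subsingleton (r j ⟶ W) := ⟨fun f g => hW.eq_of_tgt f g⟩
      exact Module.finrank_zero_of_subsingleton
    simp [h1, h2]
  by_cases hs : Simple W
  · obtain ⟨i, ⟨e⟩⟩ := complete W hs
    simp [finrank_hom_congr_left e X, finrank_hom_congr_right e, hr]
  obtain ⟨Z, f, hf, hf0, hfi⟩ : ∃ (Z : C) (f : Z ⟶ W), Mono f ∧ f ≠ 0 ∧ ¬ IsIso f := by
    by_contra hcon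
    push Not at hcon
    refine hs ⟨fun {Y} f hf => ⟨fun hi h0 => ?_, fun h0 => hcon Y f hf h0⟩⟩
    subst h0
    exact hW ((Limits.isIsoZero_iff_source_target_isZero (C := C) Y W).1 hi).2
  -- `W` is the direct sum of its proper subobject `Z` and the quotient, since `Z` is injective
  have := inj Z
  set S : ShortComplex C := ShortComplex.mk f (Limits.cokernel.π f) (by simp)
  have hS : S.ShortExact :=
    { exact := ShortComplex.exact_of_g_is_cokernel _ (Limits.cokernelIsCokernel f)
      mono_f := hf
      epi_g := by dsimp [S]; infer_instance }
  have s : S.Splitting := hS.splittingOfInjective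
  have e : W ≅ Z ⊞ Limits.cokernel f := s.isoBinaryBiproduct
  have hZ : ¬ Limits.IsZero Z := fun h => hf0 (h.eq_of_src _ _)
  have hK : ¬ Limits.IsZero (Limits.cokernel f) := fun h => by
    have : Epi f := Preadditive.epi_of_isZero_cokernel f h
    exact hfi (isIso_of_mono_of_epi f)
  have hdim : Module.finrank k (W ⟶ W) =
      (Module.finrank k (Z ⟶ Z) + Module.finrank k (Limits.cokernel f ⟶ Z)) +
        (Module.finrank k (Z ⟶ Limits.cokernel f) +
          Module.finrank k (Limits.cokernel f ⟶ Limits.cokernel f)) := by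
    rw [finrank_hom_congr_left e, finrank_hom_congr_right e, finrank_hom_biprod_right,
      finrank_hom_biprod_left, finrank_hom_biprod_left]
  have p1 := finrank_end_pos (k := k) hZ
  have p2 := finrank_end_pos (k := k) hK
  rw [finrank_hom_congr_left e X, finrank_hom_biprod_left, ih _ (by omega) Z rfl,
    ih _ (by omega) (Limits.cokernel f) rfl, ← Finset.sum_add_distrib]
  refine Finset.sum_congr rfl fun j _ => ?_
  rw [finrank_hom_congr_right e, finrank_hom_biprod_right, add_mul]

/-! ### Traces on symmetric powers -/
section Trace

/-- The exponent vector of the monomial `X₀ ^ k * X₁ ^ (n - k)`. -/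
noncomputable def binExp (n : ℕ) (k : Fin (n + 1)) : Fin 2 →₀ ℕ :=
  Finsupp.single 0 (k : ℕ) + Finsupp.single 1 (n - k)

theorem binExp_zero (n : ℕ) (k : Fin (n + 1)) : binExp n k 0 = k := by simp [binExp]

theorem binExp_injective (n : ℕ) : Function.Injective (binExp n) := fun k l h => by
  have := DFunLike.congr_fun h 0
  rw [binExp_zero, binExp_zero] at this
  exact Fin.ext this

theorem monomial_binExp_mem (n : ℕ) (k : Fin (n + 1)) :
    MvPolynomial.monomial (binExp n k) (1 : ℂ) ∈
      MvPolynomial.homogeneousSubmodule (Fin 2) ℂ n := by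
  apply MvPolynomial.isHomogeneous_monomial
  have := k.2
  rw [binExp, map_add, Finsupp.degree_single, Finsupp.degree_single]
  omega

/-- The coordinates of a homogeneous polynomial of degree `n` in two variables with respect to the
monomials `X₀ ^ k * X₁ ^ (n - k)`. -/
noncomputable def homogeneousEquiv (n : ℕ) :
    MvPolynomial.homogeneousSubmodule (Fin 2) ℂ n ≃ₗ[ℂ] (Fin (n + 1) → ℂ) where
  toFun p k := MvPolynomial.coeff (binExp n k) p.1
  map_add' p q := by ext; simp
  map_smul' c p := by ext; simp
  invFun c := ∑ k, c k • ⟨MvPolynomial.monomial (binExp n k) 1, monomial_binExp_mem n k⟩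
  left_inv p := by
    apply Subtype.ext
    simp only [AddSubmonoidClass.coe_finsetSum, SetLike.val_smul]
    ext d
    simp only [MvPolynomial.coeff_sum, MvPolynomial.coeff_smul, MvPolynomial.coeff_monomial,
      smul_eq_mul, mul_ite, mul_one, mul_zero]
    by_cases hd : d.degree = n
    · have h0 : d 0 + d 1 = n := by
        rw [← hd, Finsupp.degree_eq_sum, Fin.sum_univ_two]
      have hk : binExp n ⟨d 0, by omega⟩ = d := by
        ext i
        fin_cases i
        · simp [binExp]
        · simp [binExp]; omega
      rw [Finset.sum_eq_single ⟨d 0, by omega⟩]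
      · rw [if_pos hk, hk]
      · intro k _ hne
        rw [if_neg]
        intro h
        exact hne (binExp_injective n (h.trans hk.symm))
      · simp
    · have : MvPolynomial.coeff d p.1 = 0 := by
        by_contra h
        have := p.2 h
        exact hd (by rw [← this, Finsupp.degree_eq_weight_one (R := ℕ)]; rfl)
      rw [this]
      refine Finset.sum_eq_zero fun k _ => ?_
      split_ifs with h
      · rw [h, this]
      · rfl
  right_inv c := by
    ext k
    simp [MvPolynomial.coeff_sum, MvPolynomial.coeff_monomial, (binExp_injective n).eq_iff]

/-- The trace of the `n`-th symmetric power of a matrix. -/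
noncomputable def symTrace (n : ℕ) (M : Matrix (Fin 2) (Fin 2) ℂ) : ℂ :=
  LinearMap.trace ℂ _ ((symHom M).toLinearMap.restrict (symHom_mem M n))

theorem symTrace_mul_comm (n : ℕ) (M N : Matrix (Fin 2) (Fin 2) ℂ) :
    symTrace n (M * N) = symTrace n (N * M) := by
  have h : ∀ A B : Matrix (Fin 2) (Fin 2) ℂ,
      (symHom (A * B)).toLinearMap.restrict (symHom_mem (A * B) n) =
        (symHom A).toLinearMap.restrict (symHom_mem A n) *
          (symHom B).toLinearMap.restrict (symHom_mem B n) := by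
    intro A B
    ext1 p
    apply Subtype.ext
    simp [symHom_mul, LinearMap.restrict_apply]
  rw [symTrace, symTrace, h, h, LinearMap.trace_mul_comm]

theorem symTrace_eq_sum_coeff (n : ℕ) (M : Matrix (Fin 2) (Fin 2) ℂ) :
    symTrace n M = ∑ k, MvPolynomial.coeff (binExp n k)
      (symHom M (MvPolynomial.monomial (binExp n k) 1)) := by
  have hb : ∀ k, (Module.Basis.ofEquivFun (homogeneousEquiv n)) k =
      ⟨MvPolynomial.monomial (binExp n k) 1, monomial_binExp_mem n k⟩ := fun k => by
    rw [Module.Basis.coe_ofEquivFun]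
    refine (LinearEquiv.symm_apply_eq _).2 (funext fun l => ?_)
    simp [homogeneousEquiv, MvPolynomial.coeff_monomial, (binExp_injective n).eq_iff,
      Pi.single_apply, eq_comm]
  rw [symTrace, LinearMap.trace_eq_matrix_trace ℂ (Module.Basis.ofEquivFun (homogeneousEquiv n)),
    Matrix.trace]
  refine Finset.sum_congr rfl fun k _ => ?_
  rw [Matrix.diag_apply, LinearMap.toMatrix_apply, hb, Module.Basis.ofEquivFun_repr_apply]
  rfl

/-- An upper triangular matrix acts on the monomials of degree `n` by a triangular matrix. -/
theorem coeff_symHom_of_upper (a b d : ℂ) (n : ℕ) (k : Fin (n + 1)) :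
    MvPolynomial.coeff (binExp n k)
      (symHom !![a, b; 0, d] (MvPolynomial.monomial (binExp n k) 1)) =
      a ^ (k : ℕ) * d ^ (n - k) := by
  have hm : MvPolynomial.monomial (binExp n k) (1 : ℂ) =
      MvPolynomial.X 0 ^ (k : ℕ) * MvPolynomial.X 1 ^ (n - k) := by
    rw [MvPolynomial.X_pow_eq_monomial, MvPolynomial.X_pow_eq_monomial, MvPolynomial.monomial_mul,
      mul_one, binExp]
  have h0 : symHom !![a, b; 0, d] (MvPolynomial.X 0) = MvPolynomial.C a * MvPolynomial.X 0 := by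
    simp [symHom]
  have h1 : symHom !![a, b; 0, d] (MvPolynomial.X 1) =
      MvPolynomial.C b * MvPolynomial.X 0 + MvPolynomial.C d * MvPolynomial.X 1 := by
    simp [symHom]
  -- modulo `X₀ ^ (k + 1)` the image of the monomial is a multiple of the monomial
  obtain ⟨g, hg⟩ : (MvPolynomial.X 0 : MvPolynomial (Fin 2) ℂ) ∣
      (MvPolynomial.C b * MvPolynomial.X 0 + MvPolynomial.C d * MvPolynomial.X 1) ^ (n - k) -
        (MvPolynomial.C d * MvPolynomial.X 1) ^ (n - (k : ℕ)) := by
    refine dvd_trans ?_ (sub_dvd_pow_sub_pow _ _ _)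
    simp
  rw [sub_eq_iff_eq_add] at hg
  have : symHom !![a, b; 0, d] (MvPolynomial.monomial (binExp n k) 1) =
      MvPolynomial.C (a ^ (k : ℕ) * d ^ (n - k)) * MvPolynomial.monomial (binExp n k) 1 +
        MvPolynomial.X 0 ^ ((k : ℕ) + 1) * (MvPolynomial.C (a ^ (k : ℕ)) * g) := by
    rw [hm, map_mul, map_pow, map_pow, h0, h1, hg]
    simp only [MvPolynomial.C_mul, MvPolynomial.C_pow]
    ring
  rw [this, MvPolynomial.coeff_add, MvPolynomial.coeff_C_mul, MvPolynomial.coeff_monomial,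
    if_pos rfl, mul_one, MvPolynomial.X_pow_eq_monomial, MvPolynomial.coeff_monomial_mul', if_neg, add_zero]
  intro h
  have := h 0
  rw [binExp_zero] at this
  simp at this

theorem symTrace_of_upper (a b d : ℂ) (n : ℕ) :
    symTrace n !![a, b; 0, d] = ∑ k ∈ Finset.range (n + 1), a ^ k * d ^ (n - k) := by
  rw [symTrace_eq_sum_coeff, Finset.sum_range]
  exact Finset.sum_congr rfl fun k _ => coeff_symHom_of_upper a b d n k

/-- Every complex `2 × 2` matrix is conjugate to an upper triangular one, because it has an
eigenvector. -/
theorem exists_conj_upper (M : Matrix (Fin 2) (Fin 2) ℂ) :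
    ∃ (P Q : Matrix (Fin 2) (Fin 2) ℂ) (a b d : ℂ), Q * P = 1 ∧ M = P * (!![a, b; 0, d] * Q) := by
  obtain ⟨t, ht⟩ := Module.End.exists_eigenvalue (Matrix.toLin' M)
  obtain ⟨v, hv⟩ := ht.exists_hasEigenvector
  have hv1 := hv.apply_eq_smul
  have hv0 := hv.2
  have e0 : M 0 0 * v 0 + M 0 1 * v 1 = t * v 0 := by
    have := congrFun hv1 0
    simpa [Matrix.toLin'_apply, Matrix.mulVec, dotProduct, Fin.sum_univ_two] using this
  have e1 : M 1 0 * v 0 + M 1 1 * v 1 = t * v 1 := by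
    have := congrFun hv1 1
    simpa [Matrix.toLin'_apply, Matrix.mulVec, dotProduct, Fin.sum_univ_two] using this
  by_cases h0 : v 0 = 0
  · have h1 : v 1 ≠ 0 := fun h1 => hv0 (by ext i; fin_cases i <;> simp [h0, h1])
    rw [h0] at e0 e1
    have e0' : M 0 1 = 0 := by simpa [h1] using e0
    refine ⟨!![0, 1; 1, 0], !![0, 1; 1, 0], M 1 1, M 1 0, M 0 0, ?_, ?_⟩
    · ext i j; fin_cases i <;> fin_cases j <;> simp [Matrix.mul_apply, Fin.sum_univ_two]
    · ext i j; fin_cases i <;> fin_cases j <;> simp [Matrix.mul_apply, Fin.sum_univ_two, e0']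
  · refine ⟨!![1, 0; v 1 / v 0, 1], !![1, 0; -(v 1 / v 0), 1], t, M 0 1,
      M 1 1 - M 0 1 * (v 1 / v 0), ?_, ?_⟩
    · ext i j; fin_cases i <;> fin_cases j <;> simp [Matrix.mul_apply, Fin.sum_univ_two]
    · have f0 : M 0 0 = t - M 0 1 * (v 1 / v 0) := by
        field_simp; linear_combination e0
      have f1 : M 1 0 = t * (v 1 / v 0) - M 1 1 * (v 1 / v 0) := by
        field_simp; linear_combination e1
      ext i j; fin_cases i <;> fin_cases j <;>
        simp [Matrix.mul_apply, Fin.sum_univ_two, f0, f1] <;> ring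

/-- The Clebsch–Gordan rule for the traces of symmetric powers. -/
theorem trace_mul_symTrace (n : ℕ) (M : Matrix (Fin 2) (Fin 2) ℂ) :
    M.trace * symTrace (n + 1) M = symTrace (n + 2) M + M.det * symTrace n M := by
  obtain ⟨P, Q, a, b, d, hQP, rfl⟩ := exists_conj_upper M
  have hsym : ∀ m, symTrace m (P * (!![a, b; 0, d] * Q)) = symTrace m !![a, b; 0, d] := fun m => by
    rw [symTrace_mul_comm, mul_assoc, hQP, mul_one]
  have htr : (P * (!![a, b; 0, d] * Q)).trace = a + d := by
    rw [Matrix.trace_mul_comm, mul_assoc, hQP, mul_one, Matrix.trace_fin_two_of]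
  have hdet : (P * (!![a, b; 0, d] * Q)).det = a * d := by
    rw [Matrix.det_mul_comm, mul_assoc, hQP, mul_one, Matrix.det_fin_two_of, mul_zero, sub_zero]
  rw [hsym, hsym, hsym, htr, hdet]
  simp only [symTrace_of_upper]
  have h1 : ∀ m, ∑ k ∈ Finset.range (m + 2), a ^ k * d ^ (m + 1 - k) =
      d * ∑ k ∈ Finset.range (m + 1), a ^ k * d ^ (m - k) + a ^ (m + 1) := fun m => by
    rw [Finset.sum_range_succ, Finset.mul_sum]
    congr 1
    · refine Finset.sum_congr rfl fun k hk => ?_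
      rw [Finset.mem_range] at hk
      rw [show m + 1 - k = (m - k) + 1 by omega]; ring
    · simp
  rw [show n + 1 + 1 = n + 2 by ring, h1 (n + 1), h1 n]
  ring

theorem symTrace_zero (M : Matrix (Fin 2) (Fin 2) ℂ) : symTrace 0 M = 1 := by
  obtain ⟨P, Q, a, b, d, hQP, rfl⟩ := exists_conj_upper M
  rw [symTrace_mul_comm, mul_assoc, hQP, mul_one, symTrace_of_upper]
  simp

theorem symTrace_one (M : Matrix (Fin 2) (Fin 2) ℂ) : symTrace 1 M = M.trace := by
  obtain ⟨P, Q, a, b, d, hQP, rfl⟩ := exists_conj_upper M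
  rw [symTrace_mul_comm, Matrix.trace_mul_comm, mul_assoc, hQP, mul_one, symTrace_of_upper,
    Matrix.trace_fin_two_of]
  simp [Finset.sum_range_succ, add_comm]

end Trace

/-! ### The recurrence for the multiplicities in the symmetric powers -/

theorem character_symRep (B : Subgroup SU2) (n : ℕ) (g : B) :
    (symRep B n).character g = symTrace n (toMatrixHom B g) := rfl

theorem character_stdRep (B : Subgroup SU2) (g : B) :
    (stdRep B).character g = (toMatrixHom B g).trace :=
  Matrix.trace_toLin'_eq (toMatrixHom B g)

theorem det_toMatrixHom (B : Subgroup SU2) (g : B) : (toMatrixHom B g).det = 1 :=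
  (Matrix.mem_specialUnitaryGroup_iff.1 g.1.2).2

/-- The trace is real on `SU(2)`: the inverse of a matrix is its adjugate. -/
theorem trace_toMatrixHom_inv (B : Subgroup SU2) (g : B) :
    (toMatrixHom B g⁻¹).trace = (toMatrixHom B g).trace := by
  have h : toMatrixHom B g⁻¹ * toMatrixHom B g = 1 := by
    rw [← map_mul, inv_mul_cancel, map_one]
  have h2 : toMatrixHom B g⁻¹ = (toMatrixHom B g).adjugate := by
    calc toMatrixHom B g⁻¹ =
          toMatrixHom B g⁻¹ * (toMatrixHom B g * (toMatrixHom B g).adjugate) := by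
            rw [Matrix.mul_adjugate, det_toMatrixHom, one_smul, mul_one]
      _ = _ := by rw [← mul_assoc, h, one_mul]
  rw [h2, Matrix.adjugate_fin_two, Matrix.trace_fin_two, Matrix.trace_fin_two]
  simp [add_comm]

section
variable {B : Subgroup SU2} [Finite B]

theorem multiplicity_eq_sum [Fintype B] (V W : FDRep ℂ B) :
    (multiplicity V W : ℂ) = (Nat.card B : ℂ)⁻¹ * ∑ g : B, W.character g * V.character g⁻¹ := by
  have := invertibleOfNonzero (NeZero.ne (Nat.card B : ℂ))
  rw [FDRep.scalar_product_char_eq_finrank_equivariant, multiplicity]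

/-- Tensoring with the standard representation is self-adjoint, because its character is real. -/
theorem multiplicity_stdRep_tensor (V W : FDRep ℂ B) :
    multiplicity (stdRep B ⊗ V) W = multiplicity V (stdRep B ⊗ W) := by
  have := Fintype.ofFinite B
  rw [← Nat.cast_inj (R := ℂ), multiplicity_eq_sum, multiplicity_eq_sum]
  congr 1
  refine Finset.sum_congr rfl fun g _ => ?_
  rw [FDRep.char_tensor, FDRep.char_tensor, Pi.mul_apply, Pi.mul_apply, character_stdRep,
    character_stdRep, trace_toMatrixHom_inv]
  ring

/-- The Clebsch–Gordan rule for the multiplicities in the symmetric powers. -/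
theorem multiplicity_stdRep_symRep (V : FDRep ℂ B) (n : ℕ) :
    multiplicity V (stdRep B ⊗ symRep B (n + 1)) =
      multiplicity V (symRep B (n + 2)) + multiplicity V (symRep B n) := by
  have := Fintype.ofFinite B
  rw [← Nat.cast_inj (R := ℂ), Nat.cast_add, multiplicity_eq_sum, multiplicity_eq_sum,
    multiplicity_eq_sum, ← mul_add, ← Finset.sum_add_distrib]
  congr 1
  refine Finset.sum_congr rfl fun g _ => ?_
  rw [FDRep.char_tensor, Pi.mul_apply, character_stdRep, character_symRep, character_symRep,
    character_symRep, trace_mul_symTrace, det_toMatrixHom, one_mul, add_mul]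

theorem multiplicity_stdRep_symRep_zero (V : FDRep ℂ B) :
    multiplicity V (stdRep B ⊗ symRep B 0) = multiplicity V (symRep B 1) := by
  have := Fintype.ofFinite B
  rw [← Nat.cast_inj (R := ℂ), multiplicity_eq_sum, multiplicity_eq_sum]
  congr 1
  refine Finset.sum_congr rfl fun g _ => ?_
  rw [FDRep.char_tensor, Pi.mul_apply, character_stdRep, character_symRep, character_symRep,
    symTrace_zero, symTrace_one, mul_one]

theorem multiplicity_symRep_zero (V : FDRep ℂ B) :
    multiplicity V (symRep B 0) = multiplicity V (𝟙_ (FDRep ℂ B)) := by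
  have := Fintype.ofFinite B
  rw [← Nat.cast_inj (R := ℂ), multiplicity_eq_sum, multiplicity_eq_sum]
  congr 1
  refine Finset.sum_congr rfl fun g _ => ?_
  rw [character_symRep, symTrace_zero]
  congr 1
  have h : (𝟙_ (FDRep ℂ B)).ρ g = LinearMap.id := rfl
  rw [FDRep.character, h, LinearMap.trace_id]
  have : Module.finrank ℂ (𝟙_ (FDRep ℂ B)) = Module.finrank ℂ ℂ := rfl
  rw [this, Module.finrank_self, Nat.cast_one]

variable {T : AffineDiagram} (M : McKay B T)
include M

omit [Finite B] in
theorem McKay.multiplicity_r (i j : T.Vertex) :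
    multiplicity (M.r i) (M.r j) = if i = j then 1 else 0 := by
  have := M.simple i
  have := M.simple j
  rw [multiplicity, FDRep.finrank_hom_simple_simple]
  by_cases h : i = j
  · subst h
    rw [if_pos ⟨Iso.refl _⟩, if_pos rfl]
  · rw [if_neg fun hn => h (M.injective i j hn), if_neg h]

theorem McKay.multiplicity_eq_sum_r (V W : FDRep ℂ B) :
    multiplicity V W = ∑ j, multiplicity (M.r j) V * multiplicity (M.r j) W :=
  finrank_hom_eq_sum (fun _ => inferInstance) M.r M.multiplicity_r M.complete V W

theorem McKay.multiplicity_tensor (i : T.Vertex) (W : FDRep ℂ B) :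
    multiplicity (M.r i) (stdRep B ⊗ W) = ∑ j, T.adj i j * multiplicity (M.r j) W := by
  rw [← multiplicity_stdRep_tensor, M.multiplicity_eq_sum_r]
  simp_rw [M.tensor]

theorem McKay.mult_zero (i : T.Vertex) : M.mult 0 i = if i = 0 then 1 else 0 := by
  rw [McKay.mult, multiplicity_symRep_zero, ← M.multiplicity_r]
  obtain ⟨e⟩ := M.trivial
  exact (finrank_hom_congr_right e (M.r i)).symm

theorem McKay.mult_one (i : T.Vertex) : M.mult 1 i = ∑ j, T.adj i j * M.mult 0 j := by
  rw [McKay.mult, ← multiplicity_stdRep_symRep_zero, M.multiplicity_tensor]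
  rfl

/-- The multiplicities grow along the edges: `ℂ² ⊗ Symⁿ⁺¹ = Symⁿ⁺² ⊕ Symⁿ`. -/
theorem McKay.mult_add_two (n : ℕ) (i : T.Vertex) :
    M.mult (n + 2) i + M.mult n i = ∑ j, T.adj i j * M.mult (n + 1) j := by
  rw [McKay.mult, McKay.mult, ← multiplicity_stdRep_symRep, M.multiplicity_tensor]
  rfl

end

/-! ### The characteristic matrix of a weighted graph -/

section LinAlg

/-- The matrix `z E - A` of a weighted graph. -/
def zMat {V : Type*} [DecidableEq V] {R : Type*} [CommRing R] (z : R) (a : Matrix V V ℕ) :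
    Matrix V V R :=
  Matrix.of fun i j => (if i = j then z else 0) - (a i j : R)

theorem zMat_mulVec {V : Type*} [Fintype V] [DecidableEq V] {R : Type*} [CommRing R] (z : R)
    (a : Matrix V V ℕ) (u : V → R) (i : V) :
    (zMat z a).mulVec u i = z * u i - ∑ j, (a i j : R) * u j := by
  simp [zMat, Matrix.mulVec, dotProduct, sub_mul, Finset.sum_sub_distrib]

theorem zMat_submatrix {V W : Type*} [DecidableEq V] [DecidableEq W] {R : Type*} [CommRing R]
    (z : R) (a : Matrix V V ℕ) {f : W → V} (hf : Function.Injective f) :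
    (zMat z a).submatrix f f = zMat z (a.submatrix f f) := by
  ext i j
  simp [zMat, hf.eq_iff]

/-- The determinant of a weighted graph does not depend on the numbering of the vertices. -/
theorem det_zMat_submatrix_equiv {V W : Type*} [Fintype V] [Fintype W] [DecidableEq V]
    [DecidableEq W] {R : Type*} [CommRing R] (z : R) (a : Matrix V V ℕ) (e : W ≃ V) :
    (zMat z (a.submatrix e e)).det = (zMat z a).det := by
  rw [← zMat_submatrix z a e.injective, Matrix.det_submatrix_equiv_self]

variable {V : Type} [Fintype V] [LinearOrder V]

omit [Fintype V] in
theorem charMat_eq_zMat {a : Matrix V V ℕ} (ha : a.IsSymm) (hd : ∀ i, a i i = 0) :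
    charMat a = zMat X a := by
  ext1 i j
  rw [charMat, cartan, zMat]
  simp only [Matrix.add_apply, Matrix.smul_apply, Matrix.one_apply, Matrix.map_apply, seifert,
    Matrix.transpose_apply, Matrix.of_apply, smul_eq_mul]
  rcases lt_trichotomy i j with h | rfl | h
  · simp [h.ne, h.ne', h, h.not_gt]
  · simp [hd]
  · simp [h.ne, h.ne', h, h.not_gt, ha.apply]

theorem zMat_map {R S : Type*} [CommRing R] [CommRing S] (f : R →+* S) (z : R)
    (a : Matrix V V ℕ) : f.mapMatrix (zMat z a) = zMat (f z) a := by
  ext i j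
  simp only [zMat, RingHom.mapMatrix_apply, Matrix.map_apply, Matrix.of_apply]
  split_ifs <;> simp

theorem aeval_charPoly {S : Type*} [CommRing S] [Algebra ℤ S] (z : S) {a : Matrix V V ℕ}
    (ha : a.IsSymm) (hd : ∀ i, a i i = 0) : aeval z (charPoly a) = (zMat z a).det := by
  rw [charPoly, charMat_eq_zMat ha hd]
  have := (aeval (R := ℤ) z).toRingHom.map_det (zMat X a)
  rw [zMat_map] at this
  simpa using this

theorem aeval_cofactor {S : Type*} [CommRing S] [Algebra ℤ S] (z : S) {a : Matrix V V ℕ}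
    (ha : a.IsSymm) (hd : ∀ i, a i i = 0) (i j : V) :
    aeval z (cofactor a i j) = (zMat z a).adjugate j i := by
  rw [cofactor, charMat_eq_zMat ha hd]
  have := congrFun (congrFun ((aeval (R := ℤ) z).toRingHom.map_adjugate (zMat X a)) j) i
  rw [zMat_map] at this
  simpa using this

end LinAlg

/-! ### Coxeter polynomials of forests -/

/-- The graph with adjacency relation `Adj` is a forest: every vertex is joined only to its
parent and to its children. -/
def IsParent {W : Type*} (Adj : W → W → Prop) (par : W → W) (depth : W → ℕ) : Prop :=
  ∀ u v, Adj u v → (par u = v ∧ depth u = depth v + 1) ∨ (par v = u ∧ depth v = depth u + 1)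

/-- On a forest, every multiplicative cocycle is a coboundary. -/
theorem IsParent.exists_potential {W K : Type*} [Field K] {Adj : W → W → Prop} {par : W → W}
    {depth : W → ℕ} (h : IsParent Adj par depth) (ε : W → W → K)
    (hε : ∀ u v, ε u v * ε v u = 1) :
    ∃ φ : W → K, (∀ u, φ u ≠ 0) ∧ ∀ u v, Adj u v → φ u = ε u v * φ v := by
  -- the potential of `v` is the product of the cocycle along the path from `v` to its root
  set φ : W → K := fun v => ∏ t ∈ Finset.range (depth v), ε (par^[t] v) (par^[t + 1] v) with hφ
  have key : ∀ u v, par u = v → depth u = depth v + 1 → φ u = ε u v * φ v := by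
    rintro u v rfl hd
    simp only [hφ, hd, Finset.prod_range_succ']
    rw [mul_comm]
    rfl
  refine ⟨φ, fun u => Finset.prod_ne_zero_iff.2 fun t _ => left_ne_zero_of_mul_eq_one (hε _ _),
    fun u v huv => ?_⟩
  rcases h u v huv with ⟨h1, h2⟩ | ⟨h1, h2⟩
  · exact key u v h1 h2
  · rw [key v u h1 h2, ← mul_assoc, hε, one_mul]

section Coxeter
variable {V : Type} [Fintype V] [LinearOrder V] {K : Type} [Field K] {q : K}

/-- If the matrices `q S + q⁻¹ Sᵗ` and `z E - A` are conjugate by a diagonal matrix, then the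
Coxeter polynomial is the characteristic polynomial. -/
theorem coxeter_eq_det_of_potential (hq : q ≠ 0) {a : Matrix V V ℕ} (ha : a.IsSymm)
    (hd : ∀ i, a i i = 0) (φ : V → K) (hφ : ∀ i, φ i ≠ 0)
    (h : ∀ i j, i < j → a i j ≠ 0 → φ j = q * φ i) :
    coxeter q a = (zMat (q + q⁻¹) a).det := by
  have hconj : zMat (q + q⁻¹) a = Matrix.diagonal φ *
      ((q • seifert a + q⁻¹ • (seifert a).transpose : Matrix V V K) *
        Matrix.diagonal fun i => (φ i)⁻¹) := by
    ext i j
    rw [Matrix.diagonal_mul, Matrix.mul_diagonal]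
    simp only [zMat, seifert, Matrix.add_apply, Matrix.smul_apply, Matrix.transpose_apply,
      Matrix.of_apply, smul_eq_mul]
    have hi := hφ i
    have hj := hφ j
    rcases lt_trichotomy i j with hij | rfl | hij
    · by_cases h0 : a i j = 0
      · simp [hij.ne, hij.ne', hij, hij.not_gt, h0]
      · simp only [hij.ne, hij.ne', hij, hij.not_gt, if_true, if_false]
        rw [h i j hij h0] at *
        field_simp
        ring
    · simp only [if_true, hd, Nat.cast_zero, sub_zero, mul_one]
      field_simp
    · by_cases h0 : a i j = 0
      · simp [hij.ne, hij.ne', hij, hij.not_gt, h0, ha.apply]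
      · simp only [hij.ne, hij.ne', hij, hij.not_gt, if_true, if_false]
        have h0' : a j i ≠ 0 := by rwa [ha.apply]
        rw [h j i hij h0'] at *
        rw [ha.apply]
        field_simp
        ring
  rw [hconj, Matrix.det_mul, Matrix.det_mul, Matrix.det_diagonal, Matrix.det_diagonal, coxeter,
    mul_comm, mul_assoc, ← Finset.prod_mul_distrib]
  simp [hφ]

/-- The Coxeter polynomial of a forest is its characteristic polynomial, for every numbering of
the vertices. The map `f` embeds the vertices into a forest. -/
theorem coxeter_eq_det_of_isParent {W : Type*} (hq : q ≠ 0) {a : Matrix V V ℕ} (ha : a.IsSymm)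
    (hd : ∀ i, a i i = 0) {Adj : W → W → Prop} {par : W → W} {depth : W → ℕ}
    (h : IsParent Adj par depth) (f : V → W) (hf : Function.Injective f)
    (hadj : ∀ i j, a i j ≠ 0 → Adj (f i) (f j)) :
    coxeter q a = (zMat (q + q⁻¹) a).det := by
  classical
  have h1 : ∀ u v, (∃ i j, i < j ∧ f i = u ∧ f j = v) → ¬ ∃ i j, i < j ∧ f i = v ∧ f j = u := by
    rintro u v ⟨i, j, hij, rfl, rfl⟩ ⟨i', j', hij', h1, h2⟩
    rw [hf h1, hf h2] at hij'
    exact absurd hij hij'.not_gt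
  -- the cocycle which multiplies by `q` along every edge towards the larger number
  obtain ⟨φ, hφ, hφa⟩ := h.exists_potential (fun u v =>
      if ∃ i j, i < j ∧ f i = u ∧ f j = v then q⁻¹
      else if ∃ i j, i < j ∧ f i = v ∧ f j = u then q else 1) (by
    intro u v
    by_cases huv : ∃ i j, i < j ∧ f i = u ∧ f j = v
    · rw [if_pos huv, if_neg (h1 _ _ huv), if_pos huv, inv_mul_cancel₀ hq]
    · rw [if_neg huv]
      by_cases hvu : ∃ i j, i < j ∧ f i = v ∧ f j = u
      · rw [if_pos hvu, if_pos hvu, mul_inv_cancel₀ hq]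
      · rw [if_neg hvu, if_neg hvu, if_neg huv, mul_one])
  refine coxeter_eq_det_of_potential hq ha hd (φ ∘ f) (fun i => hφ _) fun i j hij h0 => ?_
  have := hφa _ _ (hadj i j h0)
  rw [if_pos ⟨i, j, hij, rfl, rfl⟩] at this
  simp only [Function.comp_apply, this]
  rw [mul_inv_cancel_left₀ hq]

/-- The Coxeter polynomial of a bipartite graph is its characteristic polynomial, if the vertices
of one part are numbered before those of the other part. -/
theorem coxeter_eq_det_of_bipartite (hq : q ≠ 0) {N : ℕ} {a : Matrix (Fin N) (Fin N) ℕ}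
    (ha : a.IsSymm) (hd : ∀ i, a i i = 0) (s : ℕ)
    (h : ∀ i j : Fin N, a i j ≠ 0 → (i.val < s ↔ s ≤ j.val)) :
    coxeter q a = (zMat (q + q⁻¹) a).det := by
  refine coxeter_eq_det_of_potential hq ha hd (fun i => if i.val < s then 1 else q) ?_ ?_
  · intro i
    split_ifs
    exacts [one_ne_zero, hq]
  · intro i j hij h0
    have := h i j h0
    have hij' : i.val < j.val := hij
    rw [if_neg (show ¬ j.val < s by omega), if_pos (show i.val < s by omega), mul_one]

end Coxeter

/-! ### Cofactors -/
section Cofactors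
variable {V : Type*} [Fintype V] [DecidableEq V] {R : Type*} [CommRing R]

/-- Cramer's rule. -/
theorem det_mul_eq_of_mulVec_eq_single {A : Matrix V V R} {u : V → R} {c : R} {j : V}
    (h : A.mulVec u = Pi.single j c) (i : V) : A.det * u i = c * A.adjugate i j := by
  have h1 : A.adjugate.mulVec (A.mulVec u) i = A.det * u i := by
    rw [Matrix.mulVec_mulVec, Matrix.adjugate_mul, Matrix.smul_mulVec, Matrix.one_mulVec]
    rfl
  rw [← h1, h, Matrix.mulVec_single]
  simp [mul_comm]

theorem det_mul_eq_of_mulVec_eq_single_zero {n : ℕ} {A : Matrix (Fin (n + 1)) (Fin (n + 1)) R}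
    {u : Fin (n + 1) → R} {c : R} (h : A.mulVec u = Pi.single 0 c) :
    A.det * u 0 = c * (A.submatrix Fin.succ Fin.succ).det := by
  rw [det_mul_eq_of_mulVec_eq_single h, Matrix.adjugate_fin_succ_eq_det_submatrix]
  simp

/-- Jacobi's identity for the minors of the adjugate. -/
theorem det_mul_det_adjugate (A : Matrix V V R) (p : V → Prop) [DecidablePred p] :
    A.det * (A.adjugate.toSquareBlockProp p).det =
      A.det ^ (Finset.univ.filter p).card * (A.toSquareBlockProp (fun v => ¬ p v)).det := by
  -- `N` has the columns of the adjugate for `w` with `p w`, and those of `1` otherwise; both `N`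
  -- and `A * N` are block triangular
  set N : Matrix V V R := Matrix.of fun v w =>
    if p w then A.adjugate v w else (1 : Matrix V V R) v w with hN
  have hAN : A * N = Matrix.of fun v w =>
      if p w then (A.det • (1 : Matrix V V R)) v w else A v w := by
    ext v w
    by_cases hw : p w
    · simp only [Matrix.mul_apply, hN, Matrix.of_apply, hw, if_true]
      rw [← Matrix.mul_adjugate, Matrix.mul_apply]
    · simp only [Matrix.mul_apply, hN, Matrix.of_apply, hw, if_false]
      rw [← Matrix.mul_apply, mul_one]
  have h1 := Matrix.twoBlockTriangular_det' N p (by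
    intro i hi j hj
    simp only [hN, Matrix.of_apply, hj, if_false]
    exact Matrix.one_apply_ne (by rintro rfl; exact hj hi))
  have h2 := Matrix.twoBlockTriangular_det (A * N) p (by
    intro i hi j hj
    simp only [hAN, Matrix.of_apply, hj, if_true]
    rw [Matrix.smul_apply, Matrix.one_apply_ne (by rintro rfl; exact hi hj), smul_zero])
  have e1 : N.toSquareBlockProp (fun v => ¬ p v) = 1 := by
    ext i j
    simp only [Matrix.toSquareBlockProp, Matrix.toBlock_apply, hN, Matrix.of_apply, if_neg j.2,
      Matrix.one_apply, Subtype.ext_iff]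
  have e2 : N.toSquareBlockProp p = A.adjugate.toSquareBlockProp p := by
    ext i j
    simp only [Matrix.toSquareBlockProp, Matrix.toBlock_apply, hN, Matrix.of_apply, if_pos j.2]
  have e3 : (A * N).toSquareBlockProp p = A.det • 1 := by
    ext i j
    rw [hAN]
    simp only [Matrix.toSquareBlockProp, Matrix.toBlock_apply, Matrix.of_apply, if_pos j.2,
      Matrix.smul_apply, Matrix.one_apply, Subtype.ext_iff]
  have e4 : (A * N).toSquareBlockProp (fun v => ¬ p v) =
      A.toSquareBlockProp (fun v => ¬ p v) := by
    ext i j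
    rw [hAN]
    simp only [Matrix.toSquareBlockProp, Matrix.toBlock_apply, Matrix.of_apply, if_neg j.2]
  rw [e1, e2, Matrix.det_one, mul_one] at h1
  rw [e3, e4, Matrix.det_mul, h1, Matrix.det_smul, Matrix.det_one, mul_one,
    Fintype.card_subtype] at h2
  exact h2

end Cofactors

section Minors
variable {V : Type*} [Fintype V] [DecidableEq V] {K : Type*} [Field K]

/-- A diagonal cofactor is the principal minor of the complement. -/
theorem adjugate_self_eq_det (A : Matrix V V K) (hA : A.det ≠ 0) (i : V) :
    A.adjugate i i = (A.toSquareBlockProp (fun v => v ∉ ({i} : Finset V))).det := by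
  have h := det_mul_det_adjugate A (· = i)
  rw [Finset.filter_eq', if_pos (Finset.mem_univ i), Finset.card_singleton, pow_one] at h
  rw [Matrix.equiv_block_det A (q := fun v => ¬ v = i) (by simp), ← mul_left_cancel₀ hA h]
  convert (Matrix.det_eq_elem_of_subsingleton (A.adjugate.toSquareBlockProp (· = i)) ⟨i, rfl⟩).symm
  rfl

/-- Jacobi's identity for the principal two-by-two minors of the adjugate. -/
theorem adjugate_mul_sub_eq_det (A : Matrix V V K) (hA : A.det ≠ 0) {i j : V} (hij : i ≠ j) :
    A.adjugate i i * A.adjugate j j - A.adjugate i j * A.adjugate j i =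
      A.det * (A.toSquareBlockProp (fun v => v ∉ ({i, j} : Finset V))).det := by
  have h := det_mul_det_adjugate A (fun v => v = i ∨ v = j)
  have hg : Function.Bijective
      (![⟨i, .inl rfl⟩, ⟨j, .inr rfl⟩] : Fin 2 → {v // v = i ∨ v = j}) := by
    constructor
    · intro a b hab
      fin_cases a <;> fin_cases b <;> simp_all [hij.symm]
    · rintro ⟨v, rfl | rfl⟩
      · exact ⟨0, rfl⟩
      · exact ⟨1, rfl⟩
  rw [Finset.filter_or, Finset.filter_eq', Finset.filter_eq', if_pos (Finset.mem_univ i),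
    if_pos (Finset.mem_univ j), ← Finset.insert_eq, Finset.card_pair hij, pow_two,
    mul_assoc] at h
  rw [Matrix.equiv_block_det A (q := fun v => ¬ (v = i ∨ v = j)) (by simp),
    ← mul_left_cancel₀ hA h, ← Matrix.det_submatrix_equiv_self (Equiv.ofBijective _ hg),
    Matrix.det_fin_two]
  simp [Matrix.toSquareBlockProp_def]

end Minors

/-! ### The Cauchy–Binet formula -/

/-- The determinants on the right-hand side are taken over the columns in an `m`-element set `K`,
in increasing order. -/
theorem det_sum_mul_eq {R ι : Type*} [CommRing R] [LinearOrder ι] (S : Finset ι) (m : ℕ)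
    (A B : Fin m → ι → R) :
    (Matrix.of fun s t => ∑ k ∈ S, A s k * B t k).det =
      ∑ K ∈ (S.powersetCard m).attach,
        (Matrix.of fun s r =>
          A s (K.1.orderEmbOfFin (Finset.mem_powersetCard.1 K.2).2 r)).det *
        (Matrix.of fun t r =>
          B t (K.1.orderEmbOfFin (Finset.mem_powersetCard.1 K.2).2 r)).det := by
  classical
  set F : (Fin m → ι) → R := fun r =>
    (∏ s, A s (r s)) * (Matrix.of fun s t => B t (r s)).det with hF
  -- expand the determinant in every row
  have h1 : (Matrix.of fun s t => ∑ k ∈ S, A s k * B t k).det =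
      ∑ r ∈ Fintype.piFinset (fun _ : Fin m => S), F r := by
    have hrow : (Matrix.of fun s t => ∑ k ∈ S, A s k * B t k) =
        (fun s => ∑ k ∈ S, A s k • (fun t => B t k) : Fin m → Fin m → R) := by
      ext s t
      simp [Finset.sum_apply]
    have := (Matrix.detRowAlternating (n := Fin m) (R := R)).toMultilinearMap.map_sum_finset
      (fun s k => A s k • (fun t => B t k)) (fun _ : Fin m => S)
    rw [hrow]
    refine this.trans (Finset.sum_congr rfl fun r _ => ?_)
    exact (Matrix.detRowAlternating (n := Fin m) (R := R)).toMultilinearMap.map_smul_univ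
      (fun s => A s (r s)) (fun s t => B t (r s))
  -- the terms with two equal rows vanish
  have h2 : ∑ r ∈ Fintype.piFinset (fun _ : Fin m => S), F r =
      ∑ r ∈ (Fintype.piFinset (fun _ : Fin m => S)).filter Function.Injective, F r := by
    refine (Finset.sum_filter_of_ne fun r _ hr => ?_).symm
    by_contra hinj
    simp only [Function.Injective, not_forall] at hinj
    obtain ⟨i, j, hij, hne⟩ := hinj
    refine hr ?_
    rw [hF]
    simp only
    rw [Matrix.det_zero_of_row_eq hne, mul_zero]
    ext t
    simp [hij]
  have h3 : ∀ r ∈ (Fintype.piFinset (fun _ : Fin m => S)).filter Function.Injective,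
      Finset.univ.image r ∈ S.powersetCard m := by
    intro r hr
    rw [Finset.mem_filter, Fintype.mem_piFinset] at hr
    rw [Finset.mem_powersetCard, Finset.card_image_of_injective _ hr.2, Finset.card_univ,
      Fintype.card_fin]
    refine ⟨fun k hk => ?_, rfl⟩
    obtain ⟨s, _, rfl⟩ := Finset.mem_image.1 hk
    exact hr.1 s
  -- group the injective functions by their images `K`; those with image `K` are the permutations
  -- of `K`
  rw [h1, h2, ← Finset.sum_fiberwise_of_maps_to h3, ← Finset.sum_attach]
  refine Finset.sum_congr rfl fun K _ => ?_
  obtain ⟨hKS, hKm⟩ := Finset.mem_powersetCard.1 K.2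
  set e := K.1.orderEmbOfFin (Finset.mem_powersetCard.1 K.2).2 with he
  have hmem : ∀ r, e r ∈ K.1 := fun r => Finset.orderEmbOfFin_mem _ _ r
  have h4 : ∑ r ∈ ((Fintype.piFinset (fun _ : Fin m => S)).filter Function.Injective).filter
      (fun r => Finset.univ.image r = K.1), F r = ∑ σ : Equiv.Perm (Fin m), F (e ∘ σ) := by
    symm
    refine Finset.sum_nbij (fun σ => e ∘ σ) ?_ ?_ ?_ fun _ _ => rfl
    · intro σ _
      have hinj : Function.Injective (e ∘ σ) := e.injective.comp σ.injective
      rw [Finset.mem_filter, Finset.mem_filter, Fintype.mem_piFinset]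
      refine ⟨⟨fun s => hKS (hmem _), hinj⟩, ?_⟩
      refine Finset.eq_of_subset_of_card_le ?_ ?_
      · intro k hk
        obtain ⟨s, _, rfl⟩ := Finset.mem_image.1 hk
        exact hmem _
      · rw [Finset.card_image_of_injective _ hinj, Finset.card_univ, Fintype.card_fin, hKm]
    · intro σ _ τ _ h
      ext s
      exact congrArg _ (e.injective (congrFun h s))
    · intro r hr
      simp only [Finset.coe_filter, Set.mem_ofPred_eq, Finset.mem_filter] at hr
      obtain ⟨⟨_, hinj⟩, him⟩ := hr
      have hrK : ∀ s, r s ∈ Set.range e := fun s => by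
        rw [he, Finset.range_orderEmbOfFin, ← him]
        simp
      choose σ hσ using hrK
      have hσi : Function.Injective σ := fun a b hab => hinj (by rw [← hσ, ← hσ, hab])
      exact ⟨Equiv.ofBijective σ (Finite.injective_iff_bijective.1 hσi), by simp,
        funext hσ⟩
  rw [h4, Matrix.det_apply' (Matrix.of fun s r => A s (e r)), ← Matrix.det_transpose
    (Matrix.of fun t r => B t (e r)), Finset.sum_mul]
  refine (Fintype.sum_equiv (Equiv.inv (Equiv.Perm (Fin m))) _ _ fun σ => ?_)
  have hdet : (Matrix.of fun s t => B t ((e ∘ σ) s)).det =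
      Equiv.Perm.sign σ * (Matrix.of fun t r => B t (e r)).transpose.det :=
    Matrix.det_permute σ (Matrix.of fun t r => B t (e r)).transpose
  simp only [hF, hdet, Equiv.inv_apply, Equiv.Perm.sign_inv, Matrix.of_apply]
  rw [← Equiv.prod_comp σ⁻¹ (fun s => A s ((e ∘ σ) s))]
  simp
  ring

/-! ### Neighbours in the affine diagrams -/

theorem diagram_apply (N : ℕ) (p : ℕ → ℕ → Prop) [∀ i j, Decidable (p i j)] (i j : Fin N) :
    diagram N (fun i j => decide (p i j)) i j =
      (if p i j then 1 else 0) + (if p j i then 1 else 0) := by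
  simp only [diagram, Matrix.of_apply]
  congr 1 <;> split_ifs with h <;> simp [h]

theorem diagram_comm (N : ℕ) (E : ℕ → ℕ → Bool) (i j : Fin N) :
    diagram N E i j = diagram N E j i := by
  simp [diagram, add_comm]

theorem sum_count_mul {N : ℕ} {R : Type*} [CommSemiring R] (l : List ℕ) (hl : ∀ k ∈ l, k < N)
    (f : ℕ → R) : ∑ j : Fin N, (l.count j.val : R) * f j = (l.map f).sum := by
  induction l with
  | nil => simp
  | cons a l ih =>
    have ha : a < N := hl a (by simp)
    have h1 : ∀ j : Fin N, (a = j.val) = ((⟨a, ha⟩ : Fin N) = j) := fun j => by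
      rw [Fin.ext_iff]
    simp [List.count_cons, add_mul, Finset.sum_add_distrib, ih fun k hk => hl k (by simp [hk]),
      add_comm, h1]

namespace AffineDiagram

/-- The list of the neighbours of a vertex, with multiplicity. -/
def nbrs : AffineDiagram → ℕ → List ℕ
  | A n _, i => [if i = n then 0 else i + 1, if i = 0 then n else i - 1]
  | D n _, i =>
      if i ≤ 1 then [2]
      else if i + 2 ≤ n then
        (if i = 2 then [0, 1] else [i - 1]) ++ (if i + 2 = n then [n - 1, n] else [i + 1])
      else [n - 2]
  | E6, i => [[1], [0, 2], [1, 3, 5], [2, 4], [3], [2, 6], [5]].getD i []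
  | E7, i => [[1], [0, 2], [1, 3], [2, 4, 7], [3, 5], [4, 6], [5], [3]].getD i []
  | E8, i => [[1], [0, 2], [1, 3], [2, 4], [3, 5], [4, 6, 8], [5, 7], [6], [5]].getD i []

theorem adj_A_eq_count {n : ℕ} (hn : 1 ≤ n) (i j : Fin (n + 1)) :
    cycle n i j = ((A n hn).nbrs i).count j.val := by
  rw [cycle, diagram_apply, nbrs]
  have hi := i.2
  have hj := j.2
  simp only [List.count_cons, List.count_nil, beq_iff_eq]
  split_ifs <;> omega

theorem adj_D_eq_count {n : ℕ} (hn : 4 ≤ n) (i j : Fin (n + 1)) :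
    diagram (n + 1) (fun i j =>
      decide ((i = 0 ∧ j = 2) ∨ (1 ≤ i ∧ j = i + 1 ∧ j < n) ∨ (i + 2 = n ∧ j = n))) i j =
      ((D n hn).nbrs i).count j.val := by
  rw [diagram_apply, nbrs]
  have hi := i.2
  have hj := j.2
  by_cases h1 : i.val ≤ 1
  · rw [if_pos h1]
    simp only [List.count_cons, List.count_nil, beq_iff_eq]
    split_ifs <;> omega
  rw [if_neg h1]
  by_cases h2 : i.val + 2 ≤ n
  · rw [if_pos h2, List.count_append, apply_ite (List.count j.val), apply_ite (List.count j.val)]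
    simp only [List.count_cons, List.count_nil, beq_iff_eq]
    split_ifs <;> omega
  · rw [if_neg h2]
    simp only [List.count_cons, List.count_nil, beq_iff_eq]
    split_ifs <;> omega

theorem adj_E6_eq_count : ∀ p : E6.Vertex × E6.Vertex,
    E6.adj p.1 p.2 = (E6.nbrs p.1.val).count p.2.val := by decide

theorem adj_E7_eq_count : ∀ p : E7.Vertex × E7.Vertex,
    E7.adj p.1 p.2 = (E7.nbrs p.1.val).count p.2.val := by decide

theorem adj_E8_eq_count : ∀ p : E8.Vertex × E8.Vertex,
    E8.adj p.1 p.2 = (E8.nbrs p.1.val).count p.2.val := by decide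

theorem adj_eq_count (T : AffineDiagram) (i j : T.Vertex) :
    T.adj i j = (T.nbrs i.val).count j.val := by
  cases T with
  | A n hn => exact adj_A_eq_count hn i j
  | D n hn => exact adj_D_eq_count hn i j
  | E6 => exact adj_E6_eq_count (i, j)
  | E7 => exact adj_E7_eq_count (i, j)
  | E8 => exact adj_E8_eq_count (i, j)

theorem adj_comm (T : AffineDiagram) (i j : T.Vertex) : T.adj i j = T.adj j i := by
  cases T with
  | A n hn =>
    exact (diagram_comm (n + 1) _ : ∀ i j : Fin (n + 1), cycle n i j = cycle n j i) i j
  | D n hn =>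
    exact diagram_comm (n + 1) (fun i j =>
      decide ((i = 0 ∧ j = 2) ∨ (1 ≤ i ∧ j = i + 1 ∧ j < n) ∨ (i + 2 = n ∧ j = n))) i j
  | E6 => exact (by decide : ∀ p : E6.Vertex × E6.Vertex, E6.adj p.1 p.2 = E6.adj p.2 p.1) (i, j)
  | E7 => exact (by decide : ∀ p : E7.Vertex × E7.Vertex, E7.adj p.1 p.2 = E7.adj p.2 p.1) (i, j)
  | E8 => exact (by decide : ∀ p : E8.Vertex × E8.Vertex, E8.adj p.1 p.2 = E8.adj p.2 p.1) (i, j)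

theorem adj_isSymm (T : AffineDiagram) : T.adj.IsSymm := by
  ext i j
  exact T.adj_comm j i

theorem lt_of_mem_nbrs (T : AffineDiagram) (i : ℕ) (hi : i < T.rank + 1) :
    ∀ k ∈ T.nbrs i, k < T.rank + 1 := by
  cases T with
  | A n hn =>
    simp only [rank] at hi ⊢
    intro k hk
    simp only [nbrs, List.mem_cons, List.not_mem_nil, or_false] at hk
    split_ifs at hk <;> omega
  | D n hn =>
    simp only [rank] at hi ⊢
    intro k hk
    simp only [nbrs] at hk
    split_ifs at hk <;>
      simp only [List.cons_append, List.nil_append, List.mem_cons, List.not_mem_nil, or_false]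
        at hk <;> omega
  | E6 => exact (by decide : ∀ i < 7, ∀ k ∈ E6.nbrs i, k < 7) i hi
  | E7 => exact (by decide : ∀ i < 8, ∀ k ∈ E7.nbrs i, k < 8) i hi
  | E8 => exact (by decide : ∀ i < 9, ∀ k ∈ E8.nbrs i, k < 9) i hi

theorem not_mem_nbrs (T : AffineDiagram) (i : ℕ) (hi : i < T.rank + 1) : i ∉ T.nbrs i := by
  cases T with
  | A n hn =>
    simp only [rank] at hi
    intro hk
    simp only [nbrs, List.mem_cons, List.not_mem_nil, or_false] at hk
    split_ifs at hk <;> omega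
  | D n hn =>
    simp only [rank] at hi
    intro hk
    simp only [nbrs] at hk
    split_ifs at hk <;>
      simp only [List.cons_append, List.nil_append, List.mem_cons, List.not_mem_nil, or_false]
        at hk <;> omega
  | E6 => exact (by decide : ∀ i < 7, i ∉ E6.nbrs i) i hi
  | E7 => exact (by decide : ∀ i < 8, i ∉ E7.nbrs i) i hi
  | E8 => exact (by decide : ∀ i < 9, i ∉ E8.nbrs i) i hi

theorem adj_self (T : AffineDiagram) (i : T.Vertex) : T.adj i i = 0 := by
  rw [adj_eq_count, List.count_eq_zero]
  exact T.not_mem_nbrs i.val i.2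

theorem sum_adj_mul (T : AffineDiagram) {R : Type*} [CommSemiring R] (i : T.Vertex)
    (f : ℕ → R) : ∑ j : T.Vertex, (T.adj i j : R) * f j.val = ((T.nbrs i.val).map f).sum := by
  simp_rw [adj_eq_count]
  exact sum_count_mul _ (T.lt_of_mem_nbrs i.val i.2) f

/-! ### The polynomials `Z_i` -/

/-- The polynomials `Z_i`, as a function of the number of the vertex. -/
noncomputable def zNat : AffineDiagram → ℕ → ℤ[X]
  | A n _, k => X ^ k + X ^ (n + 1 - k)
  | D n _, k =>
      if k = 0 then 1 + X ^ (2 * n - 2)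
      else if k = 1 then X ^ 2 + X ^ (2 * n - 4)
      else if k + 2 ≤ n then
        X ^ (k - 1) + X ^ (k + 1) + X ^ (2 * n - k - 3) + X ^ (2 * n - k - 1)
      else X ^ (n - 2) + X ^ n
  | E6, k => [1 + X ^ 12, X + X ^ 5 + X ^ 7 + X ^ 11,
      X ^ 2 + X ^ 4 + X ^ 6 + X ^ 6 + X ^ 8 + X ^ 10, X ^ 3 + X ^ 5 + X ^ 7 + X ^ 9,
      X ^ 4 + X ^ 8, X ^ 3 + X ^ 5 + X ^ 7 + X ^ 9, X ^ 4 + X ^ 8].getD k 0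
  | E7, k => [1 + X ^ 18, X + X ^ 7 + X ^ 11 + X ^ 17,
      X ^ 2 + X ^ 6 + X ^ 8 + X ^ 10 + X ^ 12 + X ^ 16,
      X ^ 3 + X ^ 5 + X ^ 7 + X ^ 9 + X ^ 9 + X ^ 11 + X ^ 13 + X ^ 15,
      X ^ 4 + X ^ 6 + X ^ 8 + X ^ 10 + X ^ 12 + X ^ 14, X ^ 5 + X ^ 7 + X ^ 11 + X ^ 13,
      X ^ 6 + X ^ 12, X ^ 4 + X ^ 8 + X ^ 10 + X ^ 14].getD k 0
  | E8, k => [1 + X ^ 30, X + X ^ 11 + X ^ 19 + X ^ 29,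
      X ^ 2 + X ^ 10 + X ^ 12 + X ^ 18 + X ^ 20 + X ^ 28,
      X ^ 3 + X ^ 9 + X ^ 11 + X ^ 13 + X ^ 17 + X ^ 19 + X ^ 21 + X ^ 27,
      X ^ 4 + X ^ 8 + X ^ 10 + X ^ 12 + X ^ 14 + X ^ 16 + X ^ 18 + X ^ 20 + X ^ 22 + X ^ 26,
      X ^ 5 + X ^ 7 + X ^ 9 + X ^ 11 + X ^ 13 + X ^ 15 + X ^ 15 + X ^ 17 + X ^ 19 + X ^ 21 +
        X ^ 23 + X ^ 25,
      X ^ 6 + X ^ 8 + X ^ 12 + X ^ 14 + X ^ 16 + X ^ 18 + X ^ 22 + X ^ 24,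
      X ^ 7 + X ^ 13 + X ^ 17 + X ^ 23,
      X ^ 6 + X ^ 10 + X ^ 14 + X ^ 16 + X ^ 20 + X ^ 24].getD k 0

theorem zPoly_D_eq_zNat {n : ℕ} (hn : 4 ≤ n) (i : Fin (n + 1)) :
    (D n hn).zPoly i = (D n hn).zNat i.val := by
  simp only [zPoly, zExps, zNat]
  split_ifs <;> simp [add_assoc]

theorem zPoly_E6_eq_zNat (i : Fin 7) : E6.zPoly i = E6.zNat i.val := by
  simp only [zPoly]
  fin_cases i <;> simp [zExps, zNat, add_assoc]

theorem zPoly_E7_eq_zNat (i : Fin 8) : E7.zPoly i = E7.zNat i.val := by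
  simp only [zPoly]
  fin_cases i <;> simp [zExps, zNat, add_assoc]

theorem zPoly_E8_eq_zNat (i : Fin 9) : E8.zPoly i = E8.zNat i.val := by
  simp only [zPoly]
  fin_cases i <;> simp [zExps, zNat, add_assoc]

theorem zPoly_eq_zNat (T : AffineDiagram) (i : T.Vertex) : T.zPoly i = T.zNat i.val := by
  cases T with
  | A n hn => simp [zPoly, zExps, zNat]
  | D n hn => exact zPoly_D_eq_zNat hn i
  | E6 => exact zPoly_E6_eq_zNat i
  | E7 => exact zPoly_E7_eq_zNat i
  | E8 => exact zPoly_E8_eq_zNat i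

theorem zNat_A_eq {n : ℕ} (hn : 1 ≤ n) (i : ℕ) (hi : i < n + 1) :
    (X ^ 2 + 1) * (A n hn).zNat i = X * (((A n hn).nbrs i).map (A n hn).zNat).sum +
      if i = 0 then (1 - X ^ 2) * (1 - X ^ (n + 1)) else 0 := by
  simp only [nbrs, zNat, List.map_cons, List.map_nil, List.sum_cons, List.sum_nil]
  rcases Nat.eq_zero_or_pos i with rfl | h0
  · obtain ⟨m, rfl⟩ : ∃ m, n = m + 1 := ⟨n - 1, by omega⟩
    rw [if_neg (by omega), if_pos rfl, if_pos rfl]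
    simp only [show m + 1 + 1 - 0 = m + 2 by omega, show m + 1 + 1 - (0 + 1) = m + 1 by omega,
      show m + 1 + 1 - (m + 1) = 1 by omega]
    ring
  · rw [if_neg h0.ne', if_neg h0.ne']
    obtain ⟨k, rfl⟩ : ∃ k, i = k + 1 := ⟨i - 1, by omega⟩
    rcases eq_or_ne (k + 1) n with rfl | hin
    · rw [if_pos rfl]
      simp only [show k + 1 + 1 - (k + 1) = 1 by omega, show k + 1 - 1 = k by omega,
        show k + 1 + 1 - k = 2 by omega, show k + 1 + 1 - 0 = k + 2 by omega]
      ring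
    · rw [if_neg hin]
      obtain ⟨m, rfl⟩ : ∃ m, n = k + m + 2 := ⟨n - k - 2, by omega⟩
      simp only [show k + m + 2 + 1 - (k + 1) = m + 2 by omega, show k + 1 - 1 = k by omega,
        show k + m + 2 + 1 - (k + 1 + 1) = m + 1 by omega,
        show k + m + 2 + 1 - k = m + 3 by omega]
      ring

theorem zNat_D_eq {n : ℕ} (hn : 4 ≤ n) (i : ℕ) (hi : i < n + 1) :
    (X ^ 2 + 1) * (D n hn).zNat i = X * (((D n hn).nbrs i).map (D n hn).zNat).sum +
      if i = 0 then (1 - X ^ 4) * (1 - X ^ (2 * n - 4)) else 0 := by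
  obtain ⟨m, rfl⟩ : ∃ m, n = m + 4 := ⟨n - 4, by omega⟩
  have hz0 : (D (m + 4) hn).zNat 0 = 1 + X ^ (2 * m + 6) := rfl
  have hz1 : (D (m + 4) hn).zNat 1 = X ^ 2 + X ^ (2 * m + 4) := rfl
  -- the vertices `2, …, n - 2` are `k + 2` with `k + l = n - 4`
  have hzm : ∀ k l : ℕ, m = k + l → (D (m + 4) hn).zNat (k + 2) =
        X ^ (k + 1) + X ^ (k + 3) + X ^ (k + 2 * l + 3) + X ^ (k + 2 * l + 5) := by
    rintro k l rfl
    simp only [zNat]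
    rw [if_neg (by omega), if_neg (by omega), if_pos (by omega),
      show k + 2 - 1 = k + 1 by omega, show 2 * (k + l + 4) - (k + 2) - 3 = k + 2 * l + 3 by omega,
      show 2 * (k + l + 4) - (k + 2) - 1 = k + 2 * l + 5 by omega]
  have hzl : ∀ k, m + 2 < k → (D (m + 4) hn).zNat k = X ^ (m + 2) + X ^ (m + 4) := by
    intro k hk
    simp only [zNat]
    rw [if_neg (by omega), if_neg (by omega), if_neg (by omega),
      show m + 4 - 2 = m + 2 by omega]
  rw [show 2 * (m + 4) - 4 = 2 * m + 4 by omega]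
  simp only [nbrs]
  by_cases h1 : i ≤ 1
  · rw [if_pos h1]
    simp only [List.map_cons, List.map_nil, List.sum_cons, List.sum_nil,
      hzm 0 m (Nat.zero_add m).symm]
    interval_cases i
    · rw [hz0, if_pos rfl]
      ring
    · rw [hz1, if_neg one_ne_zero]
      ring
  rw [if_neg h1, if_neg (show i ≠ 0 by omega)]
  by_cases h2 : i + 2 ≤ m + 4
  · obtain ⟨k, rfl⟩ : ∃ k, i = k + 2 := ⟨i - 2, by omega⟩
    obtain ⟨l, rfl⟩ : ∃ l, m = k + l := ⟨m - k, by omega⟩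
    rw [if_pos h2, hzm k l rfl, List.map_append, List.sum_append]
    -- the sums over the neighbours before and after the vertex
    have hleft : (List.map (D (k + l + 4) hn).zNat
        (if k + 2 = 2 then [0, 1] else [k + 2 - 1])).sum =
          (X ^ k + X ^ (k + 2) + X ^ (k + 2 * l + 4) + X ^ (k + 2 * l + 6) : ℤ[X]) := by
      rcases k with _ | k
      · rw [if_pos rfl]
        simp only [List.map_cons, List.map_nil, List.sum_cons, List.sum_nil, hz0, hz1]
        ring
      · rw [if_neg (by omega), show k + 1 + 2 - 1 = k + 2 by omega]
        simp only [List.map_cons, List.map_nil, List.sum_cons, List.sum_nil,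
          hzm k (l + 1) (by omega)]
        ring
    have hright : (List.map (D (k + l + 4) hn).zNat
        (if k + 2 + 2 = k + l + 4 then [k + l + 4 - 1, k + l + 4] else [k + 2 + 1])).sum =
          (X ^ (k + 2) + X ^ (k + 4) + X ^ (k + 2 * l + 2) + X ^ (k + 2 * l + 4) : ℤ[X]) := by
      rcases l with _ | l
      · rw [if_pos (by omega)]
        simp only [List.map_cons, List.map_nil, List.sum_cons, List.sum_nil]
        rw [hzl _ (by omega), hzl _ (by omega)]
        ring
      · rw [if_neg (by omega)]
        simp only [List.map_cons, List.map_nil, List.sum_cons, List.sum_nil]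
        rw [show k + 2 + 1 = (k + 1) + 2 by omega, hzm (k + 1) l (by omega)]
        ring
    rw [hleft, hright]
    ring
  · rw [if_neg h2, hzl i (by omega)]
    simp only [List.map_cons, List.map_nil, List.sum_cons, List.sum_nil,
      show m + 4 - 2 = m + 2 by omega, hzm m 0 rfl]
    ring

theorem zNat_E6_eq (i : ℕ) (hi : i < 7) :
    (X ^ 2 + 1) * E6.zNat i = X * ((E6.nbrs i).map E6.zNat).sum +
      if i = 0 then (1 - X ^ 6) * (1 - X ^ 8) else 0 := by
  interval_cases i <;> simp [zNat, nbrs] <;> ring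

theorem zNat_E7_eq (i : ℕ) (hi : i < 8) :
    (X ^ 2 + 1) * E7.zNat i = X * ((E7.nbrs i).map E7.zNat).sum +
      if i = 0 then (1 - X ^ 8) * (1 - X ^ 12) else 0 := by
  interval_cases i <;> simp [zNat, nbrs] <;> ring

theorem zNat_E8_eq (i : ℕ) (hi : i < 9) :
    (X ^ 2 + 1) * E8.zNat i = X * ((E8.nbrs i).map E8.zNat).sum +
      if i = 0 then (1 - X ^ 12) * (1 - X ^ 20) else 0 := by
  interval_cases i <;> simp [zNat, nbrs] <;> ring

/-- The polynomials `Z_i` satisfy the equations which determine the Poincaré series. -/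
theorem zPoly_eq (T : AffineDiagram) (i : T.Vertex) :
    (X ^ 2 + 1) * T.zPoly i =
      X * ∑ j, (T.adj i j : ℤ[X]) * T.zPoly j +
        if i = 0 then (1 - X ^ T.expA) * (1 - X ^ T.expB) else 0 := by
  simp_rw [zPoly_eq_zNat]
  rw [sum_adj_mul, if_congr (Fin.ext_iff (b := (0 : T.Vertex))) rfl rfl]
  cases T with
  | A n hn => exact zNat_A_eq hn i.val i.2
  | D n hn => exact zNat_D_eq hn i.val i.2
  | E6 => exact zNat_E6_eq i.val i.2
  | E7 => exact zNat_E7_eq i.val i.2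
  | E8 => exact zNat_E8_eq i.val i.2

end AffineDiagram

/-! ### Proportionality of the three families -/

namespace AffineDiagram

theorem charMat_adj (T : AffineDiagram) : charMat T.adj = zMat X T.adj :=
  charMat_eq_zMat T.adj_isSymm T.adj_self

theorem aeval_hPoly_none (T : AffineDiagram) {R : Type*} [CommRing R] [Algebra ℤ R] (z : R) :
    aeval z (T.hPoly none) = (zMat z T.adj).det :=
  aeval_charPoly z T.adj_isSymm T.adj_self

theorem zMat_adj_isSymm (T : AffineDiagram) {R : Type*} [CommRing R] (z : R) :
    (zMat z T.adj).IsSymm := by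
  ext i j
  simp [zMat, T.adj_comm i j, eq_comm]

theorem aeval_hPoly_some (T : AffineDiagram) {R : Type*} [CommRing R] [Algebra ℤ R] (z : R)
    (i : T.Vertex) :
    aeval z (T.hPoly (some i)) = (zMat z T.adj).adjugate i 0 := by
  have h : (zMat z T.adj).adjugate.transpose = (zMat z T.adj).adjugate := by
    rw [Matrix.adjugate_transpose, (T.zMat_adj_isSymm z).eq]
  rw [← congrFun (congrFun h i) 0]
  exact aeval_cofactor z T.adj_isSymm T.adj_self i 0

theorem hPoly_eq_adjugate (T : AffineDiagram) (i : T.Vertex) :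
    T.hPoly (some i) = (zMat X T.adj).adjugate i 0 := by
  rw [← aeval_hPoly_some, Polynomial.aeval_X_left_apply]

/-- The first column of the adjugate matrix of `z E - A` satisfies the equations which determine
the Poincaré series. -/
theorem hPoly_eq (T : AffineDiagram) (i : T.Vertex) :
    X * T.hPoly (some i) =
      ∑ j, (T.adj i j : ℤ[X]) * T.hPoly (some j) + if i = 0 then T.hPoly none else 0 := by
  have h1 : (zMat X T.adj).mulVec (fun j => T.hPoly (some j)) i =
      if i = 0 then T.hPoly none else 0 := by
    have h2 : ∀ A : Matrix T.Vertex T.Vertex ℤ[X],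
        A.mulVec (fun j => A.adjugate j 0) i = if i = 0 then A.det else 0 := fun A => by
      have h3 := congrFun (congrFun (Matrix.mul_adjugate A) i) 0
      rwa [Matrix.smul_apply, Matrix.one_apply, smul_eq_mul, mul_ite, mul_one, mul_zero] at h3
    have h4 : T.hPoly none = (zMat X T.adj).det := by rw [← charMat_adj]; rfl
    simp_rw [hPoly_eq_adjugate, h4]
    exact h2 _
  rw [zMat_mulVec] at h1
  rw [← h1]
  ring

section Field
variable {K : Type*} [Field K] [Algebra ℤ K] {q : K}

/-- The polynomials `Z_i` solve the same linear system as the Poincaré series, up to a factor. -/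
theorem zMat_mulVec_zPoly (T : AffineDiagram) (hq : q ≠ 0) :
    (zMat (q + q⁻¹) T.adj).mulVec (fun i => aeval q (T.zPoly i)) =
      Pi.single 0 (q⁻¹ * (1 - q ^ T.expA) * (1 - q ^ T.expB)) := by
  funext i
  have h := congrArg (aeval q) (T.zPoly_eq i)
  simp only [map_mul, map_add, map_pow, aeval_X, map_one, map_sum, map_natCast, apply_ite (aeval q),
    map_sub, map_zero] at h
  rw [zMat_mulVec, Pi.single_apply]
  have h2 : q * ((q + q⁻¹) * aeval q (T.zPoly i) - ∑ j, (T.adj i j : K) * aeval q (T.zPoly j)) =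
      if i = 0 then (1 - q ^ T.expA) * (1 - q ^ T.expB) else 0 := by
    have h3 : q * ((q + q⁻¹) * aeval q (T.zPoly i)) = (q ^ 2 + 1) * aeval q (T.zPoly i) := by
      field_simp
    rw [mul_sub, h3, h]
    ring
  rw [eq_comm, ← mul_right_inj' hq, h2]
  split_ifs
  · field_simp
  · rw [mul_zero]

/-- The polynomials `H_{i0}` and `Z_i` are proportional. -/
theorem hPoly_mul_zPoly (T : AffineDiagram) (hq : q ≠ 0) (i : T.Vertex) :
    aeval (q + q⁻¹) (T.hPoly none) * aeval q (T.zPoly i) =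
      q⁻¹ * (1 - q ^ T.expA) * (1 - q ^ T.expB) * aeval (q + q⁻¹) (T.hPoly (some i)) := by
  rw [aeval_hPoly_none, aeval_hPoly_some]
  exact det_mul_eq_of_mulVec_eq_single (T.zMat_mulVec_zPoly hq) i

end Field
end AffineDiagram

/-! ### Laurent series -/

theorem qL_ne_zero : qL ≠ 0 := by simp [qL]

theorem coe_X : ((PowerSeries.X : PowerSeries ℚ) : ℚ⸨X⸩) = qL := by
  simp [qL, HahnSeries.ofPowerSeries_X]

theorem aeval_qL_injective : Function.Injective (aeval (R := ℤ) qL) := by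
  have h : (aeval (R := ℤ) qL).toRingHom = (HahnSeries.ofPowerSeries ℤ ℚ).comp
      ((Polynomial.coeToPowerSeries.ringHom).comp (Polynomial.mapRingHom (Int.castRingHom ℚ))) := by
    refine Polynomial.ringHom_ext (fun a => ?_) ?_
    · simp
    · simp [qL]
  have h2 : Function.Injective (aeval (R := ℤ) qL).toRingHom := by
    rw [h]
    rw [RingHom.coe_comp, RingHom.coe_comp]
    refine HahnSeries.ofPowerSeries_injective.comp (Function.Injective.comp ?_ ?_)
    · exact Polynomial.coe_injective ℚ
    · exact Polynomial.map_injective _ (Int.castRingHom ℚ).injective_int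
  exact h2

theorem det_zMat_zL_ne_zero {N : ℕ} (a : Matrix (Fin N) (Fin N) ℕ) : (zMat zL a).det ≠ 0 := by
  -- `z E - A` is `z` times the image of an invertible matrix of power series
  set A : Matrix (Fin N) (Fin N) (PowerSeries ℚ) :=
    1 - zInv • a.map (fun n => (n : PowerSeries ℚ)) with hA
  have hA0 : PowerSeries.constantCoeff A.det = 1 := by
    rw [RingHom.map_det]
    have : (PowerSeries.constantCoeff (R := ℚ)).mapMatrix A = 1 := by
      rw [hA, map_sub, map_one]
      ext i j
      simp [zInv]
    rw [this, Matrix.det_one]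
  have hA1 : A.det ≠ 0 := fun h => by simp [h] at hA0
  have hz : zL ≠ 0 := fun h => by
    have h1 : zInv ≠ 0 := fun h0 => by
      have h2 : zInv * (1 + PowerSeries.X ^ 2) = PowerSeries.X := by
        rw [zInv, mul_assoc, PowerSeries.inv_mul_cancel _ (by simp), mul_one]
      rw [h0, zero_mul] at h2
      exact PowerSeries.X_ne_zero h2.symm
    have h3 := coe_zInv
    rw [h, inv_zero] at h3
    exact h1 (HahnSeries.ofPowerSeries_injective (h3.trans (map_zero _).symm))
  have hmap : zMat zL a = zL • (HahnSeries.ofPowerSeries ℤ ℚ).mapMatrix A := by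
    ext1 i j
    rw [Matrix.smul_apply, RingHom.mapMatrix_apply, Matrix.map_apply, hA, Matrix.sub_apply,
      Matrix.smul_apply, Matrix.map_apply, map_sub, smul_eq_mul, smul_eq_mul, map_mul, mul_sub,
      ← mul_assoc]
    have h1 : HahnSeries.ofPowerSeries ℤ ℚ zInv = zL⁻¹ := coe_zInv
    rw [h1, mul_inv_cancel₀ hz, one_mul, zMat, Matrix.of_apply, Matrix.one_apply]
    split_ifs <;> simp
  rw [hmap, Matrix.det_smul, ← RingHom.map_det]
  refine mul_ne_zero (pow_ne_zero _ hz) fun h => hA1 ?_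
  exact HahnSeries.ofPowerSeries_injective (h.trans (map_zero _).symm)

section Laurent
variable {B : Subgroup SU2} [Finite B] {T : AffineDiagram} (M : McKay B T)

theorem McKay.poincare_eq (i : T.Vertex) :
    (PowerSeries.X ^ 2 + 1) * M.poincare i =
      PowerSeries.X * ∑ j, (T.adj i j : PowerSeries ℚ) * M.poincare j +
        if i = 0 then 1 else 0 := by
  have hc : ∀ (n m : ℕ) (p : PowerSeries ℚ), PowerSeries.coeff n ((m : PowerSeries ℚ) * p) =
      m * PowerSeries.coeff n p := fun n m p => by
    rw [← nsmul_eq_mul, map_nsmul, nsmul_eq_mul]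
  ext n
  rw [add_mul, one_mul, map_add, map_add]
  rcases n with _ | _ | n
  · have : PowerSeries.coeff 0 (if i = 0 then 1 else 0 : PowerSeries ℚ) =
        if i = 0 then 1 else 0 := by split_ifs <;> simp
    rw [this]
    simp [McKay.poincare, M.mult_zero]
  · have : PowerSeries.coeff (0 + 1) (if i = 0 then 1 else 0 : PowerSeries ℚ) = 0 := by
      split_ifs <;> simp [PowerSeries.coeff_one]
    rw [this, PowerSeries.coeff_succ_X_mul, pow_two, mul_assoc, PowerSeries.coeff_succ_X_mul,
      PowerSeries.coeff_zero_X_mul, map_sum]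
    simp_rw [hc]
    simp [McKay.poincare, M.mult_one]
  · have : PowerSeries.coeff (n + 1 + 1) (if i = 0 then 1 else 0 : PowerSeries ℚ) = 0 := by
      split_ifs <;> simp [PowerSeries.coeff_one]
    rw [this, PowerSeries.coeff_succ_X_mul, pow_two, mul_assoc, PowerSeries.coeff_succ_X_mul,
      PowerSeries.coeff_succ_X_mul, map_sum]
    simp_rw [hc]
    have := M.mult_add_two n i
    simp only [McKay.poincare, PowerSeries.coeff_mk, add_zero]
    rw [add_comm]
    exact_mod_cast this

/-- The linear system for the Poincaré series. -/
theorem McKay.zMat_mulVec_poincare :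
    (zMat zL T.adj).mulVec (fun i => (M.poincare i : ℚ⸨X⸩)) = Pi.single 0 qL⁻¹ := by
  funext i
  have h := congrArg (HahnSeries.ofPowerSeries ℤ ℚ) (M.poincare_eq i)
  simp only [map_mul, map_add, map_pow, map_one, map_sum, map_natCast, map_zero,
    apply_ite (HahnSeries.ofPowerSeries ℤ ℚ)] at h
  have hX : HahnSeries.ofPowerSeries ℤ ℚ PowerSeries.X = qL := coe_X
  rw [hX] at h
  rw [zMat_mulVec, Pi.single_apply, ← mul_right_inj' qL_ne_zero, mul_sub, ← mul_assoc,
    show qL * zL = qL ^ 2 + 1 by rw [zL, mul_add, mul_inv_cancel₀ qL_ne_zero]; ring, h]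
  split_ifs
  · rw [mul_inv_cancel₀ qL_ne_zero]
    ring
  · ring

theorem AffineDiagram.hSeries_none_ne_zero (T : AffineDiagram) : T.hSeries none ≠ 0 := by
  rw [AffineDiagram.hSeries, T.aeval_hPoly_none]
  exact det_zMat_zL_ne_zero T.adj

theorem McKay.pL_mul_hSeries (i : Option T.Vertex) :
    M.pL i * T.hSeries none = M.pL none * T.hSeries i := by
  rcases i with _ | i
  · rfl
  · have := det_mul_eq_of_mulVec_eq_single M.zMat_mulVec_poincare i
    rw [AffineDiagram.hSeries, AffineDiagram.hSeries, T.aeval_hPoly_none, T.aeval_hPoly_some]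
    rw [mul_comm]
    exact this

theorem AffineDiagram.zSeries_mul_hSeries (T : AffineDiagram) (i : Option T.Vertex) :
    T.zSeries i * T.hSeries none = T.zSeries none * T.hSeries i := by
  rcases i with _ | i
  · rfl
  · have := T.hPoly_mul_zPoly qL_ne_zero i
    rw [mul_comm]
    exact this

theorem AffineDiagram.expA_pos (T : AffineDiagram) : 0 < T.expA := by
  cases T <;> simp [expA]

theorem AffineDiagram.expB_pos (T : AffineDiagram) : 0 < T.expB := by
  cases T <;> simp [expB]
  omega

theorem AffineDiagram.zExps_ne_nil (T : AffineDiagram) (i : T.Vertex) : T.zExps i ≠ [] := by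
  cases T with
  | A n hn => simp [zExps]
  | D n hn =>
    simp only [zExps]
    split_ifs <;> simp
  | E6 => revert i; decide
  | E7 => revert i; decide
  | E8 => revert i; decide

theorem AffineDiagram.eval_one_zPoly (T : AffineDiagram) (i : T.Vertex) :
    (T.zPoly i).eval 1 = ((T.zExps i).length : ℤ) := by
  rw [zPoly]
  induction T.zExps i with
  | nil => simp
  | cons a l ih => simp [ih, add_comm]

theorem AffineDiagram.eval_one_zPoly_pos (T : AffineDiagram) (i : T.Vertex) :
    0 < (T.zPoly i).eval 1 := by
  rw [eval_one_zPoly]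
  exact_mod_cast List.length_pos_iff.2 (T.zExps_ne_nil i)

theorem one_sub_qL_pow_ne_zero {k : ℕ} (hk : 0 < k) : 1 - qL ^ k ≠ 0 := by
  have h1 : aeval qL (1 - X ^ k : ℤ[X]) = 1 - qL ^ k := by simp
  rw [← h1, ← map_zero (aeval (R := ℤ) qL)]
  refine aeval_qL_injective.ne fun h => ?_
  have := congrArg (Polynomial.eval 0) h
  simp [hk.ne'] at this

theorem AffineDiagram.zSeries_ne_zero (T : AffineDiagram) (i : Option T.Vertex) :
    T.zSeries i ≠ 0 := by
  rcases i with _ | i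
  · exact mul_ne_zero (mul_ne_zero (inv_ne_zero qL_ne_zero) (one_sub_qL_pow_ne_zero T.expA_pos))
      (one_sub_qL_pow_ne_zero T.expB_pos)
  · rw [zSeries, ← map_zero (aeval (R := ℤ) qL)]
    refine aeval_qL_injective.ne fun h => ?_
    have := T.eval_one_zPoly_pos i
    rw [h] at this
    simp at this

theorem AffineDiagram.hSeries_ne_zero (T : AffineDiagram) (i : Option T.Vertex) :
    T.hSeries i ≠ 0 := by
  have h := mul_ne_zero (T.zSeries_ne_zero i) T.hSeries_none_ne_zero
  rw [zSeries_mul_hSeries] at h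
  exact right_ne_zero_of_mul h

theorem McKay.pL_ne_zero (i : Option T.Vertex) : M.pL i ≠ 0 := by
  have h : M.pL none * T.hSeries i ≠ 0 :=
    mul_ne_zero (inv_ne_zero qL_ne_zero) (T.hSeries_ne_zero i)
  rw [← pL_mul_hSeries] at h
  exact left_ne_zero_of_mul h

theorem McKay.pL_div_pL (i j : Option T.Vertex) :
    M.pL i / M.pL j = T.hSeries i / T.hSeries j := by
  rw [div_eq_div_iff (M.pL_ne_zero j) (T.hSeries_ne_zero j)]
  refine mul_right_cancel₀ T.hSeries_none_ne_zero ?_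
  linear_combination T.hSeries j * M.pL_mul_hSeries i - T.hSeries i * M.pL_mul_hSeries j

theorem AffineDiagram.zSeries_div_zSeries (T : AffineDiagram) (i j : Option T.Vertex) :
    T.zSeries i / T.zSeries j = T.hSeries i / T.hSeries j := by
  rw [div_eq_div_iff (T.zSeries_ne_zero j) (T.hSeries_ne_zero j)]
  refine mul_right_cancel₀ T.hSeries_none_ne_zero ?_
  linear_combination T.hSeries j * T.zSeries_mul_hSeries i - T.hSeries i * T.zSeries_mul_hSeries j

theorem McKay.poincare_eq_div (i : T.Vertex) :
    (M.poincare i : ℚ⸨X⸩) = T.hSeries (some i) / (qL * T.hSeries none) := by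
  rw [eq_div_iff (mul_ne_zero qL_ne_zero T.hSeries_none_ne_zero)]
  have h := M.pL_mul_hSeries (some i)
  simp only [McKay.pL] at h
  rw [mul_left_comm, h, mul_inv_cancel_left₀ qL_ne_zero]

end Laurent

/-! ### Coxeter polynomials of the Euclidean diagrams -/

theorem diagram_isSymm (N : ℕ) (E : ℕ → ℕ → Bool) : (diagram N E).IsSymm := by
  ext i j
  exact diagram_comm N E j i

theorem diagram_self (N : ℕ) (p : ℕ → ℕ → Prop) [∀ i j, Decidable (p i j)]
    (h : ∀ i, i < N → ¬ p i i) (i : Fin N) : diagram N (fun i j => decide (p i j)) i i = 0 := by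
  rw [diagram_apply, if_neg (h i i.2)]

theorem diagram_ne_zero {N : ℕ} {p : ℕ → ℕ → Prop} [∀ i j, Decidable (p i j)] {i j : Fin N}
    (h : diagram N (fun i j => decide (p i j)) i j ≠ 0) : p i j ∨ p j i := by
  rw [diagram_apply] at h
  by_contra hcon
  rw [not_or] at hcon
  rw [if_neg hcon.1, if_neg hcon.2] at h
  exact h rfl

section Dynkin
variable {K : Type} [Field K] {q : K}

theorem coxeter_dynkinA_eq_det (hq : q ≠ 0) (k : ℕ) :
    coxeter q (dynkinA k) = (zMat (q + q⁻¹) (dynkinA k)).det := by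
  refine coxeter_eq_det_of_isParent hq (diagram_isSymm _ _)
    (diagram_self _ _ fun i _ => by omega) (Adj := fun i j : ℕ => j = i + 1 ∨ i = j + 1)
    (par := fun i => i - 1) (depth := id) ?_ Fin.val Fin.val_injective
    fun i j h => diagram_ne_zero h
  intro u v huv
  simp only [id]
  omega

theorem coxeter_dynkinD_eq_det (hq : q ≠ 0) (k : ℕ) :
    coxeter q (dynkinD k) = (zMat (q + q⁻¹) (dynkinD k)).det := by
  refine coxeter_eq_det_of_isParent hq (diagram_isSymm _ _)
    (diagram_self _ _ fun i _ => by omega)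
    (Adj := fun i j : ℕ => ((i = 0 ∧ j = 2) ∨ (1 ≤ i ∧ j = i + 1)) ∨
      ((j = 0 ∧ i = 2) ∨ (1 ≤ j ∧ i = j + 1)))
    (par := fun i => if i = 0 then 2 else i - 1) (depth := fun i => if i = 0 then 3 else i) ?_
    Fin.val Fin.val_injective fun i j h => diagram_ne_zero h
  intro u v huv
  simp only
  split_ifs <;> omega

theorem coxeter_dynkinE_eq_det (hq : q ≠ 0) {k : ℕ} (hk : 4 ≤ k) :
    coxeter q (dynkinE k) = (zMat (q + q⁻¹) (dynkinE k)).det := by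
  refine coxeter_eq_det_of_isParent hq (diagram_isSymm _ _)
    (diagram_self _ _ fun i _ => by omega)
    (Adj := fun i j : ℕ => ((j = i + 1 ∧ j + 1 < k) ∨ (i = 2 ∧ j + 1 = k)) ∨
      ((i = j + 1 ∧ i + 1 < k) ∨ (j = 2 ∧ i + 1 = k)))
    (par := fun i => if i + 1 = k then 2 else i - 1)
    (depth := fun i => if i + 1 = k then 3 else i) ?_
    Fin.val Fin.val_injective fun i j h => diagram_ne_zero h
  intro u v huv
  simp only
  split_ifs <;> omega

/-- The numerator `q ^ m - q ^ (-m)` of the quantum integer `[m]`. -/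
def qNum (q : K) (m : ℕ) : K := q ^ m - (q ^ m)⁻¹

theorem qNum_zero (q : K) : qNum q 0 = 0 := by simp [qNum]

theorem qNum_rec (hq : q ≠ 0) (m : ℕ) :
    (q + q⁻¹) * qNum q (m + 1) = qNum q (m + 2) + qNum q m := by
  simp only [qNum]
  field_simp
  ring

theorem qNum_ne_zero (hq0 : q ≠ 0) (hq : ∀ k, 0 < k → q ^ k ≠ 1) {m : ℕ} (hm : 0 < m) :
    qNum q m ≠ 0 := by
  intro h
  rw [qNum, sub_eq_zero, ← mul_eq_one_iff_eq_inv₀ (pow_ne_zero _ hq0), ← pow_add] at h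
  exact hq _ (by omega) h

/-- Cramer's rule for the vertex `0`: the cofactor is the determinant of the graph without `0`. -/
theorem det_zMat_mul_eq {n : ℕ} {z : K} {a : Matrix (Fin (n + 1)) (Fin (n + 1)) ℕ}
    {u : Fin (n + 1) → K} {c : K} (h : (zMat z a).mulVec u = Pi.single 0 c) :
    (zMat z a).det * u 0 = c * (zMat z (a.submatrix Fin.succ Fin.succ)).det := by
  rw [det_mul_eq_of_mulVec_eq_single_zero h, zMat_submatrix _ _ (Fin.succ_injective _)]

theorem dynkinA_submatrix (k : ℕ) :
    (dynkinA (k + 1)).submatrix Fin.succ Fin.succ = dynkinA k := by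
  ext i j
  simp [dynkinA, diagram]

theorem dynkinD_submatrix (k : ℕ) :
    (dynkinD (k + 1)).submatrix Fin.succ Fin.succ = dynkinA k := by
  ext i j
  simp [dynkinA, dynkinD, diagram]

theorem dynkinA_eq_count (k : ℕ) (i j : Fin k) : dynkinA k i j =
    ((if i.val = 0 then [] else [i.val - 1]) ++
      (if i.val + 1 = k then [] else [i.val + 1])).count j.val := by
  rw [dynkinA, diagram_apply, List.count_append, apply_ite (List.count j.val),
    apply_ite (List.count j.val)]
  have hi := i.2
  have hj := j.2
  simp only [List.count_cons, List.count_nil, beq_iff_eq]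
  split_ifs <;> omega

theorem dynkinD_eq_count (k : ℕ) (hk : 3 ≤ k) (i j : Fin k) : dynkinD k i j =
    (if i.val ≤ 1 then [2] else (if i.val = 2 then [0, 1] else [i.val - 1]) ++
      (if i.val + 1 = k then [] else [i.val + 1])).count j.val := by
  rw [dynkinD, diagram_apply, apply_ite (List.count j.val), List.count_append,
    apply_ite (List.count j.val), apply_ite (List.count j.val)]
  have hi := i.2
  have hj := j.2
  simp only [List.count_cons, List.count_nil, beq_iff_eq]
  split_ifs <;> omega

theorem sum_dynkinA_mul (k : ℕ) (i : Fin k) (f : ℕ → K) :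
    ∑ j, (dynkinA k i j : K) * f j = (if i.val = 0 then 0 else f (i.val - 1)) +
      if i.val + 1 = k then 0 else f (i.val + 1) := by
  simp_rw [dynkinA_eq_count]
  rw [sum_count_mul]
  · split_ifs <;> simp
  · have hi := i.2
    intro l hl
    split_ifs at hl <;> simp at hl <;> omega

theorem sum_dynkinD_mul (k : ℕ) (hk : 3 ≤ k) (i : Fin k) (f : ℕ → K) :
    ∑ j, (dynkinD k i j : K) * f j = if i.val ≤ 1 then f 2 else
      (if i.val = 2 then f 0 + f 1 else f (i.val - 1)) +
      if i.val + 1 = k then 0 else f (i.val + 1) := by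
  simp_rw [dynkinD_eq_count k hk]
  rw [sum_count_mul]
  · split_ifs <;> simp [add_assoc]
  · have hi := i.2
    intro l hl
    split_ifs at hl <;> simp at hl <;> omega

theorem det_dynkinA (hq0 : q ≠ 0) (hq : ∀ k, 0 < k → q ^ k ≠ 1) (k : ℕ) :
    (zMat (q + q⁻¹) (dynkinA k)).det * qNum q 1 = qNum q (k + 1) := by
  induction k with
  | zero => simp
  | succ k ih =>
    -- the quantum integers `[k + 1], …, [1]` solve the system with right-hand side `[k + 2] e₀`
    have h : (zMat (q + q⁻¹) (dynkinA (k + 1))).mulVec (fun i => qNum q (k + 1 - i.val)) =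
        Pi.single 0 (qNum q (k + 2)) := by
      funext i
      have hi := i.2
      rw [zMat_mulVec, sum_dynkinA_mul (k + 1) i fun j => qNum q (k + 1 - j), Pi.single_apply,
        if_congr (Fin.val_eq_zero_iff (a := i)).symm rfl rfl]
      obtain ⟨m, hm⟩ : ∃ m, k = i.val + m := ⟨k - i.val, by omega⟩
      have hlast : (if i.val + 1 = k + 1 then 0 else qNum q (k + 1 - (i.val + 1))) = qNum q m := by
        split_ifs with h
        · rw [show m = 0 by omega, qNum_zero]
        · rw [show k + 1 - (i.val + 1) = m by omega]
      rw [hlast, show k + 1 - i.val = m + 1 by omega, qNum_rec hq0]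
      by_cases h0 : i.val = 0
      · rw [if_pos h0, if_pos h0, show k + 2 = m + 2 by omega]
        ring
      · rw [if_neg h0, if_neg h0, show k + 1 - (i.val - 1) = m + 2 by omega]
        ring
    have h2 := det_zMat_mul_eq h
    rw [dynkinA_submatrix] at h2
    have h3 : qNum q (k + 1) ≠ 0 := qNum_ne_zero hq0 hq (by omega)
    refine mul_right_cancel₀ h3 ?_
    simp only [Fin.val_zero, Nat.sub_zero] at h2
    linear_combination qNum q 1 * h2 + qNum q (k + 2) * ih

theorem coxeter_dynkinA (hq0 : q ≠ 0) (hq : ∀ k, 0 < k → q ^ k ≠ 1) (k : ℕ) :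
    coxeter q (dynkinA k) * (q - q⁻¹) = q ^ (k + 1) - (q ^ (k + 1))⁻¹ := by
  have := det_dynkinA hq0 hq k
  rw [coxeter_dynkinA_eq_det hq0]
  simpa [qNum] using this

theorem coxeter_dynkinD (hq0 : q ≠ 0) (hq : ∀ k, 0 < k → q ^ k ≠ 1) {k : ℕ} (hk : 2 ≤ k) :
    coxeter q (dynkinD k) = (q + q⁻¹) * (q ^ (k - 1) + (q ^ (k - 1))⁻¹) := by
  rw [coxeter_dynkinD_eq_det hq0]
  rcases eq_or_lt_of_le hk with rfl | hk3
  · rw [Matrix.det_fin_two]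
    simp [zMat, dynkinD, diagram]
  obtain ⟨m, rfl⟩ : ∃ m, k = m + 3 := ⟨k - 3, by omega⟩
  -- a solution of `(z E - A) u = c e₀`; the end of the chain corresponds to `[0] = 0`, and the value
  -- at `0` is determined by the equation at the vertex `2`
  set u : ℕ → K := fun j => if j = 0 then qNum q (m + 3) else if j = 1 then qNum q (m + 1) else
    (q + q⁻¹) * qNum q (m + 3 - j) with hu
  have hu0 : u 0 = qNum q (m + 3) := rfl
  have hu1 : u 1 = qNum q (m + 1) := rfl
  have huj : ∀ j, 2 ≤ j → u j = (q + q⁻¹) * qNum q (m + 3 - j) := fun j hj => by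
    rw [hu]
    simp only
    rw [if_neg (by omega), if_neg (by omega)]
  have h : (zMat (q + q⁻¹) (dynkinD (m + 3))).mulVec (fun i => u i.val) =
      Pi.single 0 ((q + q⁻¹) * (qNum q (m + 3) - qNum q (m + 1))) := by
    funext i
    have hi := i.2
    rw [zMat_mulVec, sum_dynkinD_mul (m + 3) (by omega) i u, Pi.single_apply,
      if_congr (Fin.val_eq_zero_iff (a := i)).symm rfl rfl]
    by_cases h1 : i.val ≤ 1
    · rw [if_pos h1, huj 2 le_rfl, show m + 3 - 2 = m + 1 by omega]
      by_cases h0 : i.val = 0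
      · rw [h0, if_pos rfl, hu0]
        ring
      · rw [show i.val = 1 by omega, if_neg one_ne_zero, hu1]
        ring
    rw [if_neg h1, if_neg (show i.val ≠ 0 by omega), huj i.val (by omega)]
    obtain ⟨l, hl⟩ : ∃ l, m + 2 = i.val + l := ⟨m + 2 - i.val, by omega⟩
    have hlast : (if i.val + 1 = m + 3 then 0 else u (i.val + 1)) = (q + q⁻¹) * qNum q l := by
      split_ifs with h
      · rw [show l = 0 by omega, qNum_zero, mul_zero]
      · rw [huj _ (by omega), show m + 3 - (i.val + 1) = l by omega]
    have hfirst : (if i.val = 2 then u 0 + u 1 else u (i.val - 1)) =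
        (q + q⁻¹) * qNum q (l + 2) := by
      split_ifs with h
      · rw [hu0, hu1, show l = m by omega, qNum_rec hq0]
      · rw [huj _ (by omega), show m + 3 - (i.val - 1) = l + 2 by omega]
    rw [hlast, hfirst, show m + 3 - i.val = l + 1 by omega, qNum_rec hq0]
    ring
  have h2 := det_zMat_mul_eq h
  rw [dynkinD_submatrix] at h2
  have h2' : (zMat (q + q⁻¹) (dynkinD (m + 3))).det * qNum q (m + 3) =
    (q + q⁻¹) * (qNum q (m + 3) - qNum q (m + 1)) * (zMat (q + q⁻¹) (dynkinA (m + 2))).det := h2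
  have h3 := det_dynkinA hq0 hq (m + 2)
  have h4 : qNum q (m + 3) ≠ 0 := qNum_ne_zero hq0 hq (by omega)
  have h5 : qNum q 1 ≠ 0 := qNum_ne_zero hq0 hq (by omega)
  have h6 : qNum q (m + 3) - qNum q (m + 1) = (q ^ (m + 2) + (q ^ (m + 2))⁻¹) * qNum q 1 := by
    simp only [qNum]
    field_simp
    ring
  rw [h6] at h2'
  refine mul_right_cancel₀ h4 ?_
  rw [show m + 3 - 1 = m + 2 by omega]
  linear_combination h2' + (q + q⁻¹) * (q ^ (m + 2) + (q ^ (m + 2))⁻¹) * h3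

theorem coxeter_dynkinA_one (hq0 : q ≠ 0) (hq : ∀ k, 0 < k → q ^ k ≠ 1) :
    coxeter q (dynkinA 1) = q + q⁻¹ := by
  have h1 : q - q⁻¹ ≠ 0 := by simpa [qNum] using qNum_ne_zero hq0 hq one_pos
  refine mul_right_cancel₀ h1 ?_
  rw [coxeter_dynkinA hq0 hq]
  field_simp
  ring

theorem coxeter_dynkinA_two (hq0 : q ≠ 0) (hq : ∀ k, 0 < k → q ^ k ≠ 1) :
    coxeter q (dynkinA 2) = q ^ 2 + 1 + (q ^ 2)⁻¹ := by
  have h1 : q - q⁻¹ ≠ 0 := by simpa [qNum] using qNum_ne_zero hq0 hq one_pos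
  refine mul_right_cancel₀ h1 ?_
  rw [coxeter_dynkinA hq0 hq]
  field_simp
  ring

theorem coxeter_dynkinA_three (hq0 : q ≠ 0) (hq : ∀ k, 0 < k → q ^ k ≠ 1) :
    coxeter q (dynkinA 3) = q ^ 3 + q + q⁻¹ + (q ^ 3)⁻¹ := by
  have h1 : q - q⁻¹ ≠ 0 := by simpa [qNum] using qNum_ne_zero hq0 hq one_pos
  refine mul_right_cancel₀ h1 ?_
  rw [coxeter_dynkinA hq0 hq]
  field_simp
  ring

theorem coxeter_dynkinA_four (hq0 : q ≠ 0) (hq : ∀ k, 0 < k → q ^ k ≠ 1) :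
    coxeter q (dynkinA 4) = q ^ 4 + q ^ 2 + 1 + (q ^ 2)⁻¹ + (q ^ 4)⁻¹ := by
  have h1 : q - q⁻¹ ≠ 0 := by simpa [qNum] using qNum_ne_zero hq0 hq one_pos
  refine mul_right_cancel₀ h1 ?_
  rw [coxeter_dynkinA hq0 hq]
  field_simp
  ring

theorem coxeter_dynkinA_five (hq0 : q ≠ 0) (hq : ∀ k, 0 < k → q ^ k ≠ 1) :
    coxeter q (dynkinA 5) = q ^ 5 + q ^ 3 + q + q⁻¹ + (q ^ 3)⁻¹ + (q ^ 5)⁻¹ := by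
  have h1 : q - q⁻¹ ≠ 0 := by simpa [qNum] using qNum_ne_zero hq0 hq one_pos
  refine mul_right_cancel₀ h1 ?_
  rw [coxeter_dynkinA hq0 hq]
  field_simp
  ring

end Dynkin

/-! ### The polynomials `H_{i0}` in terms of Coxeter polynomials -/

theorem qL_pow_ne_one (k : ℕ) (hk : 0 < k) : qL ^ k ≠ 1 := fun h =>
  one_sub_qL_pow_ne_zero hk (by rw [h, sub_self])

/-- If the vertex `0` is joined to the vertex `1` only, by a simple edge, then a solution of
`(z E - A) u = c e₀` restricts to a solution of the same kind on the graph without `0`. -/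
theorem zMat_mulVec_tail {n : ℕ} {K : Type*} [CommRing K] {z : K}
    {a : Matrix (Fin (n + 2)) (Fin (n + 2)) ℕ} {u : Fin (n + 2) → K} {c : K}
    (h : (zMat z a).mulVec u = Pi.single 0 c)
    (h0 : ∀ i : Fin (n + 1), a i.succ 0 = if i = 0 then 1 else 0) :
    (zMat z (a.submatrix Fin.succ Fin.succ)).mulVec (fun i => u i.succ) = Pi.single 0 (u 0) := by
  funext i
  have hi := congrFun h i.succ
  rw [zMat_mulVec, Fin.sum_univ_succ, Pi.single_eq_of_ne (Fin.succ_ne_zero i), h0] at hi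
  rw [zMat_mulVec, Pi.single_apply]
  simp only [Matrix.submatrix_apply]
  split_ifs at hi ⊢
  · linear_combination hi
  · linear_combination hi

namespace AffineDiagram

theorem hSeries_zero (T : AffineDiagram) : T.hSeries (some 0) =
    (zMat zL ((T.adj : Matrix (Fin (T.rank + 1)) (Fin (T.rank + 1)) ℕ).submatrix
      Fin.succ Fin.succ)).det := by
  rw [hSeries, aeval_hPoly_some, Matrix.adjugate_fin_succ_eq_det_submatrix,
    ← zMat_submatrix _ _ (Fin.succ_injective _)]
  simp

/-- `Z_i(q)` as a Laurent series, as a function of the number of the vertex. -/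
noncomputable def zSer (T : AffineDiagram) (k : ℕ) : ℚ⸨X⸩ := aeval qL (T.zNat k)

theorem zSeries_some (T : AffineDiagram) (i : T.Vertex) : T.zSeries (some i) = T.zSer i.val := by
  rw [zSeries, zSer, zPoly_eq_zNat]

/-- The ratios of the polynomials `H_{i0}` are those of the polynomials `Z_i`. -/
theorem hSeries_mul_zSer (T : AffineDiagram) (i j : T.Vertex) :
    T.hSeries (some i) * T.zSer j.val = T.zSer i.val * T.hSeries (some j) := by
  have h := T.zSeries_div_zSeries (some i) (some j)
  rw [div_eq_div_iff (T.zSeries_ne_zero _) (T.hSeries_ne_zero _), zSeries_some, zSeries_some] at h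
  rw [h, mul_comm]

theorem zSer_ne_zero (T : AffineDiagram) (i : T.Vertex) : T.zSer i.val ≠ 0 := by
  rw [← zSeries_some]
  exact T.zSeries_ne_zero _

/-- The polynomials `H_{i0}` are determined by one of them. -/
theorem hSeries_eq_of_mul (T : AffineDiagram) {i j : T.Vertex} {x y : ℚ⸨X⸩}
    (hj : T.hSeries (some j) = y) (h : x * T.zSer j.val = T.zSer i.val * y) :
    T.hSeries (some i) = x := by
  subst hj
  refine mul_right_cancel₀ (T.zSer_ne_zero j) ?_
  rw [hSeries_mul_zSer, h]

theorem zMat_mulVec_zSer (T : AffineDiagram) :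
    (zMat zL T.adj).mulVec (fun i => T.zSer i.val) = Pi.single 0 (T.zSeries none) := by
  have h := T.zMat_mulVec_zPoly qL_ne_zero
  simp_rw [zPoly_eq_zNat] at h
  exact h

/-! #### The cycles -/

theorem hSeries_A_zero (n : ℕ) (hn : 1 ≤ n) :
    (A n hn).hSeries (some 0) = coxeter qL (dynkinA n) := by
  rw [hSeries_zero, coxeter_dynkinA_eq_det qL_ne_zero]
  have : (cycle n).submatrix Fin.succ Fin.succ = dynkinA n := by
    ext i j
    have hi := i.2
    have hj := j.2
    simp only [Matrix.submatrix_apply, cycle, diagram_apply, dynkinA, Fin.val_succ]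
    grind
  rw [← this]
  rfl

theorem hSeries_A (n : ℕ) (hn : 1 ≤ n) (i : Fin (n + 1)) :
    (A n hn).hSeries (some i) = (A n hn).coxeterExpr qL i := by
  simp only [coxeterExpr]
  by_cases h0 : i.val = 0
  · rw [if_pos h0, ← hSeries_A_zero n hn, show i = (0 : Fin (n + 1)) from Fin.ext h0]
    rfl
  rw [if_neg h0]
  refine hSeries_eq_of_mul _ (hSeries_A_zero n hn) ?_
  have h1 : qL - qL⁻¹ ≠ 0 := by
    simpa [qNum] using qNum_ne_zero qL_ne_zero qL_pow_ne_one one_pos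
  refine mul_right_cancel₀ h1 ?_
  have hi := i.2
  have e1 := coxeter_dynkinA qL_ne_zero qL_pow_ne_one (i.val - 1)
  have e2 := coxeter_dynkinA qL_ne_zero qL_pow_ne_one (n - i.val)
  have e3 := coxeter_dynkinA qL_ne_zero qL_pow_ne_one n
  have z0 : (A n hn).zSer 0 = 1 + qL ^ (n + 1) := by simp [zSer, zNat]
  have zi : (A n hn).zSer i.val = qL ^ i.val + qL ^ (n + 1 - i.val) := by simp [zSer, zNat]
  have z0' : (A n hn).zSer (0 : (A n hn).Vertex).val = 1 + qL ^ (n + 1) := z0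
  obtain ⟨k, hk⟩ : ∃ k, i.val = k + 1 := ⟨i.val - 1, by omega⟩
  obtain ⟨m, hm⟩ : ∃ m, n = k + 1 + m := ⟨n - k - 1, by omega⟩
  rw [z0', zi]
  rw [hk] at e1 e2 ⊢
  rw [show n - (k + 1) = m by omega] at e2 ⊢
  rw [show k + 1 - 1 = k by omega] at e1 ⊢
  rw [show n + 1 - (k + 1) = m + 1 by omega]
  rw [show n + 1 = k + m + 2 by omega] at e3 ⊢
  have hq := qL_ne_zero
  calc _ = (coxeter qL (dynkinA k) * (qL - qL⁻¹) + coxeter qL (dynkinA m) * (qL - qL⁻¹)) *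
        (1 + qL ^ (k + m + 2)) := by ring
    _ = (qL ^ (k + 1) + qL ^ (m + 1)) * (coxeter qL (dynkinA n) * (qL - qL⁻¹)) := by
      rw [e1, e2, e3]
      field_simp
      ring
    _ = _ := by ring

/-- The characteristic polynomial of the cycle. -/
theorem hSeries_A_none (n : ℕ) (hn : 1 ≤ n) :
    (A n hn).hSeries none = qL ^ (n + 1) + (qL ^ (n + 1))⁻¹ - 2 := by
  have h := (A n hn).zSeries_mul_hSeries (some 0)
  rw [hSeries_A_zero, zSeries_some] at h
  have z0 : (A n hn).zSer (0 : (A n hn).Vertex).val = 1 + qL ^ (n + 1) := by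
    have : (A n hn).zSer 0 = 1 + qL ^ (n + 1) := by simp [zSer, zNat]
    exact this
  have z1 : (A n hn).zSeries none = qL⁻¹ * (1 - qL ^ 2) * (1 - qL ^ (n + 1)) := rfl
  have e3 := coxeter_dynkinA qL_ne_zero qL_pow_ne_one n
  have hne := (A n hn).zSer_ne_zero 0
  rw [z0] at h hne
  rw [z1] at h
  refine mul_left_cancel₀ hne ?_
  rw [h]
  have hq := qL_ne_zero
  calc _ = (coxeter qL (dynkinA n) * (qL - qL⁻¹)) * (qL ^ (n + 1) - 1) := by
        field_simp
        ring
    _ = _ := by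
        rw [e3]
        field_simp
        ring

/-! #### The diagrams `D̃_n` -/

theorem hSeries_D_zero (n : ℕ) (hn : 4 ≤ n) :
    (D n hn).hSeries (some 0) = coxeter qL (dynkinD n) := by
  rw [hSeries_zero, coxeter_dynkinD_eq_det qL_ne_zero,
    ← det_zMat_submatrix_equiv _ (dynkinD n) Fin.revPerm]
  have : (diagram (n + 1) fun i j => decide ((i = 0 ∧ j = 2) ∨ (1 ≤ i ∧ j = i + 1 ∧ j < n) ∨
      (i + 2 = n ∧ j = n))).submatrix Fin.succ Fin.succ =
        (dynkinD n).submatrix Fin.revPerm Fin.revPerm := by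
    ext i j
    have hi := i.2
    have hj := j.2
    simp only [Matrix.submatrix_apply, diagram_apply, dynkinD, Fin.val_succ, Fin.revPerm_apply,
      Fin.val_rev]
    grind
  rw [← this]
  rfl

theorem hSeries_D (n : ℕ) (hn : 4 ≤ n) (i : Fin (n + 1)) :
    (D n hn).hSeries (some i) = (D n hn).coxeterExpr qL i := by
  have hq := qL_ne_zero
  simp only [coxeterExpr]
  by_cases h0 : i.val = 0
  · rw [if_pos h0, ← hSeries_D_zero n hn, show i = (0 : Fin (n + 1)) from Fin.ext h0]
    rfl
  rw [if_neg h0]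
  refine hSeries_eq_of_mul _ ((hSeries_D_zero n hn).trans
    (coxeter_dynkinD qL_ne_zero qL_pow_ne_one (by omega))) ?_
  have hi := i.2
  have z0 : (D n hn).zSer (0 : (D n hn).Vertex).val = 1 + qL ^ (2 * n - 2) := by
    have : (D n hn).zSer 0 = 1 + qL ^ (2 * n - 2) := by simp [zSer, zNat]
    exact this
  rw [z0]
  by_cases h1 : i.val = 1
  · have z1 : (D n hn).zSer i.val = qL ^ 2 + qL ^ (2 * n - 4) := by simp [zSer, zNat, h1]
    rw [if_pos h1, z1, coxeter_dynkinD qL_ne_zero qL_pow_ne_one (by omega)]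
    obtain ⟨m, rfl⟩ : ∃ m, n = m + 4 := ⟨n - 4, by omega⟩
    rw [show 2 * (m + 4) - 2 = 2 * m + 6 by omega, show m + 4 - 2 - 1 = m + 1 by omega,
      show 2 * (m + 4) - 4 = 2 * m + 4 by omega, show m + 4 - 1 = m + 3 by omega]
    field_simp
    ring
  rw [if_neg h1]
  by_cases h2 : i.val + 2 ≤ n
  · have zi : (D n hn).zSer i.val = qL ^ (i.val - 1) + qL ^ (i.val + 1) +
        qL ^ (2 * n - i.val - 3) + qL ^ (2 * n - i.val - 1) := by simp [zSer, zNat, h0, h1, h2]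
    rw [if_pos h2, zi, coxeter_dynkinD qL_ne_zero qL_pow_ne_one (by omega),
      coxeter_dynkinA_one qL_ne_zero qL_pow_ne_one]
    obtain ⟨k, hk⟩ : ∃ k, i.val = k + 2 := ⟨i.val - 2, by omega⟩
    obtain ⟨m, rfl⟩ : ∃ m, n = k + m + 4 := ⟨n - k - 4, by omega⟩
    rw [hk, show 2 * (k + m + 4) - 2 = 2 * k + 2 * m + 6 by omega,
      show k + m + 4 - (k + 2) - 1 = m + 1 by omega, show k + 2 - 1 = k + 1 by omega,
      show 2 * (k + m + 4) - (k + 2) - 3 = k + 2 * m + 3 by omega,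
      show 2 * (k + m + 4) - (k + 2) - 1 = k + 2 * m + 5 by omega,
      show k + m + 4 - 1 = k + m + 3 by omega]
    field_simp
    ring
  · have zi : (D n hn).zSer i.val = qL ^ (n - 2) + qL ^ n := by simp [zSer, zNat, h0, h1, h2]
    rw [if_neg h2, zi, coxeter_dynkinA_one qL_ne_zero qL_pow_ne_one]
    obtain ⟨m, rfl⟩ : ∃ m, n = m + 4 := ⟨n - 4, by omega⟩
    rw [show 2 * (m + 4) - 2 = 2 * m + 6 by omega, show m + 4 - 2 = m + 2 by omega,
      show m + 4 - 1 = m + 3 by omega]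
    field_simp
    ring

/-! #### The diagrams `Ẽ_6`, `Ẽ_7`, `Ẽ_8` -/

/-- Along the chain of the vertices `0, 1, 2, …` the polynomial `H_{i0}` is the characteristic
polynomial of the graph without `0, …, i`. -/
theorem hSeries_succ_of_tail (T : AffineDiagram) {i j : T.Vertex} {m : ℕ}
    {a : Matrix (Fin (m + 1)) (Fin (m + 1)) ℕ} {u : Fin (m + 1) → ℚ⸨X⸩}
    (hj : T.hSeries (some j) = (zMat zL a).det)
    (h : (zMat zL a).mulVec u = Pi.single 0 (T.zSer j.val)) (hi : u 0 = T.zSer i.val) :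
    T.hSeries (some i) = (zMat zL (a.submatrix Fin.succ Fin.succ)).det := by
  refine T.hSeries_eq_of_mul hj ?_
  rw [mul_comm, ← det_zMat_mul_eq h, hi, mul_comm]

theorem hSeries_E6_zero_eq_det : E6.hSeries (some (0 : Fin 7)) =
    (zMat zL (Matrix.submatrix (m := Fin 7) (n := Fin 7) E6.adj Fin.succ Fin.succ :
      Matrix (Fin 6) (Fin 6) ℕ)).det := E6.hSeries_zero

theorem zMat_mulVec_E6 :
    (zMat zL (E6.adj : Matrix (Fin 7) (Fin 7) ℕ)).mulVec (fun i => E6.zSer i.val) =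
      Pi.single 0 (E6.zSeries none) := E6.zMat_mulVec_zSer

theorem hSeries_E6_zero : E6.hSeries (some (0 : Fin 7)) = coxeter qL (dynkinE 6) := by
  rw [coxeter_dynkinE_eq_det qL_ne_zero (by norm_num)]
  refine hSeries_E6_zero_eq_det.trans ?_
  rw [← det_zMat_submatrix_equiv _ (dynkinE 6)
    ⟨![5, 2, 1, 0, 3, 4], ![3, 2, 1, 4, 5, 0], by decide, by decide⟩]
  congr 2
  decide

theorem hSeries_E6_one : E6.hSeries (some (1 : Fin 7)) = coxeter qL (dynkinA 5) := by
  rw [coxeter_dynkinA_eq_det qL_ne_zero]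
  have h := zMat_mulVec_tail zMat_mulVec_E6 (by decide)
  refine (E6.hSeries_succ_of_tail hSeries_E6_zero_eq_det h rfl).trans ?_
  rw [← det_zMat_submatrix_equiv _ (dynkinA 5)
    ⟨![2, 1, 0, 3, 4], ![2, 1, 0, 3, 4], by decide, by decide⟩]
  congr 2
  decide

theorem hSeries_E6 (i : Fin 7) : E6.hSeries (some i) = E6.coxeterExpr qL i := by
  have hq := qL_ne_zero
  have h : ∀ {i : Fin 7} {x : ℚ⸨X⸩}, x * E6.zSer 1 = E6.zSer i.val * coxeter qL (dynkinA 5) →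
      E6.hSeries (some i) = x := fun h => hSeries_eq_of_mul _ hSeries_E6_one h
  fin_cases i
  · exact hSeries_E6_zero
  · exact hSeries_E6_one
  all_goals
    refine h ?_
    simp [coxeterExpr, zSer, zNat, coxeter_dynkinA_one qL_ne_zero qL_pow_ne_one,
      coxeter_dynkinA_two qL_ne_zero qL_pow_ne_one, coxeter_dynkinA_five qL_ne_zero qL_pow_ne_one]
    field_simp
    ring

theorem hSeries_E7_zero_eq_det : E7.hSeries (some (0 : Fin 8)) =
    (zMat zL (Matrix.submatrix (m := Fin 8) (n := Fin 8) E7.adj Fin.succ Fin.succ :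
      Matrix (Fin 7) (Fin 7) ℕ)).det := E7.hSeries_zero

theorem zMat_mulVec_E7 :
    (zMat zL (E7.adj : Matrix (Fin 8) (Fin 8) ℕ)).mulVec (fun i => E7.zSer i.val) =
      Pi.single 0 (E7.zSeries none) := E7.zMat_mulVec_zSer

theorem hSeries_E7_zero : E7.hSeries (some (0 : Fin 8)) = coxeter qL (dynkinE 7) := by
  rw [coxeter_dynkinE_eq_det qL_ne_zero (by norm_num)]
  refine hSeries_E7_zero_eq_det.trans ?_
  congr 2
  decide

theorem hSeries_E7_two : E7.hSeries (some (2 : Fin 8)) = coxeter qL (dynkinA 5) := by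
  rw [coxeter_dynkinA_eq_det qL_ne_zero]
  have h1 := zMat_mulVec_tail zMat_mulVec_E7 (by decide)
  have h2 := zMat_mulVec_tail h1 (by decide)
  have e1 := E7.hSeries_succ_of_tail (i := (1 : Fin 8)) hSeries_E7_zero_eq_det h1 rfl
  refine (E7.hSeries_succ_of_tail e1 h2 rfl).trans ?_
  rw [← det_zMat_submatrix_equiv _ (dynkinA 5)
    ⟨![3, 2, 1, 0, 4], ![3, 2, 1, 0, 4], by decide, by decide⟩]
  congr 2
  decide

theorem hSeries_E7 (i : Fin 8) : E7.hSeries (some i) = E7.coxeterExpr qL i := by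
  have hq := qL_ne_zero
  have h : ∀ {i : Fin 8} {x : ℚ⸨X⸩}, x * E7.zSer 2 = E7.zSer i.val * coxeter qL (dynkinA 5) →
      E7.hSeries (some i) = x := fun h => hSeries_eq_of_mul _ hSeries_E7_two h
  have hD := coxeter_dynkinD (k := 6) qL_ne_zero qL_pow_ne_one (by norm_num)
  fin_cases i
  · exact hSeries_E7_zero
  · refine h ?_
    simp [coxeterExpr, zSer, zNat, hD, coxeter_dynkinA_five qL_ne_zero qL_pow_ne_one]
    field_simp
    ring
  · exact hSeries_E7_two
  all_goals
    refine h ?_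
    simp [coxeterExpr, zSer, zNat, coxeter_dynkinA_one qL_ne_zero qL_pow_ne_one,
      coxeter_dynkinA_two qL_ne_zero qL_pow_ne_one, coxeter_dynkinA_three qL_ne_zero qL_pow_ne_one,
      coxeter_dynkinA_five qL_ne_zero qL_pow_ne_one]
    field_simp
    ring

theorem hSeries_E8_zero_eq_det : E8.hSeries (some (0 : Fin 9)) =
    (zMat zL (Matrix.submatrix (m := Fin 9) (n := Fin 9) E8.adj Fin.succ Fin.succ :
      Matrix (Fin 8) (Fin 8) ℕ)).det := E8.hSeries_zero

theorem zMat_mulVec_E8 :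
    (zMat zL (E8.adj : Matrix (Fin 9) (Fin 9) ℕ)).mulVec (fun i => E8.zSer i.val) =
      Pi.single 0 (E8.zSeries none) := E8.zMat_mulVec_zSer

theorem hSeries_E8_chain :
    E8.hSeries (some (0 : Fin 9)) = coxeter qL (dynkinE 8) ∧
    E8.hSeries (some (1 : Fin 9)) = coxeter qL (dynkinE 7) ∧
    E8.hSeries (some (2 : Fin 9)) = coxeter qL (dynkinE 6) ∧
    E8.hSeries (some (4 : Fin 9)) = coxeter qL (dynkinA 4) := by
  rw [coxeter_dynkinA_eq_det qL_ne_zero, coxeter_dynkinE_eq_det qL_ne_zero (by norm_num),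
    coxeter_dynkinE_eq_det qL_ne_zero (by norm_num),
    coxeter_dynkinE_eq_det qL_ne_zero (by norm_num)]
  have h1 := zMat_mulVec_tail zMat_mulVec_E8 (by decide)
  have h2 := zMat_mulVec_tail h1 (by decide)
  have h3 := zMat_mulVec_tail h2 (by decide)
  have h4 := zMat_mulVec_tail h3 (by decide)
  have e1 := E8.hSeries_succ_of_tail (i := (1 : Fin 9)) hSeries_E8_zero_eq_det h1 rfl
  have e2 := E8.hSeries_succ_of_tail (i := (2 : Fin 9)) e1 h2 rfl
  have e3 := E8.hSeries_succ_of_tail (i := (3 : Fin 9)) e2 h3 rfl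
  have e4 := E8.hSeries_succ_of_tail (i := (4 : Fin 9)) e3 h4 rfl
  refine ⟨hSeries_E8_zero_eq_det.trans ?_, e1.trans ?_, e2.trans ?_, e4.trans ?_⟩
  · rw [← det_zMat_submatrix_equiv _ (dynkinE 8)
      ⟨![6, 5, 4, 3, 2, 1, 0, 7], ![6, 5, 4, 3, 2, 1, 0, 7], by decide, by decide⟩]
    congr 2
    decide
  · rw [← det_zMat_submatrix_equiv _ (dynkinE 7)
      ⟨![5, 4, 3, 2, 1, 0, 6], ![5, 4, 3, 2, 1, 0, 6], by decide, by decide⟩]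
    congr 2
    decide
  · congr 2
    decide
  · rw [← det_zMat_submatrix_equiv _ (dynkinA 4)
      ⟨![2, 1, 0, 3], ![2, 1, 0, 3], by decide, by decide⟩]
    congr 2
    decide

theorem hSeries_E8 (i : Fin 9) : E8.hSeries (some i) = E8.coxeterExpr qL i := by
  have hq := qL_ne_zero
  obtain ⟨h0, h1, h2, h4⟩ := hSeries_E8_chain
  have h : ∀ {i : Fin 9} {x : ℚ⸨X⸩}, x * E8.zSer 4 = E8.zSer i.val * coxeter qL (dynkinA 4) →
      E8.hSeries (some i) = x := fun h => hSeries_eq_of_mul _ h4 h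
  have hD := coxeter_dynkinD (k := 5) qL_ne_zero qL_pow_ne_one (by norm_num)
  fin_cases i
  · exact h0
  · exact h1
  · exact h2
  · refine h ?_
    simp [coxeterExpr, zSer, zNat, hD, coxeter_dynkinA_four qL_ne_zero qL_pow_ne_one]
    field_simp
    ring
  · exact h4
  all_goals
    refine h ?_
    simp [coxeterExpr, zSer, zNat, coxeter_dynkinA_one qL_ne_zero qL_pow_ne_one,
      coxeter_dynkinA_two qL_ne_zero qL_pow_ne_one, coxeter_dynkinA_four qL_ne_zero qL_pow_ne_one]
    field_simp
    ring

theorem hSeries_eq_coxeterExpr (T : AffineDiagram) (i : T.Vertex) :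
    T.hSeries (some i) = T.coxeterExpr qL i := by
  cases T with
  | A n hn => exact hSeries_A n hn i
  | D n hn => exact hSeries_D n hn i
  | E6 => exact hSeries_E6 i
  | E7 => exact hSeries_E7 i
  | E8 => exact hSeries_E8 i

/-! ### The trees rooted at the affine vertex -/

/-- The neighbour of `i ≠ 0` which is closer to the vertex `0`, for the diagrams without cycles; the
values for `Ã_n` and for `i = 0` are not used. -/
def parNat : AffineDiagram → ℕ → ℕ
  | A _ _, i => i - 1
  | D n _, i => if i = 1 then 2 else if i = 2 then 0 else if i = n then n - 2 else i - 1
  | E6, i => if i = 5 then 2 else i - 1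
  | E7, i => if i = 7 then 3 else i - 1
  | E8, i => if i = 8 then 5 else i - 1

/-- The distance from `i` to the vertex `0`, for the diagrams without cycles; the values for `Ã_n` are
not used. -/
def depthNat : AffineDiagram → ℕ → ℕ
  | A _ _, i => i
  | D n _, i => if i = 0 then 0 else if i = 1 then 2 else if i = n then n - 2 else i - 1
  | E6, i => if 5 ≤ i then i - 2 else i
  | E7, i => if i = 7 then 4 else i
  | E8, i => if i = 8 then 6 else i

theorem parNat_spec (T : AffineDiagram) (hT : ¬ T.IsCycle) {u v : ℕ} (hu : u < T.rank + 1)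
    (hv : v ∈ T.nbrs u) :
    (T.parNat u = v ∧ T.depthNat u = T.depthNat v + 1) ∨
      (T.parNat v = u ∧ T.depthNat v = T.depthNat u + 1) := by
  cases T with
  | A n hn => exact absurd trivial hT
  | D n hn =>
    simp only [rank] at hu
    simp only [nbrs] at hv
    simp only [parNat, depthNat]
    split_ifs at hv <;>
      simp only [List.cons_append, List.nil_append, List.mem_cons, List.not_mem_nil, or_false]
        at hv <;> grind
  | E6 => exact (by decide : ∀ u < 7, ∀ v ∈ E6.nbrs u, (E6.parNat u = v ∧
      E6.depthNat u = E6.depthNat v + 1) ∨ (E6.parNat v = u ∧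
        E6.depthNat v = E6.depthNat u + 1)) u hu v hv
  | E7 => exact (by decide : ∀ u < 8, ∀ v ∈ E7.nbrs u, (E7.parNat u = v ∧
      E7.depthNat u = E7.depthNat v + 1) ∨ (E7.parNat v = u ∧
        E7.depthNat v = E7.depthNat u + 1)) u hu v hv
  | E8 => exact (by decide : ∀ u < 9, ∀ v ∈ E8.nbrs u, (E8.parNat u = v ∧
      E8.depthNat u = E8.depthNat v + 1) ∨ (E8.parNat v = u ∧
        E8.depthNat v = E8.depthNat u + 1)) u hu v hv

theorem parNat_mem (T : AffineDiagram) (hT : ¬ T.IsCycle) {u : ℕ} (hu : u < T.rank + 1)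
    (h0 : u ≠ 0) :
    T.parNat u ∈ T.nbrs u ∧ T.depthNat u = T.depthNat (T.parNat u) + 1 := by
  cases T with
  | A n hn => exact absurd trivial hT
  | D n hn =>
    simp only [rank] at hu
    simp only [nbrs, parNat, depthNat]
    constructor
    · split_ifs <;>
        simp only [List.cons_append, List.nil_append, List.mem_cons, List.not_mem_nil, or_false]
          <;> grind
    · grind
  | E6 => exact (by decide : ∀ u < 7, u ≠ 0 → E6.parNat u ∈ E6.nbrs u ∧
      E6.depthNat u = E6.depthNat (E6.parNat u) + 1) u hu h0
  | E7 => exact (by decide : ∀ u < 8, u ≠ 0 → E7.parNat u ∈ E7.nbrs u ∧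
      E7.depthNat u = E7.depthNat (E7.parNat u) + 1) u hu h0
  | E8 => exact (by decide : ∀ u < 9, u ≠ 0 → E8.parNat u ∈ E8.nbrs u ∧
      E8.depthNat u = E8.depthNat (E8.parNat u) + 1) u hu h0

theorem nodup_nbrs (T : AffineDiagram) (hT : ¬ T.IsCycle) {u : ℕ} (hu : u < T.rank + 1) :
    (T.nbrs u).Nodup := by
  cases T with
  | A n hn => exact absurd trivial hT
  | D n hn =>
    simp only [nbrs]
    split_ifs <;>
      simp only [List.cons_append, List.nil_append, List.nodup_cons, List.mem_cons,
        List.not_mem_nil, or_false, not_or, List.nodup_nil, not_false_iff, and_true] <;> omega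
  | E6 => exact (by decide : ∀ u < 7, (E6.nbrs u).Nodup) u hu
  | E7 => exact (by decide : ∀ u < 8, (E7.nbrs u).Nodup) u hu
  | E8 => exact (by decide : ∀ u < 9, (E8.nbrs u).Nodup) u hu

theorem adj_ne_zero_iff (T : AffineDiagram) (i j : T.Vertex) :
    T.adj i j ≠ 0 ↔ j.val ∈ T.nbrs i.val := by
  rw [adj_eq_count, ← Nat.pos_iff_ne_zero, List.count_pos_iff]

theorem adj_eq_one (T : AffineDiagram) (hT : ¬ T.IsCycle) {i j : T.Vertex} (h : T.adj i j ≠ 0) :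
    T.adj i j = 1 := by
  rw [adj_eq_count]
  exact List.count_eq_one_of_mem (T.nodup_nbrs hT i.2) ((T.adj_ne_zero_iff i j).1 h)

/-! ### Coxeter polynomials of the subgraphs of the affine diagrams -/

/-- The Coxeter polynomial of a full subgraph without cycles is its characteristic polynomial. A
cycle becomes a chain when a vertex is removed. -/
theorem coxeter_submatrix_adj (T : AffineDiagram) {V K : Type} [Fintype V] [LinearOrder V]
    [Field K] {q : K} (hq : q ≠ 0) {f : V → T.Vertex} (hf : Function.Injective f)
    (h : T.IsCycle → ∃ r, ∀ i, f i ≠ r) :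
    coxeter q (T.adj.submatrix f f) = (zMat (q + q⁻¹) (T.adj.submatrix f f)).det := by
  have hs : (T.adj.submatrix f f).IsSymm := T.adj_isSymm.submatrix f
  have hd : ∀ i, T.adj.submatrix f f i i = 0 := fun i => T.adj_self (f i)
  by_cases hT : T.IsCycle
  · obtain ⟨r, hr⟩ := h hT
    have hr' : ∀ i, (f i).val ≠ r.val := fun i h => hr i (Fin.ext h)
    cases T with
    | A n hn =>
      have hrn : r.val < n + 1 := r.2
      refine coxeter_eq_det_of_isParent hq hs hd
        (Adj := fun u v => u < n + 1 ∧ v ∈ (A n hn).nbrs u ∧ u ≠ r.val ∧ v ≠ r.val)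
        (par := fun u => if u = 0 then n else u - 1)
        (depth := fun u => if u < r.val then u + n - r.val else u - r.val - 1)
        ?_ (fun i => (f i).val) (Fin.val_injective.comp hf) fun i j hij =>
          ⟨(f i).2, ((A n hn).adj_ne_zero_iff _ _).1 hij, hr' i, hr' j⟩
      rintro u v ⟨hu, hv, hur, hvr⟩
      simp only [nbrs, List.mem_cons, List.not_mem_nil, or_false] at hv
      grind
    | D n hn => exact hT.elim
    | E6 => exact hT.elim
    | E7 => exact hT.elim
    | E8 => exact hT.elim
  · exact coxeter_eq_det_of_isParent hq hs hd (Adj := fun u v => u < T.rank + 1 ∧ v ∈ T.nbrs u)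
      (fun u v huv => T.parNat_spec hT huv.1 huv.2) (fun i => (f i).val)
      (Fin.val_injective.comp hf) fun i j hij => ⟨(f i).2, (T.adj_ne_zero_iff _ _).1 hij⟩

/-- `H_{-1,0}` is the Coxeter polynomial of the diagram, unless the diagram is a cycle numbered in
an unsuitable way. -/
theorem hSeries_none_eq_coxeter (T : AffineDiagram) (e : Equiv.Perm T.Vertex)
    (h : ¬ T.IsCycle ∨ ∃ s : ℕ, ∀ i j : T.Vertex, T.adj (e i) (e j) ≠ 0 →
      (i.val < s ↔ s ≤ j.val)) :
    T.hSeries none = coxeter qL (T.adj.submatrix e e) := by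
  have h1 : T.hSeries none = (zMat zL (T.adj.submatrix e e)).det := by
    rw [hSeries, aeval_hPoly_none, det_zMat_submatrix_equiv]
  rw [h1, zL]
  rcases h with h | ⟨s, h⟩
  · rw [T.coxeter_submatrix_adj qL_ne_zero e.injective fun hT => absurd hT h]
  · rw [coxeter_eq_det_of_bipartite qL_ne_zero (T.adj_isSymm.submatrix e)
      (fun i => T.adj_self (e i)) s h]

theorem coxeter_removeVertices (T : AffineDiagram) (s : Finset T.Vertex) (hs : s.Nonempty) :
    coxeter qL (removeVertices T.adj s) =
      ((zMat zL T.adj).toSquareBlockProp (fun v => v ∉ s)).det := by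
  obtain ⟨r, hr⟩ := hs
  rw [removeVertices, T.coxeter_submatrix_adj qL_ne_zero Subtype.val_injective
    fun _ => ⟨r, fun (i : {v // v ∉ s}) hi => i.2 (hi ▸ hr)⟩]
  have : (zMat zL T.adj).toSquareBlockProp (fun v => v ∉ s) =
      zMat zL (T.adj.submatrix (Subtype.val : {v // v ∉ s} → _) Subtype.val) := by
    rw [← zMat_submatrix _ _ Subtype.val_injective]
    rfl
  rw [this, zL]
  congr!

/-- The determinant of the matrix of the cofactors of the vertices `0` and `i`. -/
theorem hSeries_sq (T : AffineDiagram) {i : T.Vertex} (hi : i ≠ 0) :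
    T.hSeries (some i) ^ 2 =
      T.hSeries (some 0) * coxeter qL (removeVertices T.adj {i}) -
        T.hSeries none * coxeter qL (removeVertices T.adj {0, i}) := by
  have hs := T.zMat_adj_isSymm zL
  have hdet : (zMat zL T.adj).det ≠ 0 := det_zMat_zL_ne_zero T.adj
  rw [T.coxeter_removeVertices _ (Finset.singleton_nonempty i),
    T.coxeter_removeVertices _ (Finset.insert_nonempty 0 _), ← adjugate_self_eq_det _ hdet,
    hSeries, hSeries, hSeries, aeval_hPoly_none, aeval_hPoly_some, aeval_hPoly_some,
    ← adjugate_mul_sub_eq_det _ hdet hi.symm]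
  have h : (zMat zL T.adj).adjugate 0 i = (zMat zL T.adj).adjugate i 0 := by
    have h := congrFun (congrFun (Matrix.adjugate_transpose (zMat zL T.adj)) i) 0
    rw [hs.eq] at h
    exact h
  rw [h]
  ring

end AffineDiagram

theorem McKay.poincare_sq {B : Subgroup SU2} [Finite B] {T : AffineDiagram} (M : McKay B T)
    {i : T.Vertex} (hi : i ≠ 0) :
    (M.poincare i : LaurentSeries ℚ) ^ 2 =
      1 / (qL * T.hSeries none) *
        (!![(M.poincare 0 : LaurentSeries ℚ), coxeter qL (removeVertices T.adj {0, i});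
            qL⁻¹, coxeter qL (removeVertices T.adj {i})]).det := by
  have h := T.hSeries_sq hi
  have hq := qL_ne_zero
  have hT := T.hSeries_none_ne_zero
  rw [Matrix.det_fin_two_of, M.poincare_eq_div, M.poincare_eq_div, div_pow, h]
  field_simp

/-! ### The cycles with an odd number of vertices -/

theorem add_inv_pow_odd {K : Type*} [Field K] {q : K} (hq : q ≠ 0) (m : ℕ) :
    (q + q⁻¹) ^ (2 * m + 1) = ∑ i ∈ Finset.range (m + 1),
      ((2 * m + 1).choose i : K) * (q ^ (2 * m + 1 - 2 * i) + (q ^ (2 * m + 1 - 2 * i))⁻¹) := by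
  rw [add_pow, show 2 * m + 1 + 1 = (m + 1) + (m + 1) by ring, Finset.sum_range_add]
  -- the terms `i` and `2 m + 1 - i` have the same coefficient
  rw [← Finset.sum_range_reflect (fun x => q ^ (m + 1 + x) * q⁻¹ ^ (2 * m + 1 - (m + 1 + x)) * _) (m + 1),
    ← Finset.sum_add_distrib]
  refine Finset.sum_congr rfl fun i hi => ?_
  have hi' := Finset.mem_range.1 hi
  obtain ⟨j, rfl⟩ : ∃ j, m = i + j := ⟨m - i, by omega⟩
  have h1 : (2 * (i + j) + 1).choose (i + 2 * j + 1) = (2 * (i + j) + 1).choose i :=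
    Nat.choose_symm_of_eq_add (by ring)
  rw [show i + j + 1 + (i + j + 1 - 1 - i) = i + 2 * j + 1 by omega,
    show 2 * (i + j) + 1 - i = i + 2 * j + 1 by omega,
    show 2 * (i + j) + 1 - (i + 2 * j + 1) = i by omega,
    show 2 * (i + j) + 1 - 2 * i = 2 * j + 1 by omega, h1, inv_pow, inv_pow]
  field_simp
  ring

theorem aeval_zL_charPoly_cycle {n : ℕ} (hn : 1 ≤ n) :
    aeval zL (charPoly (cycle n)) = qL ^ (n + 1) + (qL ^ (n + 1))⁻¹ - 2 :=
  AffineDiagram.hSeries_A_none n hn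

theorem charPoly_cycle_even {m : ℕ} (hm : 1 ≤ m) :
    aeval zL (charPoly (cycle (2 * m))) =
      zL ^ (2 * m + 1) - ∑ i ∈ Finset.Icc 1 (m - 1), ((2 * m + 1).choose i : LaurentSeries ℚ) *
        (aeval zL (charPoly (cycle (2 * m - 2 * i))) + 2) -
          ((2 * m + 1).choose m : LaurentSeries ℚ) * zL - 2 := by
  have h : ∑ i ∈ Finset.Icc 1 (m - 1), ((2 * m + 1).choose i : LaurentSeries ℚ) *
      (aeval zL (charPoly (cycle (2 * m - 2 * i))) + 2) =
      ∑ i ∈ Finset.Ico 1 m, ((2 * m + 1).choose i : LaurentSeries ℚ) *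
        (qL ^ (2 * m + 1 - 2 * i) + (qL ^ (2 * m + 1 - 2 * i))⁻¹) := by
    rw [show Finset.Icc 1 (m - 1) = Finset.Ico 1 m by ext; simp; omega]
    refine Finset.sum_congr rfl fun i hi => ?_
    have hi' := Finset.mem_Ico.1 hi
    rw [aeval_zL_charPoly_cycle (by omega),
      show 2 * m - 2 * i + 1 = 2 * m + 1 - 2 * i by omega]
    ring
  rw [h, aeval_zL_charPoly_cycle (by omega), zL, add_inv_pow_odd qL_ne_zero,
    Finset.sum_range_succ, Finset.range_eq_Ico, Finset.sum_eq_sum_Ico_succ_bot (by omega)]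
  rw [show 2 * m + 1 - 2 * m = 1 by omega]
  simp
  ring

theorem charPoly_cycle_even_eq_sq {m : ℕ} (hm : 1 ≤ m) :
    qL * aeval zL (charPoly (cycle (2 * m))) =
      (qL ^ (2 * m))⁻¹ * (qL ^ (2 * m + 1) - 1) ^ 2 := by
  have hq := qL_ne_zero
  rw [aeval_zL_charPoly_cycle (by omega)]
  field_simp
  ring

namespace AffineDiagram

/-! ### Branches -/

theorem extGraph_adj_some (T : AffineDiagram) (i j : T.Vertex) :
    T.extGraph.Adj (some i) (some j) ↔ T.adj i j ≠ 0 := by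
  rw [extGraph, SimpleGraph.fromRel_adj]
  constructor
  · rintro ⟨-, h | h⟩
    · exact h
    · rw [T.adj_comm]
      exact h
  · intro h
    refine ⟨fun hij => h ?_, Or.inl h⟩
    rw [Option.some_injective _ hij, T.adj_self]

theorem extGraph_adj_none (T : AffineDiagram) (i : T.Vertex) :
    T.extGraph.Adj (some i) none ↔ i = 0 := by
  rw [extGraph, SimpleGraph.fromRel_adj]
  simp

/-- Summation over the neighbours of a vertex in the extended diagram. -/
theorem sum_adj_eq_of_neighborSet (T : AffineDiagram) (hT : ¬ T.IsCycle) {R : Type*}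
    [CommRing R] (g : Option T.Vertex → R) {i : T.Vertex} {u w : Option T.Vertex} (huw : u ≠ w)
    (h : T.extGraph.neighborSet (some i) = {u, w}) :
    (∑ j, (T.adj i j : R) * g (some j)) + (if i = 0 then g none else 0) = g u + g w := by
  classical
  have h1 : ∀ v, T.extGraph.Adj (some i) v ↔ v = u ∨ v = w := fun v => by
    rw [← SimpleGraph.mem_neighborSet, h]
    rfl
  have h2 : ∑ v, (if v = u ∨ v = w then g v else 0) = g u + g w := by
    rw [← Finset.sum_filter, ← Finset.sum_pair huw]
    congr 1
    ext
    simp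
  rw [← h2, Fintype.sum_option, add_comm]
  congr 1
  · simp only [← h1, extGraph_adj_none]
  · refine Finset.sum_congr rfl fun j _ => ?_
    simp only [← h1, extGraph_adj_some]
    split_ifs with h3
    · rw [T.adj_eq_one hT h3, Nat.cast_one, one_mul]
    · rw [not_not.1 h3, Nat.cast_zero, zero_mul]

theorem IsBranch.recurrence {T : AffineDiagram} (hT : ¬ T.IsCycle) {k : ℕ}
    {v : ℕ → Option T.Vertex} (h : T.IsBranch k v) {t : ℕ} (h1 : 1 ≤ t) (h2 : t < k) :
    T.hPoly (v (t - 1)) = X * T.hPoly (v t) - T.hPoly (v (t + 1)) := by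
  have hne : v (t - 1) ≠ v (t + 1) := fun he => by
    have := h.injOn (show t - 1 ∈ Set.Iic k by simp; omega)
      (show t + 1 ∈ Set.Iic k by simp; omega) he
    omega
  have hn := h.interior t h1 h2
  rcases hv : v t with _ | i
  · -- the vertex `-1` is joined to the vertex `0` only
    have h3 : ∀ s, s ∈ T.extGraph.neighborSet (v t) → s = some 0 := by
      rw [hv]
      rintro (_ | j) hs
      · exact absurd hs (T.extGraph.loopless.irrefl _)
      · rw [(T.extGraph_adj_none j).1 (T.extGraph.adj_symm hs)]
    rw [hn] at h3
    exact absurd ((h3 _ (by simp)).trans (h3 _ (by simp)).symm) hne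
  · rw [hv] at hn
    rw [T.hPoly_eq, T.sum_adj_eq_of_neighborSet hT T.hPoly hne hn]
    ring

end AffineDiagram

theorem bez_mul_sub {f g h : ℂ → ℂ} (hf : ∀ q, f q = (q + q⁻¹) * g q - h q) {x y : ℂ}
    (hx : x ≠ 0) (hy : y ≠ 0) (hxy : x ≠ y) :
    bez f g x y = (1 - (x * y)⁻¹) * (g x * g y) + bez g h x y := by
  have : x - y ≠ 0 := sub_ne_zero.2 hxy
  rw [bez, bez, hf, hf]
  field_simp
  ring

theorem deriv_add_inv_mul {g : ℂ → ℂ} {x : ℂ} (hx : x ≠ 0) (hg : DifferentiableAt ℂ g x) :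
    HasDerivAt (fun q => (q + q⁻¹) * g q) ((1 - (x ^ 2)⁻¹) * g x + (x + x⁻¹) * deriv g x) x := by
  have h := ((hasDerivAt_id x).add (hasDerivAt_inv hx)).mul hg.hasDerivAt
  exact h

theorem wr_mul_sub {f g h : ℂ → ℂ} (hf : ∀ q, f q = (q + q⁻¹) * g q - h q) {x : ℂ}
    (hx : x ≠ 0) (hg : DifferentiableAt ℂ g x) (hh : DifferentiableAt ℂ h x) :
    wr f g x = (1 - (x ^ 2)⁻¹) * g x ^ 2 + wr g h x := by
  have h1 := ((deriv_add_inv_mul hx hg).sub hh.hasDerivAt).deriv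
  rw [show (fun q => (q + q⁻¹) * g q) - h = f by funext q; simp [hf q]] at h1
  rw [wr, wr, h1, hf]
  ring

namespace AffineDiagram

theorem differentiableAt_hFun (T : AffineDiagram) (i : Option T.Vertex) {x : ℂ} (hx : x ≠ 0) :
    DifferentiableAt ℂ (T.hFun i) x := by
  have h1 : DifferentiableAt ℂ (fun q : ℂ => q + q⁻¹) x :=
    differentiableAt_id.add (differentiableAt_inv hx)
  have h2 : T.hFun i = (fun z : ℂ => aeval z (T.hPoly i)) ∘ fun q => q + q⁻¹ := rfl
  rw [h2]
  exact (Polynomial.differentiableAt_aeval _).comp x h1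

theorem IsBranch.branchFormulas {T : AffineDiagram} (hT : ¬ T.IsCycle) {k : ℕ}
    {v : ℕ → Option T.Vertex} (h : T.IsBranch k v) : BranchFormulas T k v := by
  set c : ℕ → ℚ⸨X⸩ := fun t => T.hSeries (v t) with hc
  have hc0 : ∀ t, c t ≠ 0 := fun t => T.hSeries_ne_zero _
  have rec1 : ∀ i, i + 1 < k → c i = zL * c (i + 1) - c (i + 2) := fun i hi => by
    have := congrArg (aeval zL) (h.recurrence hT (t := i + 1) (by omega) hi)
    rw [map_sub, map_mul, aeval_X] at this
    exact this
  have rec2 : ∀ i, i + 1 < k → ∀ q, T.hFun (v i) q =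
      (q + q⁻¹) * T.hFun (v (i + 1)) q - T.hFun (v (i + 2)) q := fun i hi q => by
    have := congrArg (aeval (q + q⁻¹)) (h.recurrence hT (t := i + 1) (by omega) hi)
    rw [map_sub, map_mul, aeval_X] at this
    exact this
  have transfer : ∀ i, i + 1 < k → !![c i, c (i + 1); c (i + 1), c (i + 2)] =
      !![0, 1; -1, zL] ^ i * !![c 0, c 1; c 1, c 2] := fun i => by
    induction i with
    | zero => simp
    | succ i ih =>
      intro hi
      rw [pow_succ', mul_assoc, ← ih (by omega), Matrix.mul_fin_two, rec1 i (by omega),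
        rec1 (i + 1) hi]
      ext x y
      fin_cases x <;> fin_cases y <;> simp
  -- all determinants of the matrices in the transfer formula are equal
  have det : ∀ i, i + 1 < k → c i * c (i + 2) - c (i + 1) * c (i + 1) =
      (!![c 0, c 1; c 1, c 2]).det := fun i hi => by
    have := congrArg Matrix.det (transfer i hi)
    rw [Matrix.det_mul, Matrix.det_pow, Matrix.det_fin_two_of, Matrix.det_fin_two_of 0] at this
    rw [this]
    ring
  -- the last three formulas hold trivially for `i = k`, and descend
  have quotient : ∀ d i, i + 1 + d = k → c i / c (i + 1) = (!![c 0, c 1; c 1, c 2]).det *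
      ∑ j ∈ Finset.Icc (i + 2) k, 1 / (c (j - 1) * c j) + c (k - 1) / c k := fun d => by
    induction d with
    | zero =>
      rintro i rfl
      simp
    | succ d ih =>
      intro i hi
      have h1 := ih (i + 1) (by omega)
      rw [show Finset.Icc (i + 2) k = insert (i + 2) (Finset.Icc (i + 3) k) by ext; simp; omega,
        Finset.sum_insert (by simp), mul_add, add_assoc, ← h1, ← det i (by omega)]
      have e1 := hc0 (i + 1)
      have e2 := hc0 (i + 2)
      rw [show i + 2 - 1 = i + 1 by omega]
      field_simp
      ring
  have frac : ∀ d i, i + 1 + d = k →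
      c (i + 1) / c i = contFrac zL (c k / c (k - 1)) (k - (i + 1)) := fun d => by
    induction d with
    | zero =>
      rintro i rfl
      simp [contFrac]
    | succ d ih =>
      intro i hi
      have h1 := ih (i + 1) (by omega)
      rw [show k - (i + 1) = k - (i + 1 + 1) + 1 by omega, contFrac, ← h1]
      have e0 := hc0 i
      have e1 := hc0 (i + 1)
      have e2 : zL - c (i + 1 + 1) / c (i + 1) = c i / c (i + 1) := by
        rw [rec1 i (by omega)]
        field_simp
      rw [e2, one_div_div]
  have bezoutian : ∀ d i, i + 1 + d = k → ∀ x y : ℂ, x ≠ 0 → y ≠ 0 → x ≠ y →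
      bez (T.hFun (v i)) (T.hFun (v (i + 1))) x y =
        (1 - (x * y)⁻¹) * ∑ j ∈ Finset.Ico (i + 1) k, T.hFun (v j) x * T.hFun (v j) y +
        bez (T.hFun (v (k - 1))) (T.hFun (v k)) x y := fun d => by
    induction d with
    | zero =>
      rintro i rfl
      simp
    | succ d ih =>
      intro i hi x y hx hy hxy
      rw [bez_mul_sub (rec2 i (by omega)) hx hy hxy, ih (i + 1) (by omega) x y hx hy hxy,
        Finset.sum_eq_sum_Ico_succ_bot (show i + 1 < k by omega), mul_add,
        add_assoc _ _ (_ : ℂ)]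
  have wronskian : ∀ d i, i + 1 + d = k → ∀ x : ℂ, x ≠ 0 →
      wr (T.hFun (v i)) (T.hFun (v (i + 1))) x =
        (1 - (x ^ 2)⁻¹) * ∑ j ∈ Finset.Ico (i + 1) k, T.hFun (v j) x ^ 2 +
        wr (T.hFun (v (k - 1))) (T.hFun (v k)) x := fun d => by
    induction d with
    | zero =>
      rintro i rfl
      simp
    | succ d ih =>
      intro i hi x hx
      rw [wr_mul_sub (rec2 i (by omega)) hx (T.differentiableAt_hFun _ hx)
        (T.differentiableAt_hFun _ hx), ih (i + 1) (by omega) x hx,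
        Finset.sum_eq_sum_Ico_succ_bot (show i + 1 < k by omega), mul_add,
        add_assoc _ _ (_ : ℂ)]
  constructor <;> intro i h1 h2 <;> obtain ⟨i, rfl⟩ : ∃ t, i = t + 1 := ⟨i - 1, by omega⟩ <;>
    rw [Nat.add_sub_cancel]
  · rw [← sub_eq_zero.2 (rec1 i h2)]
    ring
  · exact transfer i h2
  · exact quotient (k - (i + 1)) i (by omega)
  · exact frac (k - (i + 1)) i (by omega)
  · exact bezoutian (k - (i + 1)) i (by omega)
  · exact wronskian (k - (i + 1)) i (by omega)

end AffineDiagram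

/-! ### Christoffel–Darboux identities -/

/-- The matrix versions follow from the identity for the Bezoutian; the determinant is computed by
the Cauchy–Binet formula. -/
theorem ChristoffelDarboux.of_bezoutian {ι : Type} [LinearOrder ι] {Ω : Set ℂ} {Bz : ℂ → ℂ → ℂ}
    {W : ℂ → ℂ} {S : Finset ι} {f : ι → ℂ → ℂ}
    (hB : ∀ x ∈ Ω, ∀ y ∈ Ω, x ≠ y → Bz x y = (1 - (x * y)⁻¹) * ∑ k ∈ S, f k x * f k y)
    (hW : ∀ x ∈ Ω, W x = (1 - (x ^ 2)⁻¹) * ∑ k ∈ S, f k x ^ 2) :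
    ChristoffelDarboux Ω Bz W S f := by
  have key : ∀ x ∈ Ω, ∀ y ∈ Ω, x ≠ y ∧ x * y ≠ 1 →
      Bz x y / (1 - (x * y)⁻¹) = ∑ k ∈ S, f k x * f k y := by
    intro x hx y hy hxy
    have h1 : 1 - (x * y)⁻¹ ≠ 0 := fun h => hxy.2 (by
      rw [← inv_inv (x * y), ← sub_eq_zero.1 h, inv_one])
    rw [hB x hx y hy hxy.1, mul_div_cancel_left₀ _ h1]
  refine ⟨hB, hW, fun m l x y hx hy hxy => ?_, fun m x y hx hy hxy => ?_⟩
  · ext s t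
    simp only [Matrix.of_apply, Matrix.mul_apply, Matrix.transpose_apply]
    rw [key _ (hx s) _ (hy t) (hxy s t), Finset.sum_coe_sort S fun k => f k (x s) * f k (y t)]
  · rw [← det_sum_mul_eq S m (fun s k => f k (x s)) (fun t k => f k (y t))]
    congr 1
    ext s t
    exact key _ (hx s) _ (hy t) (hxy s t)

namespace AffineDiagram

/-- The weights of the edges of the extended diagram. -/
def extWeight (T : AffineDiagram) (k : T.Vertex) : Option T.Vertex → ℕ
  | none => if k = 0 then 1 else 0
  | some j => T.adj k j

/-- A family of differentiable functions which satisfies the equations `z F_k = ∑ a_{kv} F_v`,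
where `z = q + q⁻¹`, at the vertices `k` of the diagram; the sum is over the vertices of the
extended diagram. -/
structure IsHarmonic (T : AffineDiagram) (Ω : Set ℂ) (F : Option T.Vertex → ℂ → ℂ) : Prop where
  isOpen : IsOpen Ω
  ne_zero : ∀ q ∈ Ω, q ≠ 0
  differentiableAt : ∀ v, ∀ q ∈ Ω, DifferentiableAt ℂ (F v) q
  eq : ∀ k, ∀ q ∈ Ω, (q + q⁻¹) * F (some k) q = ∑ v, (T.extWeight k v : ℂ) * F v q

theorem IsHarmonic.eq_deriv {T : AffineDiagram} {Ω : Set ℂ} {F : Option T.Vertex → ℂ → ℂ}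
    (hF : T.IsHarmonic Ω F) (k : T.Vertex) {x : ℂ} (hx : x ∈ Ω) :
    (1 - (x ^ 2)⁻¹) * F (some k) x + (x + x⁻¹) * deriv (F (some k)) x =
      ∑ v, (T.extWeight k v : ℂ) * deriv (F v) x := by
  have h1 := deriv_add_inv_mul (hF.ne_zero x hx) (hF.differentiableAt (some k) x hx)
  have h2 : HasDerivAt (fun q => ∑ v, (T.extWeight k v : ℂ) * F v q)
      (∑ v, (T.extWeight k v : ℂ) * deriv (F v) x) x :=
    HasDerivAt.fun_sum fun v _ => (hF.differentiableAt v x hx).hasDerivAt.const_mul _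
  refine h1.unique (h2.congr_of_eventuallyEq ?_)
  filter_upwards [hF.isOpen.mem_nhds hx] with q hq using hF.eq k q hq

/-- Green's formula for a set of vertices, with an alternating form given by the pairs of vertices
in the list `L` as the boundary term, implies the Christoffel–Darboux identities: apply it to
`F(x)` and `F(y)` for the Bezoutians, and to `F'(x)` and `F(x)` for the Wronskians. -/
theorem IsHarmonic.christoffelDarboux {T : AffineDiagram} {Ω : Set ℂ}
    {F : Option T.Vertex → ℂ → ℂ} (hF : T.IsHarmonic Ω F) {ι : Type} [LinearOrder ι]
    (S : Finset ι) (e : ι → T.Vertex) (L : List (Option T.Vertex × Option T.Vertex))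
    (hG : ∀ u w : Option T.Vertex → ℂ, ∑ k ∈ S,
      ((∑ v, (T.extWeight (e k) v : ℂ) * u v) * w (some (e k)) -
        u (some (e k)) * ∑ v, (T.extWeight (e k) v : ℂ) * w v) =
          (L.map fun p => u p.1 * w p.2 - u p.2 * w p.1).sum) :
    ChristoffelDarboux Ω (fun x y => (L.map fun p => bez (F p.1) (F p.2) x y).sum)
      (fun x => (L.map fun p => wr (F p.1) (F p.2) x).sum) S (fun k => F (some (e k))) := by
  refine ChristoffelDarboux.of_bezoutian (fun x hx y hy hxy => ?_) fun x hx => ?_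
  · have h := hG (fun v => F v x) (fun v => F v y)
    simp only [← hF.eq _ x hx, ← hF.eq _ y hy] at h
    have hxy' : x - y ≠ 0 := sub_ne_zero.2 hxy
    have hx0 := hF.ne_zero x hx
    have hy0 := hF.ne_zero y hy
    have h1 : (L.map fun p => bez (F p.1) (F p.2) x y).sum =
        (L.map fun p => F p.1 x * F p.2 y - F p.2 x * F p.1 y).sum / (x - y) := by
      rw [div_eq_mul_inv, ← List.sum_map_mul_right]
      congr 1
      refine List.map_congr_left fun p _ => ?_
      rw [bez]
      ring
    rw [h1, ← h, div_eq_iff hxy', Finset.mul_sum, Finset.sum_mul]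
    refine Finset.sum_congr rfl fun k _ => ?_
    field_simp
    ring
  · have h := hG (fun v => deriv (F v) x) (fun v => F v x)
    simp only [← hF.eq _ x hx, ← hF.eq_deriv _ hx] at h
    have h1 : (L.map fun p => wr (F p.1) (F p.2) x).sum =
        (L.map fun p => deriv (F p.1) x * F p.2 x - deriv (F p.2) x * F p.1 x).sum := by
      congr 1
      refine List.map_congr_left fun p _ => ?_
      rw [wr]
      ring
    rw [h1, ← h, Finset.mul_sum]
    refine Finset.sum_congr rfl fun k _ => ?_
    ring

/-- Green's formula for a set of vertices which is joined to the other vertices by a single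
edge. -/
theorem sum_green_of_boundary (T : AffineDiagram) (S : Finset T.Vertex) {i : T.Vertex}
    {p : Option T.Vertex} (hi : i ∈ S) (hp : ∀ k ∈ S, p ≠ some k)
    (h : ∀ k ∈ S, ∀ v, (∀ l ∈ S, v ≠ some l) → T.extWeight k v ≠ 0 → k = i ∧ v = p)
    (hip : T.extWeight i p = 1) (u w : Option T.Vertex → ℂ) :
    ∑ k ∈ S, ((∑ v, (T.extWeight k v : ℂ) * u v) * w (some k) -
      u (some k) * ∑ v, (T.extWeight k v : ℂ) * w v) = u p * w (some i) - u (some i) * w p := by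
  classical
  set g : T.Vertex → Option T.Vertex → ℂ := fun k v =>
    (T.extWeight k v : ℂ) * (u v * w (some k) - u (some k) * w v) with hg
  have h1 : ∀ k, (∑ v, (T.extWeight k v : ℂ) * u v) * w (some k) -
      u (some k) * ∑ v, (T.extWeight k v : ℂ) * w v = ∑ v, g k v := fun k => by
    rw [Finset.sum_mul, Finset.mul_sum, ← Finset.sum_sub_distrib]
    refine Finset.sum_congr rfl fun v _ => ?_
    rw [hg]
    ring
  -- the edges inside `S` contribute `0`, since their two orientations cancel
  have h2 : ∑ k ∈ S, ∑ l ∈ S, g k (some l) = 0 := by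
    rw [← self_eq_neg]
    conv_lhs => rw [Finset.sum_comm]
    rw [← Finset.sum_neg_distrib]
    refine Finset.sum_congr rfl fun k _ => ?_
    rw [← Finset.sum_neg_distrib]
    refine Finset.sum_congr rfl fun l _ => ?_
    simp only [hg, extWeight]
    rw [T.adj_comm]
    ring
  have h3 : ∀ k ∈ S, ∑ v, g k v = ∑ l ∈ S, g k (some l) + if k = i then g i p else 0 := by
    intro k hk
    rw [← Finset.sum_add_sum_compl (S.map Function.Embedding.some) (g k), Finset.sum_map]
    congr 1
    have h4 : ∀ v ∈ (S.map Function.Embedding.some)ᶜ, T.extWeight k v ≠ 0 → k = i ∧ v = p :=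
      fun v hv => h k hk v fun l hl hvl => by
        rw [Finset.mem_compl] at hv
        exact hv (Finset.mem_map.2 ⟨l, hl, hvl.symm⟩)
    split_ifs with hki
    · subst hki
      refine Finset.sum_eq_single p (fun v hv hvp => ?_) fun hp' => ?_
      · have : T.extWeight k v = 0 := by_contra fun h0 => hvp (h4 v hv h0).2
        simp [hg, this]
      · rw [Finset.mem_compl, not_not, Finset.mem_map] at hp'
        obtain ⟨l, hl, hlp⟩ := hp'
        exact absurd hlp.symm (hp l hl)
    · refine Finset.sum_eq_zero fun v hv => ?_
      have : T.extWeight k v = 0 := by_contra fun h0 => hki (h4 v hv h0).1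
      simp [hg, this]
  rw [Finset.sum_congr rfl fun k _ => h1 k, Finset.sum_congr rfl h3, Finset.sum_add_distrib, h2,
    Finset.sum_ite_eq', if_pos hi, hg]
  simp [hip]

/-- Green's formula for an interval of a cycle. -/
theorem sum_green_cycle (T : AffineDiagram) (hT : T.IsCycle) {i j : ℕ} (hi : 1 ≤ i) (hij : i ≤ j)
    (hj : j ≤ T.rank) (u w : Option T.Vertex → ℂ) :
    let e : ℕ → T.Vertex := Fin.ofNat (T.rank + 1)
    ∑ k ∈ Finset.Icc i j,
      ((∑ v, (T.extWeight (e k) v : ℂ) * u v) * w (some (e k)) -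
        u (some (e k)) * ∑ v, (T.extWeight (e k) v : ℂ) * w v) =
      u (some (e (i - 1))) * w (some (e i)) - u (some (e i)) * w (some (e (i - 1))) +
      (u (some (e (j + 1))) * w (some (e j)) - u (some (e j)) * w (some (e (j + 1)))) := by
  intro e
  have key : ∀ k, 1 ≤ k → k ≤ T.rank → ∀ u : Option T.Vertex → ℂ,
      ∑ v, (T.extWeight (e k) v : ℂ) * u v = u (some (e (k - 1))) + u (some (e (k + 1))) := by
    intro k hk1 hk2 u
    have hek : (e k).val = k := Nat.mod_eq_of_lt (by omega)
    have he : ∀ l : T.Vertex, e l.val = l := fun l => Fin.ext (Nat.mod_eq_of_lt l.2)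
    have h0 : e k ≠ 0 := fun h => by
      rw [h, Fin.val_zero] at hek
      omega
    have h1 := T.sum_adj_mul (e k) (fun m => u (some (e m)))
    simp only [he] at h1
    rw [Fintype.sum_option]
    simp only [extWeight, if_neg h0, Nat.cast_zero, zero_mul, zero_add]
    rw [h1, hek]
    cases T with
    | A n hn =>
      have h2 : k = n → e (k + 1) = e 0 := by
        rintro rfl
        exact Fin.ext (Nat.mod_self _)
      simp only [nbrs, List.map_cons, List.map_nil, List.sum_cons, List.sum_nil, add_zero,
        if_neg (show k ≠ 0 by omega)]
      split_ifs with hkn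
      · rw [h2 hkn, add_comm]
      · rw [add_comm]
    | D n hn => exact hT.elim
    | E6 => exact hT.elim
    | E7 => exact hT.elim
    | E8 => exact hT.elim
  induction j, hij using Nat.le_induction with
  | base =>
    rw [Finset.Icc_self, Finset.sum_singleton, key i hi hj, key i hi hj]
    ring
  | succ j hij ih =>
    rw [← Finset.insert_Icc_right_eq_Icc_add_one (by omega), Finset.sum_insert (by simp),
      ih (by omega), key (j + 1) (by omega) hj, key (j + 1) (by omega) hj, Nat.add_sub_cancel]
    ring

/-! ### Shortest paths in the extended trees -/

/-- The parent of a vertex in the extended tree with the root `-1`. -/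
def parent (T : AffineDiagram) (i : T.Vertex) : Option T.Vertex :=
  if i = 0 then none else some (Fin.ofNat (T.rank + 1) (T.parNat i.val))

/-- The distance to the vertex `-1` in the extended tree. -/
def depth (T : AffineDiagram) : Option T.Vertex → ℕ
  | none => 0
  | some i => T.depthNat i.val + 1

theorem extWeight_ne_zero (T : AffineDiagram) (k : T.Vertex) (v : Option T.Vertex) :
    T.extWeight k v ≠ 0 ↔ T.extGraph.Adj (some k) v := by
  rcases v with _ | v
  · rw [extGraph_adj_none, extWeight]
    simp
  · exact (T.extGraph_adj_some k v).symm

section Tree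
variable {T : AffineDiagram} (hT : ¬ T.IsCycle)
include hT

theorem val_ofNat_parNat {i : T.Vertex} (h0 : i ≠ 0) :
    (Fin.ofNat (T.rank + 1) (T.parNat i.val)).val = T.parNat i.val :=
  Nat.mod_eq_of_lt (T.lt_of_mem_nbrs i.val i.2 _
    (T.parNat_mem hT i.2 fun h => h0 (Fin.ext h)).1)

theorem parent_spec (i : T.Vertex) :
    T.extGraph.Adj (some i) (T.parent i) ∧ T.depth (some i) = T.depth (T.parent i) + 1 := by
  rw [parent]
  split_ifs with h0
  · refine ⟨(T.extGraph_adj_none i).2 h0, ?_⟩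
    have : T.depthNat 0 = 0 := by
      cases T with
      | A n hn => rfl
      | _ => rfl
    simp [depth, h0, this]
  · have h := T.parNat_mem hT i.2 fun h => h0 (Fin.ext h)
    rw [extGraph_adj_some, adj_ne_zero_iff, depth, depth, val_ofNat_parNat hT h0]
    exact ⟨h.1, congrArg (· + 1) h.2⟩

theorem eq_parent_of_adj {u : T.Vertex} {v : Option T.Vertex} (h : T.extGraph.Adj (some u) v) :
    v = T.parent u ∨ ∃ w, v = some w ∧ T.parent w = some u ∧
      T.depth (some w) = T.depth (some u) + 1 := by
  rcases v with _ | v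
  · left
    rw [parent, if_pos ((T.extGraph_adj_none u).1 h)]
  · have h1 := (T.adj_ne_zero_iff _ _).1 ((T.extGraph_adj_some _ _).1 h)
    have key : ∀ {a b : T.Vertex}, T.parNat a.val = b.val →
        T.depthNat a.val = T.depthNat b.val + 1 → T.parent a = some b := fun {a b} ha hd => by
      have h0 : a ≠ 0 := by
        rintro rfl
        have : T.depthNat 0 = 0 := by
          cases T with
          | A n hn => rfl
          | _ => rfl
        rw [Fin.val_zero, this] at hd
        omega
      rw [parent, if_neg h0]
      congr 1
      exact Fin.ext ((val_ofNat_parNat hT h0).trans ha)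
    rcases T.parNat_spec hT u.2 h1 with ⟨h2, h3⟩ | ⟨h2, h3⟩
    · exact Or.inl (key h2 h3).symm
    · exact Or.inr ⟨v, rfl, key h2 h3, congrArg (· + 1) h3⟩

theorem depth_le_of_adj {u v : Option T.Vertex} (h : T.extGraph.Adj u v) :
    T.depth u ≤ T.depth v + 1 := by
  rcases u with _ | u
  · exact Nat.zero_le _
  · rcases eq_parent_of_adj hT h with rfl | ⟨w, rfl, -, h3⟩
    · exact (parent_spec hT u).2.le
    · omega

theorem depth_le_length {u : Option T.Vertex} (w : T.extGraph.Walk u none) :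
    T.depth u ≤ w.length := by
  generalize hv : (none : Option T.Vertex) = v at w
  induction w with
  | nil => subst hv; exact le_rfl
  | cons h w ih =>
    rw [SimpleGraph.Walk.length_cons]
    exact (depth_le_of_adj hT h).trans (Nat.add_le_add_right (ih hv) 1)

theorem exists_walk_length (u : Option T.Vertex) :
    ∃ w : T.extGraph.Walk u none, w.length = T.depth u := by
  induction hd : T.depth u generalizing u with
  | zero =>
    rcases u with _ | u
    · exact ⟨.nil, rfl⟩
    · exact absurd hd (Nat.succ_ne_zero _)
  | succ d ih =>
    rcases u with _ | u
    · exact absurd hd.symm (Nat.succ_ne_zero _)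
    · obtain ⟨h1, h2⟩ := parent_spec hT u
      obtain ⟨w, hw⟩ := ih (T.parent u) (by omega)
      exact ⟨.cons h1 w, by rw [SimpleGraph.Walk.length_cons, hw]⟩

theorem dist_none (u : Option T.Vertex) : T.extGraph.dist u none = T.depth u := by
  obtain ⟨w, hw⟩ := exists_walk_length hT u
  refine le_antisymm (hw ▸ SimpleGraph.dist_le w) ?_
  obtain ⟨w', hw'⟩ := SimpleGraph.Reachable.exists_walk_length_eq_dist ⟨w⟩
  rw [← hw']
  exact depth_le_length hT w'

theorem isNext_iff (i : T.Vertex) (p : Option T.Vertex) : T.IsNext i p ↔ p = T.parent i := by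
  rw [IsNext, dist_none hT, dist_none hT]
  constructor
  · rintro ⟨h1, h2⟩
    rcases eq_parent_of_adj hT h1 with h | ⟨w, rfl, -, h3⟩
    · exact h
    · omega
  · rintro rfl
    obtain ⟨h1, h2⟩ := parent_spec hT i
    exact ⟨h1, by omega⟩

theorem mem_beyond (i k : T.Vertex) : k ∈ T.beyond i ↔
    ∀ w : T.extGraph.Walk (some k) none, w.length = T.depth (some k) → some i ∈ w.support := by
  classical
  rw [beyond, Finset.mem_filter, dist_none hT]
  simp

/-- A shortest path to the root consists of the edge to the parent and a shortest path from the
parent to the root. -/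
theorem exists_eq_cons {k : T.Vertex} (w : T.extGraph.Walk (some k) none)
    (hw : w.length = T.depth (some k)) :
    ∃ w' : T.extGraph.Walk (T.parent k) none, w'.length = T.depth (T.parent k) ∧
      w.support = some k :: w'.support := by
  obtain ⟨-, h2⟩ := parent_spec hT k
  cases w with
  | cons h w' =>
    rw [SimpleGraph.Walk.length_cons] at hw
    have h3 := depth_le_length hT w'
    rcases eq_parent_of_adj hT h with rfl | ⟨l, rfl, -, h4⟩
    · exact ⟨w', by omega, SimpleGraph.Walk.support_cons _ _⟩
    · omega

theorem mem_beyond_iff (i k : T.Vertex) :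
    k ∈ T.beyond i ↔ k = i ∨ ∃ l, T.parent k = some l ∧ l ∈ T.beyond i := by
  obtain ⟨h1, h2⟩ := parent_spec hT k
  constructor
  · intro hk
    by_cases hki : k = i
    · exact Or.inl hki
    right
    rw [mem_beyond hT] at hk
    rcases hp : T.parent k with _ | l
    · rw [hp] at h1 h2
      have := hk (.cons h1 .nil) (by rw [h2]; rfl)
      simp at this
      exact absurd this.symm hki
    · refine ⟨l, rfl, (mem_beyond hT i l).2 fun w hw => ?_⟩
      rw [hp] at h1 h2
      have := hk (.cons h1 w) (by rw [h2, SimpleGraph.Walk.length_cons, hw])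
      rw [SimpleGraph.Walk.support_cons, List.mem_cons] at this
      exact this.resolve_left fun h => hki (Option.some_injective _ h).symm
  · rintro (rfl | ⟨l, hl, hli⟩)
    · exact (mem_beyond hT k k).2 fun w _ => w.start_mem_support
    · refine (mem_beyond hT i k).2 fun w hw => ?_
      obtain ⟨w', hw', hs⟩ := exists_eq_cons hT w hw
      rw [hs]
      revert w'
      rw [hl]
      intro w' hw' _
      exact List.mem_cons_of_mem _ ((mem_beyond hT i l).1 hli w' hw')

theorem depth_le_of_mem_beyond {i : T.Vertex} : ∀ (d : ℕ) (k : T.Vertex),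
    T.depth (some k) = d → k ∈ T.beyond i → T.depth (some i) ≤ d := fun d => by
  induction d with
  | zero =>
    intro k hk
    exact absurd hk (Nat.succ_ne_zero _)
  | succ d ih =>
    intro k hk hki
    rcases (mem_beyond_iff hT i k).1 hki with rfl | ⟨l, hl, hli⟩
    · exact hk.le
    · have h2 := (parent_spec hT k).2
      rw [hl] at h2
      have := ih l (by omega) hli
      omega

theorem extWeight_eq_one {k : T.Vertex} {v : Option T.Vertex}
    (h : T.extGraph.Adj (some k) v) : T.extWeight k v = 1 := by
  rcases v with _ | v
  · rw [extWeight, if_pos ((T.extGraph_adj_none k).1 h)]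
  · exact T.adj_eq_one hT ((T.extGraph_adj_some k v).1 h)

/-- The vertices beyond `i` are joined to the other vertices only by the edge from `i` to its
parent. -/
theorem sum_green_beyond (i : T.Vertex) (u w : Option T.Vertex → ℂ) :
    ∑ k ∈ T.beyond i, ((∑ v, (T.extWeight k v : ℂ) * u v) * w (some k) -
      u (some k) * ∑ v, (T.extWeight k v : ℂ) * w v) =
        u (T.parent i) * w (some i) - u (some i) * w (T.parent i) := by
  obtain ⟨h1, h2⟩ := parent_spec hT i
  refine T.sum_green_of_boundary _ ((mem_beyond_iff hT i i).2 (Or.inl rfl)) ?_ ?_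
    (extWeight_eq_one hT h1) u w
  · intro k hk hik
    rw [hik] at h2
    have := depth_le_of_mem_beyond hT _ k rfl hk
    omega
  · intro k hk v hv hkv
    rw [extWeight_ne_zero] at hkv
    rcases eq_parent_of_adj hT hkv with rfl | ⟨l, rfl, hl, -⟩
    · rcases (mem_beyond_iff hT i k).1 hk with rfl | ⟨l, hl, hli⟩
      · exact ⟨rfl, rfl⟩
      · exact absurd hl (hv l hli)
    · exact absurd rfl (hv l ((mem_beyond_iff hT i l).2 (Or.inr ⟨k, hl, hk⟩)))

end Tree

theorem IsHarmonic.bezoutIdentities {T : AffineDiagram} {Ω : Set ℂ}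
    {F : Option T.Vertex → ℂ → ℂ} (hF : T.IsHarmonic Ω F) : BezoutIdentities T Ω F := by
  refine ⟨?_, fun hT i p hp => ?_, fun hT i j hi hij hj => ?_⟩
  · have h := hF.christoffelDarboux Finset.univ id [(none, some 0)] fun u w => by
      have := T.sum_green_of_boundary Finset.univ (Finset.mem_univ 0) (p := none) (by simp) (by
        rintro k - (_ | l) hv hk
        · exact ⟨by_contra fun h0 => hk (if_neg h0), rfl⟩
        · exact absurd rfl (hv l (Finset.mem_univ l)))
        (show (if (0 : T.Vertex) = 0 then 1 else 0) = 1 from if_pos rfl) u w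
      simpa using this
    simpa using h
  · rw [isNext_iff hT] at hp
    subst hp
    have h := hF.christoffelDarboux (T.beyond i) id [(T.parent i, some i)] fun u w => by
      have := sum_green_beyond hT i u w
      simpa using this
    simpa using h
  · have h := hF.christoffelDarboux (Finset.Icc i j) (Fin.ofNat (T.rank + 1))
      [(some (Fin.ofNat (T.rank + 1) (i - 1)), some (Fin.ofNat (T.rank + 1) i)),
        (some (Fin.ofNat (T.rank + 1) (j + 1)), some (Fin.ofNat (T.rank + 1) j))] fun u w => by
      have := T.sum_green_cycle hT hi hij hj u w
      simpa using this
    simpa using h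

end AffineDiagram

/-! ### The functions `P_i(q)` and `Z_i(q)` -/

namespace AffineDiagram

/-- The equations at the vertices, with the additional vertex written separately. -/
theorem sum_extWeight_mul (T : AffineDiagram) (k : T.Vertex) (u : Option T.Vertex → ℂ) :
    ∑ v, (T.extWeight k v : ℂ) * u v =
      ∑ j, (T.adj k j : ℂ) * u (some j) + if k = 0 then u none else 0 := by
  rw [Fintype.sum_option, add_comm]
  congr 1
  simp [extWeight]

theorem isHarmonic_zFun (T : AffineDiagram) : T.IsHarmonic {q | q ≠ 0} T.zFun where
  isOpen := isOpen_ne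
  ne_zero _ hq := hq
  differentiableAt v q hq := by
    rcases v with _ | i
    · have h0 := differentiableAt_inv (𝕜 := ℂ) hq
      have h : T.zFun none = fun q => q⁻¹ * (1 - q ^ T.expA) * (1 - q ^ T.expB) := rfl
      rw [h]
      fun_prop
    · exact Polynomial.differentiableAt_aeval (T.zPoly i)
  eq k q hq := by
    have h := congrFun (T.zMat_mulVec_zPoly (K := ℂ) hq) k
    rw [zMat_mulVec, Pi.single_apply, sub_eq_iff_eq_add'] at h
    rw [sum_extWeight_mul]
    exact h

/-- The vector of the numbers `Z_i(1)` spans the kernel of the affine Cartan matrix. -/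
theorem two_mul_eval_one_zPoly (T : AffineDiagram) (i : T.Vertex) :
    2 * (T.zPoly i).eval 1 = ∑ j, (T.adj i j : ℤ) * (T.zPoly j).eval 1 := by
  have h := congrArg (Polynomial.eval 1) (T.zPoly_eq i)
  have h0 : Polynomial.eval 1 (if i = 0 then (1 - X ^ T.expA) * (1 - X ^ T.expB) else 0 : ℤ[X]) =
      0 := by
    split_ifs <;> simp
  rw [Polynomial.eval_add, h0] at h
  simpa [Polynomial.eval_finsetSum, one_add_one_eq_two] using h

end AffineDiagram

section
variable {B : Subgroup SU2} [Finite B] {T : AffineDiagram} (M : McKay B T)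

/-- The multiplicities grow linearly, since `∑ i, Z_i(1) m_{n,i}` is an arithmetic progression. -/
theorem McKay.sum_eval_one_zPoly_mul_mult (n : ℕ) :
    ∑ i, (T.zPoly i).eval 1 * (M.mult n i : ℤ) = (n + 1) * (T.zPoly 0).eval 1 := by
  set d : T.Vertex → ℤ := fun i => (T.zPoly i).eval 1 with hd
  have h0 : ∑ i, d i * (M.mult 0 i : ℤ) = d 0 := by
    simp [M.mult_zero]
  have hs : ∀ m : T.Vertex → ℤ, ∑ i, d i * ∑ j, (T.adj i j : ℤ) * m j = 2 * ∑ i, d i * m i := by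
    intro m
    simp_rw [Finset.mul_sum]
    rw [Finset.sum_comm]
    refine Finset.sum_congr rfl fun j _ => ?_
    rw [← mul_assoc, T.two_mul_eval_one_zPoly, Finset.sum_mul]
    refine Finset.sum_congr rfl fun i _ => ?_
    rw [T.adj_comm]
    ring
  induction n using Nat.twoStepInduction with
  | zero => simpa using h0
  | one =>
    have h1 := hs fun j => (M.mult 0 j : ℤ)
    rw [h0] at h1
    have h2 : ∀ i, (M.mult 1 i : ℤ) = ∑ j, (T.adj i j : ℤ) * (M.mult 0 j : ℤ) := fun i => by
      exact_mod_cast M.mult_one i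
    refine (Finset.sum_congr rfl fun i _ => congrArg _ (h2 i)).trans (h1.trans ?_)
    norm_num [hd]
  | more n ih1 ih2 =>
    have h1 := hs fun j => (M.mult (n + 1) j : ℤ)
    have h2 : ∀ i, (M.mult (n + 2) i : ℤ) =
        ∑ j, (T.adj i j : ℤ) * (M.mult (n + 1) j : ℤ) - M.mult n i := fun i => by
      rw [eq_sub_iff_add_eq]
      exact_mod_cast M.mult_add_two n i
    simp_rw [h2, mul_sub, Finset.sum_sub_distrib]
    rw [h1, ih2, ih1]
    push_cast
    ring

theorem McKay.mult_le (n : ℕ) (i : T.Vertex) :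
    (M.mult n i : ℤ) ≤ (n + 1) * (T.zPoly 0).eval 1 := by
  rw [← M.sum_eval_one_zPoly_mul_mult n]
  have h0 : ∀ j, 0 ≤ (T.zPoly j).eval 1 * (M.mult n j : ℤ) := fun j =>
    mul_nonneg (T.eval_one_zPoly_pos j).le (Nat.cast_nonneg _)
  refine le_trans ?_ (Finset.single_le_sum (fun j _ => h0 j) (Finset.mem_univ i))
  exact le_mul_of_one_le_left (Nat.cast_nonneg _) (T.eval_one_zPoly_pos i)

/-- A summable bound for the terms of the series `P_i(q)` and of its tails, for `|q| ≤ r < 1`. -/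
theorem McKay.norm_mult_mul_pow_le (m n : ℕ) (i : T.Vertex) {q : ℂ} {r : ℝ} (hq : ‖q‖ ≤ r) :
    ‖(M.mult (n + m) i : ℂ) * q ^ n‖ ≤
      ((n : ℝ) * r ^ n + (m + 1) * r ^ n) * ((T.zPoly 0).eval 1 : ℤ) := by
  have h1 : (M.mult (n + m) i : ℝ) ≤ ((n + m : ℕ) + 1) * ((T.zPoly 0).eval 1 : ℤ) := by
    exact_mod_cast M.mult_le (n + m) i
  have h2 : ‖q‖ ^ n ≤ r ^ n := pow_le_pow_left₀ (norm_nonneg _) hq n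
  rw [norm_mul, norm_pow, Complex.norm_natCast]
  calc _ ≤ (((n + m : ℕ) + 1) * ((T.zPoly 0).eval 1 : ℤ)) * r ^ n :=
        mul_le_mul h1 h2 (by positivity) (le_trans (Nat.cast_nonneg _) h1)
    _ = _ := by
      push_cast
      ring

theorem summable_bound {r : ℝ} (hr0 : 0 ≤ r) (hr : r < 1) (m : ℕ) (c : ℝ) :
    Summable fun n : ℕ => ((n : ℝ) * r ^ n + (m + 1) * r ^ n) * c := by
  have hr' : ‖r‖ < 1 := by rwa [Real.norm_of_nonneg hr0]
  have h1 := summable_pow_mul_geometric_of_norm_lt_one 1 hr'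
  simp only [pow_one] at h1
  exact (h1.add ((summable_geometric_of_lt_one hr0 hr).mul_left _)).mul_right _

theorem McKay.summable_shift (m : ℕ) (i : T.Vertex) {q : ℂ} (hq : ‖q‖ < 1) :
    Summable fun n => (M.mult (n + m) i : ℂ) * q ^ n :=
  Summable.of_norm_bounded (summable_bound (norm_nonneg q) hq m _)
    fun n => M.norm_mult_mul_pow_le m n i le_rfl

theorem McKay.differentiableAt_pFun (v : Option T.Vertex) {q : ℂ} (hq : q ∈ puncturedDisc) :
    DifferentiableAt ℂ (M.pFun v) q := by
  rcases v with _ | i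
  · exact differentiableAt_inv (norm_pos_iff.1 hq.1)
  · obtain ⟨r, hqr, hr⟩ := exists_between hq.2
    have h : DifferentiableOn ℂ (fun q => ∑' n, (M.mult n i : ℂ) * q ^ n) (Metric.ball 0 r) := by
      refine Complex.differentiableOn_tsum_of_summable_norm
        (summable_bound ((norm_nonneg q).trans hqr.le) hr 0 _) (fun n => ?_) Metric.isOpen_ball
        fun n w hw => M.norm_mult_mul_pow_le 0 n i (mem_ball_zero_iff.1 hw).le
      fun_prop
    exact h.differentiableAt (Metric.isOpen_ball.mem_nhds (mem_ball_zero_iff.2 hqr))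

/-- The tails of the series `P_i(q)`. -/
theorem McKay.tsum_shift (m : ℕ) (i : T.Vertex) {q : ℂ} (hq : ‖q‖ < 1) :
    ∑' n, (M.mult (n + m) i : ℂ) * q ^ n =
      M.mult m i + q * ∑' n, (M.mult (n + (m + 1)) i : ℂ) * q ^ n := by
  rw [(M.summable_shift m i hq).tsum_eq_zero_add, ← tsum_mul_left]
  congr 1
  · simp
  · refine tsum_congr fun n => ?_
    rw [show n + 1 + m = n + (m + 1) by ring]
    ring

theorem McKay.isHarmonic_pFun : T.IsHarmonic puncturedDisc M.pFun where
  isOpen := (isOpen_lt continuous_const continuous_norm).inter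
    (isOpen_lt continuous_norm continuous_const)
  ne_zero _ hq := norm_pos_iff.1 hq.1
  differentiableAt v _ hq := M.differentiableAt_pFun v hq
  eq k q hq := by
    have hq0 : q ≠ 0 := norm_pos_iff.1 hq.1
    rw [T.sum_extWeight_mul]
    have e0 := fun i => M.tsum_shift 0 i hq.2
    have e1 := fun i => M.tsum_shift 1 i hq.2
    have e2 : ∑' n, (M.mult (n + 2) k : ℂ) * q ^ n + ∑' n, (M.mult n k : ℂ) * q ^ n =
        ∑ j, (T.adj k j : ℂ) * ∑' n, (M.mult (n + 1) j : ℂ) * q ^ n := by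
      have h0 : Summable fun n => (M.mult n k : ℂ) * q ^ n := M.summable_shift 0 k hq.2
      rw [← (M.summable_shift 2 k hq.2).tsum_add h0]
      simp_rw [← tsum_mul_left]
      rw [← Summable.tsum_finsetSum fun j _ => (M.summable_shift 1 j hq.2).mul_left _]
      refine tsum_congr fun n => ?_
      have : (M.mult (n + 2) k : ℂ) + M.mult n k = ∑ j, (T.adj k j : ℂ) * M.mult (n + 1) j := by
        exact_mod_cast M.mult_add_two n k
      rw [← add_mul, this, Finset.sum_mul]
      exact Finset.sum_congr rfl fun j _ => mul_assoc _ _ _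
    have e3 : (M.mult 1 k : ℂ) = ∑ j, (T.adj k j : ℂ) * M.mult 0 j := by
      exact_mod_cast M.mult_one k
    have e4 : (M.mult 0 k : ℂ) = if k = 0 then 1 else 0 := by
      rw [M.mult_zero]
      split_ifs <;> simp
    simp only [add_zero, zero_add, one_add_one_eq_two] at e0 e1
    have e5 : ∑ j, (T.adj k j : ℂ) * M.pFun (some j) q =
        M.mult 1 k + q * (∑' n, (M.mult (n + 2) k : ℂ) * q ^ n + M.pFun (some k) q) := by
      have : ∀ j, M.pFun (some j) q = M.mult 0 j + q * ∑' n, (M.mult (n + 1) j : ℂ) * q ^ n := e0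
      simp_rw [this, mul_add, Finset.sum_add_distrib, e3]
      congr 1
      rw [← mul_add, ← this, ← mul_add]
      simp only [McKay.pFun]
      rw [e2, Finset.mul_sum]
      refine Finset.sum_congr rfl fun j _ => ?_
      ring
    have e6 : M.pFun (some k) q = M.mult 0 k +
        q * (M.mult 1 k + q * ∑' n, (M.mult (n + 2) k : ℂ) * q ^ n) := by
      rw [← e1, ← e0]
      rfl
    have e7 : (if k = 0 then M.pFun none q else 0) = q⁻¹ * M.mult 0 k := by
      rw [e4]
      split_ifs <;> simp [McKay.pFun]
    rw [e5, e7, add_mul]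
    nth_rewrite 2 [e6]
    field_simp
    ring

end

/-! ### The expansion in powers of the inverse of `z` -/

theorem weightedPaths_eq_pow {V : Type} [Fintype V] [LinearOrder V] (a : Matrix V V ℕ) (k : ℕ)
    (i j : V) : weightedPaths a k i j = (a ^ k) i j := by
  simp only [weightedPaths, Finset.sum_filter]
  induction k generalizing i with
  | zero =>
    rw [← (Equiv.funUnique (Fin 1) V).symm.sum_comp, pow_zero, Matrix.one_apply,
      Finset.sum_eq_single i]
    · simp
    · intro v _ hv
      simp [hv]
    · simp
  | succ k ih =>
    rw [pow_succ', Matrix.mul_apply, ← (Fin.consEquiv fun _ => V).sum_comp, Fintype.sum_prod_type,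
      Finset.sum_eq_single i]
    · simp_rw [← ih, Finset.mul_sum]
      rw [Finset.sum_comm]
      refine Finset.sum_congr rfl fun v _ => ?_
      rw [Finset.sum_eq_single (v 0)]
      · rw [Fin.prod_univ_succ]
        simp [Fin.consEquiv, ← Fin.succ_last]
      · intro l _ hl
        simp [hl.symm]
      · simp
    · intro x _ hx
      refine Finset.sum_eq_zero fun v _ => ?_
      simp [Fin.consEquiv, hx]
    · simp

/-- The solution of `p = ζ (A p + e)` as a geometric series with a remainder. -/
theorem eq_sum_pow_mul {V R : Type*} [Fintype V] [DecidableEq V] [CommRing R] (A : Matrix V V R)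
    {ζ : R} {p : V → R} {o : V}
    (h : ∀ i, p i = ζ * (∑ j, A i j * p j + if i = o then 1 else 0)) (N : ℕ) (i : V) :
    p i = ∑ k ∈ Finset.range N, (A ^ k) i o * ζ ^ (k + 1) + ζ ^ N * ∑ j, (A ^ N) i j * p j := by
  have h1 : p = ζ • (A.mulVec p + Pi.single o 1) := by
    funext i
    rw [Pi.smul_apply, Pi.add_apply, Pi.single_apply, smul_eq_mul]
    exact h i
  induction N with
  | zero => simp [Matrix.one_apply]
  | succ N ih =>
    have h2 := congrFun (congrArg (A ^ N).mulVec h1) i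
    rw [Matrix.mulVec_smul, Matrix.mulVec_add, Matrix.mulVec_mulVec, ← pow_succ,
      Matrix.mulVec_single_one] at h2
    have h3 : ∑ j, (A ^ N) i j * p j = ζ * (∑ j, (A ^ (N + 1)) i j * p j + (A ^ N) i o) := h2
    rw [Finset.sum_range_succ, add_assoc]
    refine ih.trans (congrArg _ ?_)
    rw [h3]
    ring

section
variable {B : Subgroup SU2} [Finite B] {T : AffineDiagram} (M : McKay B T)

/-- The linear system for the Poincaré series in terms of `z⁻¹`. -/
theorem McKay.X_mul_poincare_eq (i : T.Vertex) :
    PowerSeries.X * M.poincare i = zInv * (∑ j, (T.adj i j : PowerSeries ℚ) *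
      (PowerSeries.X * M.poincare j) + if i = 0 then 1 else 0) := by
  have h1 : (1 + PowerSeries.X ^ 2 : PowerSeries ℚ)⁻¹ * (1 + PowerSeries.X ^ 2) = 1 :=
    PowerSeries.inv_mul_cancel _ (by simp)
  have h2 := M.poincare_eq i
  have h3 : ∑ j, (T.adj i j : PowerSeries ℚ) * (PowerSeries.X * M.poincare j) =
      PowerSeries.X * ∑ j, (T.adj i j : PowerSeries ℚ) * M.poincare j := by
    rw [Finset.mul_sum]
    exact Finset.sum_congr rfl fun j _ => mul_left_comm _ _ _
  rw [h3, zInv, mul_assoc, ← h2]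
  linear_combination (-PowerSeries.X * M.poincare i) * h1

theorem McKay.X_mul_poincare_eq_sum (N : ℕ) (i : T.Vertex) :
    PowerSeries.X * M.poincare i =
      ∑ k ∈ Finset.range N, (((T.adj ^ k) i 0 : ℕ) : PowerSeries ℚ) * zInv ^ (k + 1) +
        zInv ^ N * ∑ j, (((T.adj ^ N) i j : ℕ) : PowerSeries ℚ) *
          (PowerSeries.X * M.poincare j) := by
  have h1 : ∀ k, (T.adj.map (Nat.castRingHom (PowerSeries ℚ))) ^ k =
      (T.adj ^ k).map (Nat.castRingHom (PowerSeries ℚ)) := fun k =>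
    (map_pow (Nat.castRingHom (PowerSeries ℚ)).mapMatrix T.adj k).symm
  have h := eq_sum_pow_mul (T.adj.map (Nat.castRingHom (PowerSeries ℚ))) M.X_mul_poincare_eq N i
  simp only [h1] at h
  exact h

theorem McKay.hasSum_weightedPaths (i : T.Vertex) :
    HasSum (fun k : ℕ => (weightedPaths T.adj k i 0 : PowerSeries ℚ) * zInv ^ (k + 1))
      (PowerSeries.X * M.poincare i) := by
  rw [PowerSeries.WithPiTopology.hasSum_iff_hasSum_coeff]
  intro d
  have h0 : ∀ (N : ℕ) (p : PowerSeries ℚ), d < N → PowerSeries.coeff d (zInv ^ N * p) = 0 :=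
    fun N p hN => by
      rw [zInv, mul_pow, mul_assoc, PowerSeries.coeff_X_pow_mul', if_neg (by omega)]
  rw [M.X_mul_poincare_eq_sum (d + 1) i, map_add, h0 (d + 1) _ (by omega), add_zero, map_sum]
  simp_rw [weightedPaths_eq_pow]
  refine hasSum_sum_of_ne_finset_zero fun k hk => ?_
  rw [mul_comm]
  exact h0 _ _ (by rw [Finset.mem_range] at hk; omega)

end
end Kleinian

theorem mainTheorem2 (B : Subgroup Kleinian.SU2) (hB : Finite B)
    (T : Kleinian.AffineDiagram) (M : Kleinian.McKay B T) :
    -- 1) the ratios of the Poincaré series, and the series themselves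
    ((∀ i : Option T.Vertex, M.pL i ≠ 0 ∧ T.zSeries i ≠ 0 ∧ T.hSeries i ≠ 0) ∧
      (∀ i j : Option T.Vertex,
        M.pL i / M.pL j = T.zSeries i / T.zSeries j ∧
        T.zSeries i / T.zSeries j = T.hSeries i / T.hSeries j) ∧
      (∀ i : T.Vertex, (M.poincare i : LaurentSeries ℚ) =
        T.hSeries (some i) / (Kleinian.qL * T.hSeries none)) ∧
      -- the polynomials H in terms of Coxeter polynomials
      (∀ i : T.Vertex, T.hSeries (some i) = T.coxeterExpr Kleinian.qL i) ∧
      (∀ e : Equiv.Perm T.Vertex,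
        (¬ T.IsCycle ∨ ∃ s : ℕ, ∀ i j : T.Vertex, T.adj (e i) (e j) ≠ 0 →
          (i.val < s ↔ s ≤ j.val)) →
        T.hSeries none = Kleinian.coxeter Kleinian.qL (T.adj.submatrix e e)) ∧
      -- the characteristic polynomials of the odd cycles
      (∀ m : ℕ, 1 ≤ m →
        Kleinian.qL * Polynomial.aeval Kleinian.zL (Kleinian.charPoly (Kleinian.cycle (2 * m))) =
          Kleinian.qL * (Kleinian.zL ^ (2 * m + 1)
            - ∑ i ∈ Finset.Icc 1 (m - 1), ((2 * m + 1).choose i : LaurentSeries ℚ) *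
                (Polynomial.aeval Kleinian.zL
                  (Kleinian.charPoly (Kleinian.cycle (2 * m - 2 * i))) + 2)
            - ((2 * m + 1).choose m : LaurentSeries ℚ) * Kleinian.zL - 2) ∧
        Kleinian.qL * Polynomial.aeval Kleinian.zL (Kleinian.charPoly (Kleinian.cycle (2 * m))) =
          (Kleinian.qL ^ (2 * m))⁻¹ * (Kleinian.qL ^ (2 * m + 1) - 1) ^ 2) ∧
      -- the formulas along the branches
      (¬ T.IsCycle → ∀ (k : ℕ) (v : ℕ → Option T.Vertex), T.IsBranch k v →
        Kleinian.BranchFormulas T k v)) ∧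
    -- 2) the squares of the Poincaré series
    (∀ i : T.Vertex, i ≠ 0 →
      (M.poincare i : LaurentSeries ℚ) ^ 2 =
        1 / (Kleinian.qL * T.hSeries none) *
          (!![(M.poincare 0 : LaurentSeries ℚ),
              Kleinian.coxeter Kleinian.qL (Kleinian.removeVertices T.adj {0, i});
              Kleinian.qL⁻¹,
              Kleinian.coxeter Kleinian.qL (Kleinian.removeVertices T.adj {i})]).det) ∧
    -- 3) Bezoutians and Wronskians
    ((∀ i : T.Vertex, ∀ q : ℂ, ‖q‖ < 1 → Summable fun n => (M.mult n i : ℂ) * q ^ n) ∧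
      (¬ T.IsCycle → ∀ i : T.Vertex, ∃! p, T.IsNext i p) ∧
      Kleinian.BezoutIdentities T Kleinian.puncturedDisc M.pFun ∧
      Kleinian.BezoutIdentities T {q | q ≠ 0} T.zFun) ∧
    -- 4) the expansion in powers of the inverse of z
    (∀ i : T.Vertex,
      HasSum (fun k : ℕ => (Kleinian.weightedPaths T.adj k i 0 : PowerSeries ℚ) *
        Kleinian.zInv ^ (k + 1)) (PowerSeries.X * M.poincare i)) := by
  have := hB
  refine ⟨⟨fun i => ⟨M.pL_ne_zero i, T.zSeries_ne_zero i, T.hSeries_ne_zero i⟩,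
    fun i j => ⟨?_, T.zSeries_div_zSeries i j⟩, M.poincare_eq_div, T.hSeries_eq_coxeterExpr,
    T.hSeries_none_eq_coxeter, fun m hm => ⟨?_, Kleinian.charPoly_cycle_even_eq_sq hm⟩,
    fun hT k v hv => Kleinian.AffineDiagram.IsBranch.branchFormulas hT hv⟩,
    fun i hi => M.poincare_sq hi,
    ⟨fun i q hq => M.summable_shift 0 i hq, fun hT i => ?_, M.isHarmonic_pFun.bezoutIdentities,
    T.isHarmonic_zFun.bezoutIdentities⟩, M.hasSum_weightedPaths⟩
  · rw [M.pL_div_pL, T.zSeries_div_zSeries]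
  · exact congrArg (Kleinian.qL * ·) (Kleinian.charPoly_cycle_even hm)
  · simp_rw [Kleinian.AffineDiagram.isNext_iff hT]
    exact existsUnique_eq
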